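/- **Theorem (Main Convergence Theorem for EF-Landing).** Let $\|\cdot\|_F$, $\langle\cdot,\cdot\rangle$ be the Frobenius norm and inner product, $\mathrm{sym}(M)=\frac12(M+M^\top)$, $\mathrm{skew}(M)=\frac12(M-M^\top)$, $0<\epsilon<3/4$, and $\mathrm{St}^\epsilon=\{X\in\mathbb R^{n\times p}:\|X^\top X-I_p\|_F\le\epsilon\}$. Let $\mathcal D_1,\dots,\mathcal D_N$ ($N\ge1$) be probability distributions, $f_i(X)=\mathbb E_{\xi\sim\mathcal D_i}F(X;\xi)$, $f=\frac1N\sum_i f_i$, and let $\nabla F(X;\xi)$ be the gradient of $F$ in $X$. Put $\mathcal N(X)=\frac14\|X^\top X-I_p\|_F^2$ and $\mathrm{grad}f(X)=\mathrm{skew}(\nabla f(X)X^\top)X$. *Assumptions.* (1) $\|\nabla F(X;\xi_i)\|_F\le L'$ for all $X\in\mathrm{St}^\epsilon$ and almost all $\xi_i\sim\mathcal D_i$, with $L'>0$. (2) Each $f_i$ is differentiable and $\nabla f_i$ is $L_i$-Lipschitz on $\mathrm{St}^\epsilon$; let $\nabla f$ be $L$-Lipschitz on $\mathrm{St}^\epsilon$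 and $\tilde L=(\frac1N\sum_iL_i^2)^{1/2}$. (3) $f$ is bounded below on $\mathrm{St}^\epsilon$. (4) For some $\sigma\ge0$, all $i$ and all $X\in \mathrm{St}^\epsilon$: $\mathbb E_{\xi_i}[\nabla F(X;\xi_i)-\nabla f_i(X)]=0$ and $\mathbb E_{\xi_i}\|\nabla F(X;\xi_i)-\nabla f_i(X)\|_F^2\le\sigma^2$. (5) $\mathcal C$ is a random contractive compressor: $\mathbb E_{\mathcal C}\|\mathcal C(X)-X\|_F^2\le(1-\alpha)\|X\|_F^2$ for all $X\in\mathbb R^{n\times p}$, where $\alpha\in(0,1]$. *Algorithm.* Let $X^0\in\mathrm{St}^\epsilon$, $\eta\in(0,1]$, $\gamma,\lambda>0$. Set $v_i^0=\nabla F(X^0;\xi_i^0)$, $g_i^0=\mathcal C(v_i^0)$, $g^0=\frac1N\sum_ig_i^0$, and for $k\ge0$ $$\tilde g^k=\min\{1,L'/\|g^k\|_F\}\,g^k,\qquad X^{k+1}=X^k-\gamma\big(\mathrm{skew}(\tilde g^k(X^k)^\top)X^k+\lambda X^k((X^k)^\top X^k-I_p)\big),$$ $$v_i^{k+1}=(1-\eta)v_i^k+\eta\nabla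 F(X^{k+1};\xi_i^{k+1}),\quad c_i^k=\mathcal C(v_i^{k+1}-g_i^k),\quad g_i^{k+1}=g_i^k+c_i^k,\quad g^{k+1}=g^k+\tfrac1N\textstyle\sum_ic_i^k,$$ where the samples $\xi_i^k\sim\mathcal D_i$ are independent over $i,k$, and the compressor's randomness is drawn afresh in each round, independently of the samples and of the other rounds. *Constants.* $\theta=1-\sqrt{1-\alpha}$, $\beta=\frac{1-\alpha}{1-\sqrt{1-\alpha}}$, and $(c_1,c_2)=(1,0)$ if $\eta=1$ and $\sigma^2=0$; $(c_1,c_2)=(0,1)$ if $\alpha=1$ (if both apply, either choice is allowed); $c_1=c_2=2$ otherwise. Let $$\mu\ge\frac{2}{3-4\epsilon}\Big(L(1-\epsilon)+3\sqrt{1+\epsilon}\,L'+2\max\{L,L'\}^2\,\frac{1+\epsilon}{\lambda}\Big),$$ let $m(X)=f(X)-\frac12\langle\mathrm{sym}(X^\top\nabla f(X)),X^\top X-I_p\rangle+\mu\mathcal N(X)$ and $m^*=\inf_{\mathrm{St}^\epsilon}m$, and let $$\mathcal L^0=m(X^0)-m^*+\frac{c_1\gamma}{\theta N}\sum_i\|g_i^0-v_i^0\|_F^2+\frac{2c_1\gamma\eta\beta}{\theta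 N}\sum_i\|v_i^0-\nabla f_i(X^0)\|_F^2+\frac{c_2\gamma}{\eta}\Big\|\frac1N\sum_iv_i^0-\nabla f(X^0)\Big\|_F^2 .$$ *Conclusion.* There is a constant $M>0$ depending only on $\epsilon,\lambda,\mu,L,L'$ such that the following holds. Let $L_m>0$ be either a smoothness constant of $m$ on $\mathrm{St}^\epsilon$ ($m$ is differentiable at all points of $\mathrm{St}^\epsilon$ and $\nabla m$ is $L_m$-Lipschitz there), or any number with $L_m\ge M$ (in which case no differentiability of $m$ is needed). Put $a=\frac{2c_1\beta\tilde L^2}{\theta}(1-\eta+\eta^3)+\frac{c_2L^2}{\eta^2}(1-\eta)^2(1+\eta)$ and let $0<\gamma\le\min\{\gamma_s,\gamma_1,\gamma_2\}$, where $$\gamma_s=\min\Big\{\frac{\lambda(1-\epsilon)\epsilon}{(1+\epsilon)^2L'^2+\lambda^2(1+\epsilon)\epsilon^2},\ \sqrt{\frac{\epsilon}{2(1+\epsilon)^2L'^2}},\ \frac1{2\lambda}\Big\},\quad \gamma_1=\frac1{2\sqrt a+2L_m},\quad \gamma_2=\Big(2\sqrt{\tfrac{2\lambda(1+\epsilon)a}{\mu}}+\tfrac{4\lambda(1+\epsilon)L_m}{\mu}\Big)^{-1}.$$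 Then for every $K\ge1$ $$\frac1{4K}\sum_{k=0}^{K-1}\mathbb E\|\mathrm{grad}f(X^k)\|_F^2+\frac{\lambda\mu}{2K}\sum_{k=0}^{K-1}\mathbb E\,\mathcal N(X^k)\le\frac{\mathbb E\mathcal L^0}{\gamma K}+\frac{c_1\eta^2(1-\alpha)\sigma^2}{\theta}+\frac{2c_1\eta^3\beta\sigma^2}{\theta}+\frac{c_2\eta\sigma^2}{N}.$$ -/

import Mathlib

open MeasureTheory ProbabilityTheory

noncomputable section

namespace EFLanding

/-! ### Matrix notions -/

/-- Real `n × p` matrices as a Euclidean space: the norm and the inner product of this space are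
the Frobenius norm and the Frobenius inner product. -/
abbrev Mat (n p : ℕ) : Type := EuclideanSpace ℝ (Fin n × Fin p)

/-- The matrix with the entries of `X`. -/
def toM {n p : ℕ} (X : Mat n p) : Matrix (Fin n) (Fin p) ℝ := Matrix.of fun i j => X (i, j)

/-- A matrix as an element of the Euclidean space of matrices. -/
def ofM {n p : ℕ} (A : Matrix (Fin n) (Fin p) ℝ) : Mat n p :=
  WithLp.toLp 2 fun q => A q.1 q.2

/-- Symmetric part of a square matrix. -/
def symPart {m : ℕ} (A : Matrix (Fin m) (Fin m) ℝ) : Matrix (Fin m) (Fin m) ℝ :=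
  (1 / 2 : ℝ) • (A + A.transpose)

/-- Skew-symmetric part of a square matrix. -/
def skewPart {m : ℕ} (A : Matrix (Fin m) (Fin m) ℝ) : Matrix (Fin m) (Fin m) ℝ :=
  (1 / 2 : ℝ) • (A - A.transpose)

/-- The constraint defect `Xᵀ X - I_p`. -/
def defect {n p : ℕ} (X : Mat n p) : Matrix (Fin p) (Fin p) ℝ := (toM X).transpose * toM X - 1

/-- The safe region `St(p,n)^ε`. -/
def safeRegion (n p : ℕ) (ε : ℝ) : Set (Mat n p) := {X | ‖ofM (defect X)‖ ≤ ε}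

/-- The penalty `𝒩(X) = ¼ ‖Xᵀ X - I_p‖²`. -/
def penalty {n p : ℕ} (X : Mat n p) : ℝ := (1 / 4) * ‖ofM (defect X)‖ ^ 2

/-- `grad(g) = skew(g Xᵀ) X`; for `g = ∇f(X)` this is `grad f(X)`. -/
def rGrad {n p : ℕ} (X g : Mat n p) : Mat n p :=
  ofM (skewPart (toM g * (toM X).transpose) * toM X)

/-- The landing direction `skew(g Xᵀ) X + λ X (Xᵀ X - I_p)`. -/
def landingDir {n p : ℕ} (lam : ℝ) (X g : Mat n p) : Mat n p :=
  rGrad X g + lam • ofM (toM X * defect X)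

/-- Clipping at level `L'`: `min{1, L'/‖g‖} g`. -/
def clip {n p : ℕ} (L' : ℝ) (g : Mat n p) : Mat n p := min 1 (L' / ‖g‖) • g

/-! ### The optimization problem -/

section Problem

variable {n p N : ℕ} {Ξ : Type*} [MeasurableSpace Ξ]

/-- The stochastic gradient `∇F(X; ξ)`: the gradient of `F(·; ξ)` at `X`. -/
def stochGrad (F : Mat n p → Ξ → ℝ) (X : Mat n p) (ξ : Ξ) : Mat n p :=
  gradient (fun Y => F Y ξ) X

/-- The local objective `f_i(X) = 𝔼_{ξ ∼ D_i} F(X; ξ)`. -/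
def localObj (F : Mat n p → Ξ → ℝ) (D : Fin N → Measure Ξ) (i : Fin N) (X : Mat n p) : ℝ :=
  ∫ ξ, F X ξ ∂(D i)

/-- The global objective `f = (1/N) ∑ f_i`. -/
def globalObj (F : Mat n p → Ξ → ℝ) (D : Fin N → Measure Ξ) (X : Mat n p) : ℝ :=
  (1 / (N : ℝ)) * ∑ i, localObj F D i X

/-- The problem is well posed: the expectations `f_i` exist, the losses are almost surely
differentiable at each point of the safe region, and the stochastic gradient is jointly
measurable. -/
structure WellPosed (F : Mat n p → Ξ → ℝ) (D : Fin N → Measure Ξ) (ε : ℝ) : Prop where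
  integrable : ∀ i X, Integrable (F X) (D i)
  differentiable : ∀ i, ∀ X ∈ safeRegion n p ε,
    ∀ᵐ ξ ∂(D i), DifferentiableAt ℝ (fun Y => F Y ξ) X
  measurable : Measurable fun z : Mat n p × Ξ => stochGrad F z.1 z.2

/-- Global gradient bound on the safe region. -/
def GradientBound (F : Mat n p → Ξ → ℝ) (D : Fin N → Measure Ξ) (ε L' : ℝ) : Prop :=
  ∀ i, ∀ X ∈ safeRegion n p ε, ∀ᵐ ξ ∂(D i), ‖stochGrad F X ξ‖ ≤ L'

/-- The gradient of `h` is `ℓ`-Lipschitz on the safe region. -/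
def GradLipschitz (h : Mat n p → ℝ) (ε ℓ : ℝ) : Prop :=
  ∀ X ∈ safeRegion n p ε, ∀ Y ∈ safeRegion n p ε, ‖gradient h X - gradient h Y‖ ≤ ℓ * ‖X - Y‖

/-- Each `f_i` is differentiable, with gradient `L_i`-Lipschitz on the safe region. -/
def LocalSmoothness (F : Mat n p → Ξ → ℝ) (D : Fin N → Measure Ξ) (ε : ℝ)
    (Li : Fin N → ℝ) : Prop :=
  ∀ i, 0 ≤ Li i ∧ Differentiable ℝ (localObj F D i) ∧ GradLipschitz (localObj F D i) ε (Li i)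

/-- The objective is bounded below on the safe region. -/
def LowerBounded (F : Mat n p → Ξ → ℝ) (D : Fin N → Measure Ξ) (ε : ℝ) : Prop :=
  BddBelow (globalObj F D '' safeRegion n p ε)

/-- Unbiased stochastic gradients with variance at most `σ²` on the safe region. -/
def UnbiasedBoundedVariance (F : Mat n p → Ξ → ℝ) (D : Fin N → Measure Ξ) (ε σ : ℝ) : Prop :=
  ∀ i, ∀ X ∈ safeRegion n p ε,
    Integrable (stochGrad F X) (D i) ∧
    ∫ ξ, (stochGrad F X ξ - gradient (localObj F D i) X) ∂(D i) = 0 ∧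
    Integrable (fun ξ => ‖stochGrad F X ξ - gradient (localObj F D i) X‖ ^ 2) (D i) ∧
    ∫ ξ, ‖stochGrad F X ξ - gradient (localObj F D i) X‖ ^ 2 ∂(D i) ≤ σ ^ 2

/-- The averaged smoothness constant `L̃ = √((1/N) ∑ L_i²)`. -/
def avgSmooth (Li : Fin N → ℝ) : ℝ := √((1 / (N : ℝ)) * ∑ i, Li i ^ 2)

end Problem

/-! ### Merit function -/

/-- The merit function `m(X) = f(X) - ½⟨sym(Xᵀ∇f(X)), XᵀX - I⟩ + μ 𝒩(X)`. -/
def merit {n p : ℕ} (f : Mat n p → ℝ) (mu : ℝ) (X : Mat n p) : ℝ :=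
  f X
    - (1 / 2) * inner ℝ (ofM (symPart ((toM X).transpose * toM (gradient f X)))) (ofM (defect X))
    + mu * penalty X

/-- The infimum `m*` of the merit function over the safe region. -/
def meritInf {n p : ℕ} (f : Mat n p → ℝ) (mu ε : ℝ) : ℝ :=
  sInf (merit f mu '' safeRegion n p ε)

/-- `m` is `ℓ`-smooth on the safe region: differentiable at its points, with `ℓ`-Lipschitz
gradient. -/
def SmoothOnSafe {n p : ℕ} (m : Mat n p → ℝ) (ε ℓ : ℝ) : Prop :=
  (∀ X ∈ safeRegion n p ε, DifferentiableAt ℝ m X) ∧ GradLipschitz m ε ℓ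

/-- The lower bound on the merit parameter `μ`. -/
def muBound (ε lam L L' : ℝ) : ℝ :=
  2 / (3 - 4 * ε) * (L * (1 - ε) + 3 * √(1 + ε) * L' + 2 * (max L L') ^ 2 * ((1 + ε) / lam))

/-! ### Compressor and algorithm -/

/-- A (randomized) contractive compressor with factor `α`; `C X s` is the output on input `X`
with random seed `s ∼ ρ`. -/
structure ContractiveCompressor {n p : ℕ} {S : Type*} [MeasurableSpace S]
    (C : Mat n p → S → Mat n p) (ρ : Measure S) (α : ℝ) : Prop where
  measurable : Measurable fun z : Mat n p × S => C z.1 z.2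
  factor_pos : 0 < α
  factor_le_one : α ≤ 1
  integrable : ∀ X, Integrable (fun s => ‖C X s - X‖ ^ 2) ρ
  contract : ∀ X, ∫ s, ‖C X s - X‖ ^ 2 ∂ρ ≤ (1 - α) * ‖X‖ ^ 2

/-- State of the algorithm: iterate `X`, momenta `v i`, local estimates `g i`, and the
estimate `gm` of the master. -/
structure State (n p N : ℕ) where
  X : Mat n p
  v : Fin N → Mat n p
  g : Fin N → Mat n p
  gm : Mat n p

/-- The run of EF-Landing driven by the data samples `ξ i k` and the compressor seeds `ζ k i`
(node `i`, time `k`). -/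
def run {n p N : ℕ} {Ξ S : Type*} (F : Mat n p → Ξ → ℝ) (C : Mat n p → S → Mat n p)
    (lam η γ L' : ℝ) (X₀ : Mat n p) (ξ : Fin N → ℕ → Ξ) (ζ : ℕ → Fin N → S) :
    ℕ → State n p N
  | 0 =>
    let v : Fin N → Mat n p := fun i => stochGrad F X₀ (ξ i 0)
    let g : Fin N → Mat n p := fun i => C (v i) (ζ 0 i)
    { X := X₀, v := v, g := g, gm := (1 / (N : ℝ)) • ∑ i, g i }
  | k + 1 =>
    let s := run F C lam η γ L' X₀ ξ ζ k
    let X := s.X - γ • landingDir lam s.X (clip L' s.gm)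
    let v : Fin N → Mat n p := fun i => (1 - η) • s.v i + η • stochGrad F X (ξ i (k + 1))
    let c : Fin N → Mat n p := fun i => C (v i - s.g i) (ζ (k + 1) i)
    { X := X, v := v, g := fun i => s.g i + c i, gm := s.gm + (1 / (N : ℝ)) • ∑ i, c i }

/-- The randomness of the algorithm on a probability space `(Ω, P)`: each sample `ξ i k` has law
`D i`, each seed `ζ k i` has law `ρ`, all samples and the seed vectors `ζ 0, ζ 1, …` are mutually
independent. (Seeds of different nodes in the same round may be coupled.) -/
structure Sampling {N : ℕ} {Ξ S Ω : Type*} [MeasurableSpace Ξ] [MeasurableSpace S]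
    [MeasurableSpace Ω] (P : Measure Ω) (D : Fin N → Measure Ξ) (ρ : Measure S)
    (ξ : Fin N → ℕ → Ω → Ξ) (ζ : ℕ → Ω → Fin N → S) : Prop where
  measurable_sample : ∀ i k, Measurable (ξ i k)
  measurable_seed : ∀ k, Measurable (ζ k)
  law_sample : ∀ i k, P.map (ξ i k) = D i
  law_seed : ∀ k i, P.map (fun ω => ζ k ω i) = ρ
  indep : iIndep (Sum.elim
    (fun q : Fin N × ℕ => MeasurableSpace.comap (ξ q.1 q.2) inferInstance)
    (fun k : ℕ => MeasurableSpace.comap (ζ k) inferInstance)) P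

/-! ### Constants of the convergence theorem -/

/-- `θ = 1 - √(1-α)`. -/
def thetaC (α : ℝ) : ℝ := 1 - √(1 - α)

/-- `β = (1-α)/(1-√(1-α))`. -/
def betaC (α : ℝ) : ℝ := (1 - α) / (1 - √(1 - α))

/-- The three cases for the constants `(c₁, c₂)`. -/
def CaseConstants (η σ α c₁ c₂ : ℝ) : Prop :=
  (η = 1 ∧ σ ^ 2 = 0 ∧ c₁ = 1 ∧ c₂ = 0) ∨
  (α = 1 ∧ c₁ = 0 ∧ c₂ = 1) ∨
  (¬ (η = 1 ∧ σ ^ 2 = 0) ∧ ¬ α = 1 ∧ c₁ = 2 ∧ c₂ = 2)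

/-- The uniform safe step size `γ_s`. -/
def stepSafe (ε lam L' : ℝ) : ℝ :=
  min (lam * (1 - ε) * ε / ((1 + ε) ^ 2 * L' ^ 2 + lam ^ 2 * (1 + ε) * ε ^ 2))
    (min (√(ε / (2 * (1 + ε) ^ 2 * L' ^ 2))) (1 / (2 * lam)))

/-- `a = (2c₁βL̃²/θ)(1-η+η³) + (c₂L²/η²)(1-η)²(1+η)`. -/
def stepA (α η L Lt c₁ c₂ : ℝ) : ℝ :=
  2 * c₁ * betaC α * Lt ^ 2 / thetaC α * (1 - η + η ^ 3)
    + c₂ * L ^ 2 / η ^ 2 * (1 - η) ^ 2 * (1 + η)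

/-- `γ₁ = (2√a + 2L_m)⁻¹`. -/
def stepOne (a Lm : ℝ) : ℝ := (2 * √a + 2 * Lm)⁻¹

/-- `γ₂ = (2√(2λ(1+ε)a/μ) + 4λ(1+ε)L_m/μ)⁻¹`. -/
def stepTwo (ε lam mu a Lm : ℝ) : ℝ :=
  (2 * √(2 * lam * (1 + ε) * a / mu) + 4 * lam * (1 + ε) * Lm / mu)⁻¹

/-- The Lyapunov function
`ℒ = m(X) - m* + (c₁γ/θ) G̃ + (2c₁γηβ/θ) P̃ + (c₂γ/η) P` of a state. -/
def lyapunov {n p N : ℕ} {Ξ : Type*} [MeasurableSpace Ξ] (F : Mat n p → Ξ → ℝ)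
    (D : Fin N → Measure Ξ) (ε mu α η γ c₁ c₂ : ℝ) (s : State n p N) : ℝ :=
  let f := globalObj F D
  let Gt := (1 / (N : ℝ)) * ∑ i, ‖s.g i - s.v i‖ ^ 2
  let Pt := (1 / (N : ℝ)) * ∑ i, ‖s.v i - gradient (localObj F D i) s.X‖ ^ 2
  let Pm := ‖(1 / (N : ℝ)) • (∑ i, s.v i) - gradient f s.X‖ ^ 2
  merit f mu s.X - meritInf f mu ε + c₁ * γ / thetaC α * Gt
    + 2 * c₁ * γ * η * betaC α / thetaC α * Pt + c₂ * γ / η * Pm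

end EFLanding

end

open EFLanding

/-!
The argument has a geometric and a probabilistic half.

*Geometry.* Along the landing direction `Λ = grad + λ X Δ`, with `Δ = Xᵀ X - I`, the skew part is
tangent to the level sets of `Xᵀ X`, so that a step `X - t Λ` changes the defect to
`Δ - 2tλ(Δ + Δ²) + t² Λᵀ Λ` (`defect_sub_smul_landingDir`). As `‖Δ‖ ≤ ε < 1`, this is a contraction
up to a quadratic error, and for `t ≤ γ_s` the whole segment stays in the safe region
(`sub_smul_landingDir_mem`). In particular every iterate is safe, surely and not only almost surely.

The merit function need not be differentiable, since only `∇f` is Lipschitz. It still has an upper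
expansion along segments, in which the derivative of `∇f` is replaced by its Lipschitz bound
(`merit_add_le`, with the curvature constant `meritCurvature L L' μ`, which serves as `M`). If `m`
is smooth, comparison of difference quotients shows that the first-order term of this expansion
also bounds the directional derivative of `m` (`merit_landing_step_le`). So in both cases the
decrease follows from one inequality for the first-order term, `merit_slope_le`: it is at most
`-¼‖grad f‖² - ¼‖ψ‖² - λμ𝒩 + ‖g̃ - ∇f‖²`, where `ψ` is the tangential part of the direction in use.
For this inequality to hold for every `ε < 3/4`, the crude bound `1 + ε` for the square of the
operator norm of `X` does not suffice. It is replaced by `1 + δ`, where `δ` is the positive part of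
the largest eigenvalue of `Δ`: if `δ` is large then `‖XΔ‖²` exceeds its lower bound `(1 - ε)‖Δ‖²` by
`δ²(δ + ε)` (`exists_opSqBound`), and this gain, weighted with `μ`, pays for the larger cross terms
(`penalty_gain`, `cross_term_le`).

*Probability.* The sample and the compressor seeds of a round are independent of everything that
was drawn before, so the noise of the gradient is orthogonal to the past and the contraction of the
compressor applies conditionally on the past (`integral_le_of_indepFun`,
`integral_inner_eq_zero_of_indepFun`). Together with the weighted Young inequality this gives
linear recursions for the compression error `𝔼‖g_i - v_i‖²`, the momentum error `𝔼‖v_i - ∇f_i‖²`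
and the error of the averaged momentum, in which the noise of the nodes averages out to `σ²/N`
(`compressionError_recursion`, `momentumError_recursion`, `meanMomentumError_recursion`).
The weights in the Lyapunov function are such that the decrease of the three errors pays for
`γ 𝔼‖g - ∇f‖²`, and the displacement `‖X^{k+1} - X^k‖² = γ²(‖ψ‖² + λ²‖XΔ‖²)` that they leave behind
is absorbed by the terms `-¼‖ψ‖²` and half of `-λμ𝒩`, thanks to the bounds `γ₁` and `γ₂`
(`lyapunov_step_le`). Summing over the rounds gives the theorem.
-/

namespace EFLanding

/-! ### Frobenius geometry -/

section Frobenius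

variable {n p m : ℕ}

@[simp] lemma toM_ofM (A : Matrix (Fin n) (Fin p) ℝ) : toM (ofM A) = A := rfl

@[simp] lemma ofM_toM (X : Mat n p) : ofM (toM X) = X := rfl

@[simp] lemma ofM_add (A B : Matrix (Fin n) (Fin p) ℝ) : ofM (A + B) = ofM A + ofM B := rfl

@[simp] lemma ofM_sub (A B : Matrix (Fin n) (Fin p) ℝ) : ofM (A - B) = ofM A - ofM B := rfl

@[simp] lemma ofM_neg (A : Matrix (Fin n) (Fin p) ℝ) : ofM (-A) = -ofM A := rfl

@[simp] lemma ofM_smul (c : ℝ) (A : Matrix (Fin n) (Fin p) ℝ) : ofM (c • A) = c • ofM A := rfl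

@[simp] lemma toM_add (X Y : Mat n p) : toM (X + Y) = toM X + toM Y := rfl

@[simp] lemma toM_sub (X Y : Mat n p) : toM (X - Y) = toM X - toM Y := rfl

@[simp] lemma toM_smul (c : ℝ) (X : Mat n p) : toM (c • X) = c • toM X := rfl

lemma inner_ofM (A B : Matrix (Fin n) (Fin p) ℝ) :
    inner ℝ (ofM A) (ofM B) = (A.transpose * B).trace := by
  simp only [ofM, PiLp.inner_apply, Matrix.trace, Matrix.diag, Matrix.mul_apply,
    Matrix.transpose_apply, Fintype.sum_prod_type]
  rw [Finset.sum_comm]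
  simp [mul_comm]

lemma inner_ofM_transpose (A B : Matrix (Fin n) (Fin p) ℝ) :
    inner ℝ (ofM A.transpose) (ofM B.transpose) = inner ℝ (ofM A) (ofM B) := by
  rw [inner_ofM, inner_ofM, Matrix.transpose_transpose, ← Matrix.trace_transpose,
    Matrix.transpose_mul, Matrix.transpose_transpose, Matrix.trace_mul_comm]

lemma inner_ofM_mul_left (A : Matrix (Fin n) (Fin m) ℝ) (B : Matrix (Fin m) (Fin p) ℝ)
    (C : Matrix (Fin n) (Fin p) ℝ) :
    inner ℝ (ofM (A * B)) (ofM C) = inner ℝ (ofM B) (ofM (A.transpose * C)) := by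
  rw [inner_ofM, inner_ofM, Matrix.transpose_mul, Matrix.mul_assoc]

lemma inner_ofM_mul_right (A : Matrix (Fin n) (Fin m) ℝ) (B : Matrix (Fin m) (Fin p) ℝ)
    (C : Matrix (Fin n) (Fin p) ℝ) :
    inner ℝ (ofM (A * B)) (ofM C) = inner ℝ (ofM A) (ofM (C * B.transpose)) := by
  rw [inner_ofM, inner_ofM, Matrix.transpose_mul, Matrix.mul_assoc, Matrix.trace_mul_comm,
    Matrix.mul_assoc]

lemma norm_ofM_transpose (A : Matrix (Fin n) (Fin p) ℝ) : ‖ofM A.transpose‖ = ‖ofM A‖ := by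
  rw [← sq_eq_sq₀ (norm_nonneg _) (norm_nonneg _), ← real_inner_self_eq_norm_sq,
    ← real_inner_self_eq_norm_sq, inner_ofM_transpose]

lemma norm_ofM_mul_le (A : Matrix (Fin n) (Fin m) ℝ) (B : Matrix (Fin m) (Fin p) ℝ) :
    ‖ofM (A * B)‖ ≤ ‖ofM A‖ * ‖ofM B‖ := by
  have key : ∀ {a b : ℕ} (M : Matrix (Fin a) (Fin b) ℝ),
      ‖ofM M‖
        = @norm _ (Matrix.frobeniusNormedAddCommGroup (m := Fin a) (n := Fin b)).toNorm M := by
    intro a b M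
    rw [Matrix.frobenius_norm_def, EuclideanSpace.norm_eq, Real.sqrt_eq_rpow]
    simp [ofM, Fintype.sum_prod_type]
  rw [key, key, key]
  exact Matrix.frobenius_norm_mul A B

lemma skewPart_transpose (A : Matrix (Fin m) (Fin m) ℝ) :
    (skewPart A).transpose = -skewPart A := by
  unfold skewPart
  rw [Matrix.transpose_smul, Matrix.transpose_sub, Matrix.transpose_transpose, ← smul_neg, neg_sub]

lemma skewPart_sub (A B : Matrix (Fin m) (Fin m) ℝ) :
    skewPart (A - B) = skewPart A - skewPart B := by
  unfold skewPart
  rw [Matrix.transpose_sub, ← smul_sub]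
  congr 1
  abel

lemma norm_skewPart_le (A : Matrix (Fin m) (Fin m) ℝ) : ‖ofM (skewPart A)‖ ≤ ‖ofM A‖ := by
  unfold skewPart
  rw [ofM_smul, ofM_sub, norm_smul]
  have := norm_sub_le (ofM A) (ofM A.transpose)
  rw [norm_ofM_transpose] at this
  norm_num
  linarith

/-- Against a skew-symmetric matrix only the skew part counts. -/
lemma inner_skew_right (A S : Matrix (Fin m) (Fin m) ℝ) (hS : S.transpose = -S) :
    inner ℝ (ofM A) (ofM S) = inner ℝ (ofM (skewPart A)) (ofM S) := by
  have h : inner ℝ (ofM A.transpose) (ofM S) = -inner ℝ (ofM A) (ofM S) := by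
    rw [← inner_ofM_transpose, Matrix.transpose_transpose, hS, ofM_neg, inner_neg_right]
  unfold skewPart
  rw [ofM_smul, ofM_sub, real_inner_smul_left, inner_sub_left, h]
  ring

/-- Against a symmetric matrix only the symmetric part counts. -/
lemma inner_symPart_left (A E : Matrix (Fin m) (Fin m) ℝ) (hE : E.transpose = E) :
    inner ℝ (ofM (symPart A)) (ofM E) = inner ℝ (ofM A) (ofM E) := by
  have h : inner ℝ (ofM A.transpose) (ofM E) = inner ℝ (ofM A) (ofM E) := by
    rw [← inner_ofM_transpose, Matrix.transpose_transpose, hE]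
  unfold symPart
  rw [ofM_smul, ofM_add, real_inner_smul_left, inner_add_left, h]
  ring

/-- `w` bounds the square of the operator norm of `A`, expressed through Frobenius norms. -/
def OpSqBound (A : Matrix (Fin n) (Fin p) ℝ) (w : ℝ) : Prop :=
  ∀ (k : ℕ) (B : Matrix (Fin p) (Fin k) ℝ), ‖ofM (A * B)‖ ^ 2 ≤ w * ‖ofM B‖ ^ 2

lemma OpSqBound.mul_transpose {A : Matrix (Fin n) (Fin p) ℝ} {w : ℝ} (h : OpSqBound A w)
    (B : Matrix (Fin m) (Fin p) ℝ) : ‖ofM (B * A.transpose)‖ ^ 2 ≤ w * ‖ofM B‖ ^ 2 := by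
  have := h m B.transpose
  rwa [norm_ofM_transpose, ← norm_ofM_transpose (A * _), Matrix.transpose_mul,
    Matrix.transpose_transpose] at this

/-- The operator norms of `A` and `Aᵀ` agree. -/
lemma OpSqBound.mul_right {A : Matrix (Fin n) (Fin p) ℝ} {w : ℝ} (hw : 0 ≤ w) (h : OpSqBound A w)
    (B : Matrix (Fin m) (Fin n) ℝ) : ‖ofM (B * A)‖ ^ 2 ≤ w * ‖ofM B‖ ^ 2 := by
  have h1 : ‖ofM (B * A)‖ ^ 2 = inner ℝ (ofM B) (ofM (B * A * A.transpose)) := by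
    rw [← real_inner_self_eq_norm_sq, inner_ofM_mul_right]
  have h2 := h.mul_transpose (B * A)
  have h3 := real_inner_le_norm (ofM B) (ofM (B * A * A.transpose))
  rw [← h1] at h3
  have h4 : ‖ofM (B * A)‖ ^ 2 * ‖ofM (B * A)‖ ^ 2 ≤ (w * ‖ofM B‖ ^ 2) * ‖ofM (B * A)‖ ^ 2 := by
    calc ‖ofM (B * A)‖ ^ 2 * ‖ofM (B * A)‖ ^ 2
        ≤ (‖ofM B‖ * ‖ofM (B * A * A.transpose)‖) * (‖ofM B‖ * ‖ofM (B * A * A.transpose)‖) := by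
          gcongr
      _ = ‖ofM B‖ ^ 2 * ‖ofM (B * A * A.transpose)‖ ^ 2 := by ring
      _ ≤ ‖ofM B‖ ^ 2 * (w * ‖ofM (B * A)‖ ^ 2) := by gcongr
      _ = _ := by ring
  rcases (sq_nonneg ‖ofM (B * A)‖).eq_or_lt with h0 | h0
  · rw [← h0]; positivity
  · exact le_of_mul_le_mul_right h4 h0

lemma OpSqBound.transpose_mul {A : Matrix (Fin n) (Fin p) ℝ} {w : ℝ} (hw : 0 ≤ w)
    (h : OpSqBound A w) (B : Matrix (Fin n) (Fin m) ℝ) :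
    ‖ofM (A.transpose * B)‖ ^ 2 ≤ w * ‖ofM B‖ ^ 2 := by
  have := h.mul_right hw B.transpose
  rwa [norm_ofM_transpose, ← norm_ofM_transpose (_ * A), Matrix.transpose_mul,
    Matrix.transpose_transpose] at this

lemma norm_le_of_sq_le {a b w : ℝ} (hb : 0 ≤ b) (h : a ^ 2 ≤ w * b ^ 2) :
    a ≤ √w * b := by
  have := Real.abs_le_sqrt h
  rw [Real.sqrt_mul' _ (sq_nonneg b), Real.sqrt_sq hb] at this
  exact (le_abs_self a).trans this

end Frobenius

/-! ### The safe region -/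

section SafeRegion

variable {n p : ℕ} {ε : ℝ}

lemma defect_transpose (X : Mat n p) : (defect X).transpose = defect X := by
  unfold defect
  rw [Matrix.transpose_sub, Matrix.transpose_mul, Matrix.transpose_transpose,
    Matrix.transpose_one]

lemma gram_eq (X : Mat n p) : (toM X).transpose * toM X = defect X + 1 := by
  unfold defect
  rw [sub_add_cancel]

lemma norm_toM_mul_sq (X : Mat n p) {k : ℕ} (B : Matrix (Fin p) (Fin k) ℝ) :
    ‖ofM (toM X * B)‖ ^ 2 = ‖ofM B‖ ^ 2 + inner ℝ (ofM B) (ofM (defect X * B)) := by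
  rw [← real_inner_self_eq_norm_sq, inner_ofM_mul_left, ← Matrix.mul_assoc, gram_eq,
    Matrix.add_mul, Matrix.one_mul, ofM_add, inner_add_right, real_inner_self_eq_norm_sq]
  ring

lemma opSqBound_of_mem {X : Mat n p} (hX : X ∈ safeRegion n p ε) : OpSqBound (toM X) (1 + ε) := by
  intro k B
  rw [norm_toM_mul_sq]
  have h1 := real_inner_le_norm (ofM B) (ofM (defect X * B))
  have h2 := norm_ofM_mul_le (defect X) B
  have h3 : ‖ofM (defect X)‖ ≤ ε := hX
  have h4 : ‖ofM B‖ * ‖ofM (defect X * B)‖ ≤ ‖ofM B‖ * (ε * ‖ofM B‖) := by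
    gcongr
    exact h2.trans (by gcongr)
  nlinarith

/-- The skew part of the landing direction does not change the Gram matrix to first order; the
penalty part contracts the defect. -/
lemma gram_landingDir (lam : ℝ) (X g : Mat n p) :
    (toM X).transpose * toM (landingDir lam X g) + (toM (landingDir lam X g)).transpose * toM X
      = (2 * lam) • (defect X + defect X * defect X) := by
  have hS := skewPart_transpose (toM g * (toM X).transpose)
  unfold landingDir rGrad
  set S := skewPart (toM g * (toM X).transpose)
  simp only [toM_add, toM_smul, toM_ofM, Matrix.mul_add, Matrix.transpose_add,
    Matrix.transpose_smul, Matrix.transpose_mul, hS, Matrix.add_mul, Matrix.mul_smul,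
    Matrix.smul_mul, defect_transpose]
  have h1 : (toM X).transpose * (toM X * defect X) = defect X * defect X + defect X := by
    rw [← Matrix.mul_assoc, gram_eq, add_mul, one_mul]
  have h2 : defect X * (toM X).transpose * toM X = defect X * defect X + defect X := by
    rw [Matrix.mul_assoc, gram_eq, mul_add, mul_one]
  rw [h1, h2, Matrix.mul_neg, Matrix.neg_mul, Matrix.mul_assoc, two_mul, add_smul,
    add_comm (defect X)]
  abel

/-- The tangential and the penalty part of the landing direction are orthogonal, because
`X (Xᵀ X - I) Xᵀ` is symmetric. -/
lemma inner_rGrad_penalty (X g : Mat n p) :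
    inner ℝ (rGrad X g) (ofM (toM X * defect X)) = 0 := by
  have hS := skewPart_transpose (toM g * (toM X).transpose)
  unfold rGrad
  set S := skewPart (toM g * (toM X).transpose)
  have h : inner ℝ (ofM (S * toM X)) (ofM (toM X * defect X))
      = -inner ℝ (ofM (S * toM X)) (ofM (toM X * defect X)) := by
    conv_lhs =>
      rw [real_inner_comm, inner_ofM_mul_left, ← inner_ofM_transpose, defect_transpose,
        Matrix.transpose_mul, Matrix.transpose_mul, Matrix.transpose_transpose, hS,
        Matrix.mul_neg, Matrix.neg_mul, ofM_neg, inner_neg_right]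
    rw [real_inner_comm (ofM (toM X * defect X)), inner_ofM_mul_left, Matrix.mul_assoc]
  linarith

lemma norm_landingDir_sq (lam : ℝ) (X g : Mat n p) :
    ‖landingDir lam X g‖ ^ 2 = ‖rGrad X g‖ ^ 2 + lam ^ 2 * ‖ofM (toM X * defect X)‖ ^ 2 := by
  unfold landingDir
  rw [norm_add_sq_real, real_inner_smul_right, inner_rGrad_penalty, norm_smul, mul_pow,
    Real.norm_eq_abs, sq_abs]
  ring

lemma norm_rGrad_le {X : Mat n p} (hε : 0 ≤ ε) (hX : X ∈ safeRegion n p ε) (g : Mat n p) :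
    ‖rGrad X g‖ ≤ (1 + ε) * ‖g‖ := by
  have hA := opSqBound_of_mem hX
  have h1 := hA.mul_right (by linarith) (skewPart (toM g * (toM X).transpose))
  have h2 := norm_skewPart_le (toM g * (toM X).transpose)
  have h3 := hA.mul_transpose (toM g)
  rw [ofM_toM] at h3
  have h4 : ‖rGrad X g‖ ^ 2 ≤ ((1 + ε) * ‖g‖) ^ 2 := by
    calc ‖rGrad X g‖ ^ 2 ≤ (1 + ε) * ‖ofM (skewPart (toM g * (toM X).transpose))‖ ^ 2 := h1
      _ ≤ (1 + ε) * ‖ofM (toM g * (toM X).transpose)‖ ^ 2 := by gcongr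
      _ ≤ (1 + ε) * ((1 + ε) * ‖g‖ ^ 2) := by gcongr
      _ = _ := by ring
  exact le_of_sq_le_sq h4 (by positivity)

lemma norm_clip_le {L' : ℝ} (hL' : 0 ≤ L') (g : Mat n p) : ‖clip L' g‖ ≤ L' := by
  unfold clip
  rw [norm_smul, Real.norm_eq_abs, abs_of_nonneg (by positivity)]
  rcases (norm_nonneg g).eq_or_lt with h | h
  · rw [← h]; simpa using hL'
  · calc min 1 (L' / ‖g‖) * ‖g‖ ≤ L' / ‖g‖ * ‖g‖ := by gcongr; exact min_le_right _ _
      _ = L' := div_mul_cancel₀ _ h.ne'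

/-- Clipping is the projection onto a ball, so it does not increase the distance to the points of
that ball. -/
lemma norm_clip_sub_le {L' : ℝ} {h : Mat n p} (hh : ‖h‖ ≤ L') (g : Mat n p) :
    ‖clip L' g - h‖ ≤ ‖g - h‖ := by
  unfold clip
  rcases le_or_gt ‖g‖ L' with hg | hg
  · rcases (norm_nonneg g).eq_or_lt with h0 | h0
    · have : g = 0 := norm_eq_zero.mp h0.symm
      simp [this]
    · rw [min_eq_left ((one_le_div h0).mpr hg), one_smul]
  · have h0 : 0 < ‖g‖ := ((norm_nonneg h).trans hh).trans_lt hg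
    have hle : L' / ‖g‖ ≤ 1 := (div_le_one h0).mpr hg.le
    rw [min_eq_right hle]
    set t := L' / ‖g‖ with ht
    have htg : t * ‖g‖ = L' := div_mul_cancel₀ _ h0.ne'
    have hin := real_inner_le_norm g h
    refine le_of_sq_le_sq ?_ (norm_nonneg _)
    rw [norm_sub_sq_real, norm_sub_sq_real, norm_smul, real_inner_smul_left, mul_pow,
      Real.norm_eq_abs, sq_abs]
    have h1 : inner ℝ g h ≤ ‖g‖ * L' := hin.trans (by gcongr)
    -- `(1 - t) ((1 + t) ‖g‖² - 2 ⟪g, h⟫) ≥ (1 - t) (1 - t) ‖g‖² ≥ 0`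
    nlinarith [mul_nonneg (sub_nonneg.mpr hle) (sub_nonneg.mpr h1), sq_nonneg ((1 - t) * ‖g‖)]

/-- The defect after a landing step. The first-order part depends on `X` and `lam` only. -/
lemma defect_sub_smul_landingDir (lam t : ℝ) (X g : Mat n p) :
    defect (X - t • landingDir lam X g) = (1 - 2 * t * lam) • defect X
      - (2 * t * lam) • (defect X * defect X)
      + t ^ 2 • ((toM (landingDir lam X g)).transpose * toM (landingDir lam X g)) := by
  have h := gram_landingDir lam X g
  have h' : (toM (landingDir lam X g)).transpose * toM X
      = (2 * lam) • (defect X + defect X * defect X)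
      - (toM X).transpose * toM (landingDir lam X g) := by rw [← h]; abel
  have : defect (X - t • landingDir lam X g) = defect X
      - t • ((toM X).transpose * toM (landingDir lam X g)
        + (toM (landingDir lam X g)).transpose * toM X)
      + t ^ 2 • ((toM (landingDir lam X g)).transpose * toM (landingDir lam X g)) := by
    simp only [defect, toM_sub, toM_smul, Matrix.transpose_sub, Matrix.transpose_smul,
      Matrix.mul_sub, Matrix.sub_mul, Matrix.smul_mul, Matrix.mul_smul]
    module
  rw [this, h]
  module

/-- Landing steps along directions bounded by `L'`, of size at most `γ_s`, stay in the safe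
region. -/
lemma sub_smul_landingDir_mem {lam L' t : ℝ} (hε : 0 < ε) (hε' : ε < 3 / 4) (hlam : 0 < lam)
    (hL' : 0 < L') {X g : Mat n p} (hX : X ∈ safeRegion n p ε) (hg : ‖g‖ ≤ L') (ht : 0 ≤ t)
    (htγ : t ≤ stepSafe ε lam L') : X - t • landingDir lam X g ∈ safeRegion n p ε := by
  have hd : ‖ofM (defect X)‖ ≤ ε := hX
  have ht1 : t ≤ lam * (1 - ε) * ε / ((1 + ε) ^ 2 * L' ^ 2 + lam ^ 2 * (1 + ε) * ε ^ 2) :=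
    htγ.trans (min_le_left _ _)
  have ht2 : t ≤ 1 / (2 * lam) := htγ.trans ((min_le_right _ _).trans (min_le_right _ _))
  rw [le_div_iff₀ (by positivity)] at ht1 ht2
  have hΛ := norm_landingDir_sq lam X g
  have hψ := norm_rGrad_le hε.le hX g
  have hx := opSqBound_of_mem hX p (defect X)
  set d := ‖ofM (defect X)‖ with hd_def
  have hd0 : 0 ≤ d := norm_nonneg _
  have hΛ' : ‖landingDir lam X g‖ ^ 2 ≤ (1 + ε) ^ 2 * L' ^ 2 + lam ^ 2 * (1 + ε) * ε ^ 2 := by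
    rw [hΛ]
    have h1 : ‖rGrad X g‖ ^ 2 ≤ ((1 + ε) * L') ^ 2 := by
      gcongr
      exact hψ.trans (by gcongr)
    have h2 : ‖ofM (toM X * defect X)‖ ^ 2 ≤ (1 + ε) * ε ^ 2 := hx.trans (by gcongr)
    have h3 : lam ^ 2 * ‖ofM (toM X * defect X)‖ ^ 2 ≤ lam ^ 2 * ((1 + ε) * ε ^ 2) := by gcongr
    nlinarith
  show ‖ofM (defect _)‖ ≤ ε
  rw [defect_sub_smul_landingDir]
  have hΛΛ : ‖ofM ((toM (landingDir lam X g)).transpose * toM (landingDir lam X g))‖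
      ≤ ‖landingDir lam X g‖ ^ 2 := by
    refine (norm_ofM_mul_le _ _).trans ?_
    rw [norm_ofM_transpose, ofM_toM, pow_two]
  have hDD := norm_ofM_mul_le (defect X) (defect X)
  rw [← hd_def] at hDD
  calc ‖ofM ((1 - 2 * t * lam) • defect X - (2 * t * lam) • (defect X * defect X)
      + t ^ 2 • ((toM (landingDir lam X g)).transpose * toM (landingDir lam X g)))‖
      ≤ (1 - 2 * t * lam) * d + (2 * t * lam) * (d * d)
        + t ^ 2 * ((1 + ε) ^ 2 * L' ^ 2 + lam ^ 2 * (1 + ε) * ε ^ 2) := by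
        rw [ofM_add, ofM_sub, ofM_smul, ofM_smul, ofM_smul]
        refine (norm_add_le _ _).trans (add_le_add ((norm_sub_le _ _).trans (add_le_add ?_ ?_)) ?_)
        · rw [norm_smul, Real.norm_eq_abs, abs_of_nonneg (by linarith)]
        · rw [norm_smul, Real.norm_eq_abs, abs_of_nonneg (by positivity)]
          gcongr
        · rw [norm_smul, Real.norm_eq_abs, abs_of_nonneg (by positivity)]
          gcongr
          exact hΛΛ.trans hΛ'
    _ ≤ (1 - 2 * t * lam) * ε + (2 * t * lam) * (ε * ε) + t * (lam * (1 - ε) * ε) := by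
        have : t ^ 2 * ((1 + ε) ^ 2 * L' ^ 2 + lam ^ 2 * (1 + ε) * ε ^ 2)
            ≤ t * (lam * (1 - ε) * ε) := by
          rw [pow_two, mul_assoc]
          gcongr
        have h1 : 0 ≤ 1 - 2 * t * lam := by linarith
        gcongr
    _ ≤ ε := by
        have : 0 ≤ t * lam * (1 - ε) * ε := by
          have : 0 ≤ 1 - ε := by linarith
          positivity
        nlinarith

end SafeRegion

/-! ### Spectral information on the defect -/

section Spectral

variable {n p : ℕ} {ε : ℝ}

lemma inner_ofM_conj {m : ℕ} {U : Matrix (Fin m) (Fin m) ℝ} (hU : U.transpose * U = 1)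
    (A B : Matrix (Fin m) (Fin m) ℝ) :
    inner ℝ (ofM (U * A * U.transpose)) (ofM (U * B * U.transpose)) = inner ℝ (ofM A) (ofM B) := by
  rw [inner_ofM_mul_right, Matrix.transpose_transpose, Matrix.mul_assoc (U * B), hU,
    Matrix.mul_one, inner_ofM_mul_left, ← Matrix.mul_assoc, hU, Matrix.one_mul]

lemma inner_ofM_diagonal_mul {m k : ℕ} (e : Fin m → ℝ) (A B : Matrix (Fin m) (Fin k) ℝ) :
    inner ℝ (ofM A) (ofM (Matrix.diagonal e * B)) = ∑ i, e i * ∑ j, A i j * B i j := by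
  simp only [ofM, PiLp.inner_apply, Fintype.sum_prod_type, Matrix.diagonal_mul, Finset.mul_sum]
  refine Finset.sum_congr rfl fun i _ => Finset.sum_congr rfl fun j _ => ?_
  simp
  ring

/-- The number `δ` is the positive part of the largest eigenvalue of `E`. If it is not small, then
`⟪E, (E + ε) E⟫`, a sum of nonnegative terms over the eigenvalues, is not small either. -/
lemma exists_max_eigenvalue {m : ℕ} {E : Matrix (Fin m) (Fin m) ℝ} (hE : E.transpose = E)
    (hε : ‖ofM E‖ ≤ ε) :
    ∃ δ : ℝ, 0 ≤ δ ∧ δ ≤ ε ∧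
      (∀ (k : ℕ) (B : Matrix (Fin m) (Fin k) ℝ),
        inner ℝ (ofM B) (ofM (E * B)) ≤ δ * ‖ofM B‖ ^ 2) ∧
      δ ^ 2 * (δ + ε) ≤ inner ℝ (ofM E) (ofM (E * E)) + ε * ‖ofM E‖ ^ 2 := by
  have hε0 : 0 ≤ ε := (norm_nonneg _).trans hε
  have hH : E.IsHermitian := by
    rw [Matrix.IsHermitian, Matrix.conjTranspose_eq_transpose_of_trivial, hE]
  obtain ⟨U, e, hU, hU', hUE⟩ : ∃ (U : Matrix (Fin m) (Fin m) ℝ) (e : Fin m → ℝ),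
      U.transpose * U = 1 ∧ U * U.transpose = 1 ∧ E = U * Matrix.diagonal e * U.transpose := by
    refine ⟨hH.eigenvectorUnitary, hH.eigenvalues, ?_, ?_, ?_⟩
    · have := Unitary.coe_star_mul_self hH.eigenvectorUnitary
      rwa [Matrix.star_eq_conjTranspose, Matrix.conjTranspose_eq_transpose_of_trivial] at this
    · have := Unitary.coe_mul_star_self hH.eigenvectorUnitary
      rwa [Unitary.coe_star, Matrix.star_eq_conjTranspose,
        Matrix.conjTranspose_eq_transpose_of_trivial] at this
    · have := hH.spectral_theorem
      rwa [Unitary.conjStarAlgAut_apply, Matrix.star_eq_conjTranspose,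
        Matrix.conjTranspose_eq_transpose_of_trivial] at this
  have hEE : E * E = U * (Matrix.diagonal e * Matrix.diagonal e) * U.transpose := by
    rw [hUE]
    calc U * Matrix.diagonal e * U.transpose * (U * Matrix.diagonal e * U.transpose)
        = U * Matrix.diagonal e * (U.transpose * U) * Matrix.diagonal e * U.transpose := by
          simp only [Matrix.mul_assoc]
      _ = _ := by rw [hU, Matrix.mul_one]; simp only [Matrix.mul_assoc]
  have hdiag : ∀ x y : Fin m → ℝ,
      inner ℝ (ofM (Matrix.diagonal x)) (ofM (Matrix.diagonal y)) = ∑ i, x i * y i := by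
    intro x y
    rw [inner_ofM, Matrix.diagonal_transpose, Matrix.diagonal_mul_diagonal, Matrix.trace_diagonal]
  have hsq : ‖ofM E‖ ^ 2 = ∑ i, e i * e i := by
    rw [← real_inner_self_eq_norm_sq, hUE, inner_ofM_conj hU, hdiag]
  have hcube : inner ℝ (ofM E) (ofM (E * E)) = ∑ i, e i * (e i * e i) := by
    rw [hEE]
    nth_rewrite 1 [hUE]
    rw [inner_ofM_conj hU, Matrix.diagonal_mul_diagonal, hdiag]
  have hquad : ∀ δ : ℝ, (∀ i, e i ≤ δ) → ∀ (k : ℕ) (B : Matrix (Fin m) (Fin k) ℝ),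
      inner ℝ (ofM B) (ofM (E * B)) ≤ δ * ‖ofM B‖ ^ 2 := by
    intro δ hδ k B
    have hB : ‖ofM B‖ ^ 2 = ‖ofM (U.transpose * B)‖ ^ 2 := by
      rw [← real_inner_self_eq_norm_sq, ← real_inner_self_eq_norm_sq, inner_ofM_mul_left,
        Matrix.transpose_transpose, ← Matrix.mul_assoc, hU', Matrix.one_mul]
    have h1 : inner ℝ (ofM B) (ofM (E * B)) = inner ℝ (ofM (U.transpose * B))
        (ofM (Matrix.diagonal e * (U.transpose * B))) := by
      rw [inner_ofM_mul_left, Matrix.transpose_transpose, hUE]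
      simp only [Matrix.mul_assoc]
    rw [hB, h1, inner_ofM_diagonal_mul, ← real_inner_self_eq_norm_sq]
    have h2 := inner_ofM_diagonal_mul (fun _ => (1 : ℝ)) (U.transpose * B) (U.transpose * B)
    rw [Matrix.diagonal_one, Matrix.one_mul] at h2
    rw [h2, Finset.mul_sum]
    refine Finset.sum_le_sum fun i _ => ?_
    rw [one_mul]
    exact mul_le_mul_of_nonneg_right (hδ i) (Finset.sum_nonneg fun j _ => mul_self_nonneg _)
  have habs : ∀ i, |e i| ≤ ε := by
    intro i
    refine (abs_le_of_sq_le_sq ?_ (norm_nonneg _)).trans hε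
    rw [hsq, pow_two]
    exact Finset.single_le_sum (f := fun i => e i * e i) (fun j _ => mul_self_nonneg _)
      (Finset.mem_univ i)
  have hT : inner ℝ (ofM E) (ofM (E * E)) + ε * ‖ofM E‖ ^ 2 = ∑ i, e i ^ 2 * (e i + ε) := by
    rw [hcube, hsq, Finset.mul_sum, ← Finset.sum_add_distrib]
    exact Finset.sum_congr rfl fun i _ => by ring
  have hT0 : ∀ i, 0 ≤ e i ^ 2 * (e i + ε) := fun i =>
    mul_nonneg (sq_nonneg _) (by linarith [neg_le_of_abs_le (habs i)])
  rw [hT]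
  by_cases hpos : ∃ i, 0 < e i
  · obtain ⟨i₀, hi₀⟩ := hpos
    have : Nonempty (Fin m) := ⟨i₀⟩
    obtain ⟨i, hi⟩ := Finite.exists_max e
    exact ⟨e i, hi₀.le.trans (hi i₀), (le_abs_self _).trans (habs i), hquad _ hi,
      Finset.single_le_sum (f := fun i => e i ^ 2 * (e i + ε)) (fun j _ => hT0 j)
        (Finset.mem_univ i)⟩
  · push Not at hpos
    refine ⟨0, le_rfl, hε0, hquad 0 hpos, ?_⟩
    simpa using Finset.sum_nonneg fun i (_ : i ∈ Finset.univ) => hT0 i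

/-- The excess `δ` of the squared operator norm of `X` over `1` is paid for by a larger penalty
gradient `X (Xᵀ X - I)`. -/
lemma exists_opSqBound {X : Mat n p} (hX : X ∈ safeRegion n p ε) :
    ∃ δ : ℝ, 0 ≤ δ ∧ δ ≤ ε ∧ OpSqBound (toM X) (1 + δ) ∧
      (1 - ε) * ‖ofM (defect X)‖ ^ 2 + δ ^ 2 * (δ + ε) ≤ ‖ofM (toM X * defect X)‖ ^ 2 := by
  obtain ⟨δ, h0, h1, h2, h3⟩ := exists_max_eigenvalue (defect_transpose X) hX
  refine ⟨δ, h0, h1, fun k B => ?_, ?_⟩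
  · rw [norm_toM_mul_sq]
    linarith [h2 k B]
  · rw [norm_toM_mul_sq]
    linarith

end Spectral

/-! ### Slope of the merit function along the landing direction -/

section Slope

variable {n p : ℕ} {ε : ℝ}

/-- The part of the slope that comes from the penalty absorbs the terms of second order in the
defect. Besides `r d²`, the excess `δ` of the operator norm yields a gain: this is where
`(3 - 4ε) ε² ≤ 1/4` enters. -/
lemma penalty_gain {lam mu L L' δ d x : ℝ} (hε : 0 < ε) (hε' : ε < 3 / 4) (hlam : 0 < lam)
    (hL : 0 ≤ L) (hL' : 0 < L') (hmu : muBound ε lam L L' ≤ mu) (hδ : 0 ≤ δ) (hδε : δ ≤ ε)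
    (hd : 0 ≤ d) (hdε : d ≤ ε) (hx : (1 - ε) * d ^ 2 + δ ^ 2 * (δ + ε) ≤ x ^ 2) :
    (max L L') ^ 2 * (1 + ε) * d ^ 2 * (1 + 32 * δ ^ 3)
      ≤ lam * mu * x ^ 2 - lam * mu * (d ^ 2 / 4) - lam * L * x ^ 2 / 2
        - 3 / 2 * lam * L' * √(1 + ε) * d ^ 2 := by
  unfold muBound at hmu
  have hκ : 0 < 3 - 4 * ε := by linarith
  rw [div_mul_eq_mul_div, div_le_iff₀ hκ] at hmu
  set s := √(1 + ε) with hs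
  have hs0 : 0 ≤ s := Real.sqrt_nonneg _
  set r := (max L L') ^ 2 * ((1 + ε) / lam) with hr
  have hr0 : 0 ≤ r := by positivity
  have hlr : (max L L') ^ 2 * (1 + ε) = lam * r := by
    rw [hr]; field_simp
  have hmu' : 2 * (L * (1 - ε) + 3 * s * L' + 2 * r) ≤ mu * (3 - 4 * ε) := by
    refine le_trans (le_of_eq ?_) hmu
    rw [hr]; ring
  have hsL : 0 ≤ s * L' := by positivity
  have hLn : 0 ≤ L * ε := by positivity
  have h1 : 4 * r ≤ (mu - L / 2) * (3 - 4 * ε) := by linarith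
  have h1' : 0 ≤ mu - L / 2 := by
    by_contra hneg
    have := mul_neg_of_neg_of_pos (not_le.mp hneg) hκ
    linarith
  have h2 : (mu - L / 2) * ((1 - ε) * d ^ 2 + δ ^ 2 * (δ + ε)) ≤ (mu - L / 2) * x ^ 2 := by
    gcongr
  have h3 : (3 / 2 * (s * L') + r) * d ^ 2
      ≤ ((mu - L / 2) * (1 - ε) - mu / 4) * d ^ 2 := by
    gcongr
    linarith
  have h4 : (3 - 4 * ε) * d ^ 2 ≤ 1 / 4 := by
    have h : (3 - 4 * ε) * d ^ 2 ≤ (3 - 4 * ε) * ε ^ 2 := by gcongr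
    linarith [mul_nonneg (sq_nonneg (1 - 2 * ε)) (by linarith : 0 ≤ ε + 1 / 4)]
  have h5 : 32 * r * d ^ 2 * δ ^ 3 ≤ (mu - L / 2) * (δ ^ 2 * (δ + ε)) := by
    have h6 : 16 * r * d ^ 2 ≤ mu - L / 2 := by
      calc 16 * r * d ^ 2 = 4 * (4 * r) * d ^ 2 := by ring
        _ ≤ 4 * ((mu - L / 2) * (3 - 4 * ε)) * d ^ 2 := by gcongr
        _ = (mu - L / 2) * (4 * ((3 - 4 * ε) * d ^ 2)) := by ring
        _ ≤ (mu - L / 2) * 1 := by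
          gcongr
          linarith
        _ = mu - L / 2 := mul_one _
    calc 32 * r * d ^ 2 * δ ^ 3 = (16 * r * d ^ 2) * (δ ^ 2 * (δ + δ)) := by ring
      _ ≤ (mu - L / 2) * (δ ^ 2 * (δ + ε)) := by gcongr
  have h6 : (3 / 2 * (s * L') + r) * d ^ 2 + 32 * r * d ^ 2 * δ ^ 3
      ≤ (mu - L / 2) * x ^ 2 - mu * (d ^ 2 / 4) := by linarith
  have h7 := mul_le_mul_of_nonneg_left h6 hlam.le
  rw [hlr]
  linarith

/-- The quadratic form in `y` and `q d` that is left after the cross terms of the slope have been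
collected is nonnegative. -/
lemma cross_term_le {q y d δ : ℝ} (hδ : 0 ≤ δ) (hδε : δ ≤ ε) (hε' : ε < 3 / 4) :
    q * ((1 + δ) * y * d) ≤ 3 / 4 * (1 - (1 + δ) / 2) * y ^ 2
      + q ^ 2 * (1 + ε) * d ^ 2 * (1 + 32 * δ ^ 3) := by
  have hA0 : 0 < 3 / 2 * (1 - δ) := by linarith
  have hδ3 : 0 ≤ δ ^ 3 := by positivity
  have hτ : 1 + δ ≤ 3 / 2 * (1 - δ) * (1 + 32 * δ ^ 3) := by
    have h1 : 0 ≤ (3 / 4 - δ) * δ ^ 3 := mul_nonneg (by linarith) hδ3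
    -- `δ ^ 3` lies above its tangent at `27 / 100`
    have h2 : 0 ≤ (δ + 2 * (27 / 100)) * (δ - 27 / 100) ^ 2 := by positivity
    linarith
  have h1 : q ^ 2 * (1 + δ) * d ^ 2 * (1 + 32 * δ ^ 3)
      ≤ q ^ 2 * (1 + ε) * d ^ 2 * (1 + 32 * δ ^ 3) := by gcongr
  have h2 : (1 + δ) * (1 + δ) * (q * d) ^ 2
      ≤ (1 + δ) * (3 / 2 * (1 - δ) * (1 + 32 * δ ^ 3)) * (q * d) ^ 2 := by gcongr
  have h3 : 0 ≤ 3 / 2 * (1 - δ) * (3 / 4 * (1 - (1 + δ) / 2) * y ^ 2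
      + q ^ 2 * (1 + δ) * d ^ 2 * (1 + 32 * δ ^ 3) - q * ((1 + δ) * y * d)) := by
    linarith [sq_nonneg (3 / 4 * (1 - δ) * y - q * (1 + δ) * d)]
  have h4 := nonneg_of_mul_nonneg_right h3 hA0
  linarith

/-- Lower bound for `⟪T, S⟫` corrected by the distance of `T` and `S`. The excess over the
quadratic form on the left is a nonnegative multiple of `‖(T - S) + S / 2‖²` plus a nonnegative
multiple of `‖T - S‖²`. -/
lemma inner_add_dist_ge {V : Type*} [NormedAddCommGroup V] [InnerProductSpace ℝ V] {w e : ℝ}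
    (hw : 0 < w) (hw' : w ≤ 2) (T S : V) (he : ‖T - S‖ ^ 2 ≤ w * e ^ 2) :
    w / 4 * (‖T‖ ^ 2 + ‖S‖ ^ 2) + 3 / 4 * (1 - w / 2) * ‖S‖ ^ 2 ≤ inner ℝ T S + e ^ 2 := by
  have hT : T = (T - S) + S := by abel
  set R := T - S with hR
  have h1 : ‖T‖ ^ 2 = ‖R‖ ^ 2 + 2 * inner ℝ R S + ‖S‖ ^ 2 := by
    rw [hT, norm_add_sq_real]
  have h2 : inner ℝ T S = inner ℝ R S + ‖S‖ ^ 2 := by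
    rw [hT, inner_add_left, real_inner_self_eq_norm_sq]
  have h3 : 0 ≤ ‖R‖ ^ 2 + inner ℝ R S + ‖S‖ ^ 2 / 4 := by
    have h := norm_add_sq_real R ((1 / 2 : ℝ) • S)
    rw [real_inner_smul_right, norm_smul, Real.norm_eq_abs, abs_of_pos (by norm_num)] at h
    have h0 := sq_nonneg ‖R + (1 / 2 : ℝ) • S‖
    rw [h] at h0
    nlinarith
  have h4 : ‖R‖ ^ 2 / w ≤ e ^ 2 := by rwa [div_le_iff₀' hw]
  have h5 : (1 - w / 2) * ‖R‖ ^ 2 + w / 4 * ‖R‖ ^ 2 ≤ ‖R‖ ^ 2 / w := by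
    rw [le_div_iff₀ hw]
    linarith [mul_nonneg (sq_nonneg (2 - w)) (sq_nonneg ‖R‖)]
  have h6 := mul_nonneg (by linarith : 0 ≤ 1 - w / 2) h3
  rw [h1, h2]
  linarith

lemma inner_rGrad (X G g : Mat n p) :
    inner ℝ G (rGrad X g) = inner ℝ (ofM (skewPart (toM G * (toM X).transpose)))
      (ofM (skewPart (toM g * (toM X).transpose))) := by
  unfold rGrad
  rw [real_inner_comm, ← ofM_toM G, inner_ofM_mul_right, real_inner_comm, ofM_toM,
    inner_skew_right _ _ (skewPart_transpose _)]

/-- The decrease of the merit function along the landing direction driven by an estimate `g` of the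
gradient `G`. The left side bounds the one-sided derivative of the merit function. -/
lemma merit_slope_le {lam mu L L' : ℝ} (hε : 0 < ε) (hε' : ε < 3 / 4) (hlam : 0 < lam)
    (hL : 0 ≤ L) (hL' : 0 < L') (hmu : muBound ε lam L L' ≤ mu) {X G : Mat n p}
    (hX : X ∈ safeRegion n p ε) (hG : ‖G‖ ≤ L') (g : Mat n p) :
    -inner ℝ G (landingDir lam X g)
        + L / 2 * ‖landingDir lam X g‖ * ‖ofM (toM X * defect X)‖
        + 1 / 2 * inner ℝ G (ofM (toM (landingDir lam X g) * defect X
            + toM X * ((toM X).transpose * toM (landingDir lam X g)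
              + (toM (landingDir lam X g)).transpose * toM X)))
        - mu * inner ℝ (ofM (toM X * defect X)) (landingDir lam X g)
      ≤ -(1 / 4) * ‖rGrad X G‖ ^ 2 - 1 / 4 * ‖rGrad X g‖ ^ 2 - lam * mu * penalty X
        + ‖g - G‖ ^ 2 := by
  rw [gram_landingDir]
  obtain ⟨δ, hδ, hδε, hA, hxδ⟩ := exists_opSqBound hX
  have hdε : ‖ofM (defect X)‖ ≤ ε := hX
  have hgain := penalty_gain hε hε' hlam hL hL' hmu hδ hδε (norm_nonneg _) hdε hxδ
  set d := ‖ofM (defect X)‖ with hd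
  have hd0 : 0 ≤ d := norm_nonneg _
  set x := ‖ofM (toM X * defect X)‖ with hx
  have hx0 : 0 ≤ x := norm_nonneg _
  set q := max L L' with hq
  have hq0 : 0 ≤ q := hL.trans (le_max_left _ _)
  set w := 1 + δ with hw
  set Sf := ofM (skewPart (toM G * (toM X).transpose)) with hSf
  set Sg := ofM (skewPart (toM g * (toM X).transpose)) with hSg
  set ψ := rGrad X g with hψ
  have hΛn : ‖landingDir lam X g‖ ≤ ‖ψ‖ + lam * x := by
    unfold landingDir
    refine (norm_add_le _ _).trans ?_
    rw [norm_smul, Real.norm_eq_abs, abs_of_pos hlam]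
  have hinG : inner ℝ G (landingDir lam X g)
      = inner ℝ Sf Sg + lam * inner ℝ G (ofM (toM X * defect X)) := by
    unfold landingDir
    rw [inner_add_right, inner_rGrad, real_inner_smul_right]
  have hinΔ : inner ℝ (ofM (toM X * defect X)) (landingDir lam X g) = lam * x ^ 2 := by
    unfold landingDir
    rw [inner_add_right, real_inner_comm, inner_rGrad_penalty, real_inner_smul_right,
      real_inner_self_eq_norm_sq, zero_add]
  have hDG : ofM (toM (landingDir lam X g) * defect X
      + toM X * ((2 * lam) • (defect X + defect X * defect X)))
      = ofM (toM ψ * defect X) + (2 * lam) • ofM (toM X * defect X)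
        + (3 * lam) • ofM (toM X * (defect X * defect X)) := by
    unfold landingDir
    rw [← hψ]
    simp only [toM_add, toM_smul, toM_ofM, Matrix.add_mul, Matrix.smul_mul, Matrix.mul_smul,
      Matrix.mul_add, Matrix.mul_assoc, ofM_add, ofM_smul]
    module
  rw [hinG, hinΔ, hDG, inner_add_right, inner_add_right, real_inner_smul_right,
    real_inner_smul_right]
  have hS2 : inner ℝ G (ofM (toM ψ * defect X)) ≤ L' * (‖ψ‖ * d) := by
    refine (real_inner_le_norm _ _).trans ?_
    gcongr
    have := norm_ofM_mul_le (toM ψ) (defect X)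
    rwa [ofM_toM] at this
  have hS3 : inner ℝ G (ofM (toM X * (defect X * defect X))) ≤ L' * (√(1 + ε) * d ^ 2) := by
    refine (real_inner_le_norm _ _).trans ?_
    gcongr
    refine (norm_le_of_sq_le (norm_nonneg _) (opSqBound_of_mem hX p _)).trans ?_
    gcongr
    rw [pow_two]
    exact norm_ofM_mul_le _ _
  have hφn : ‖rGrad X G‖ ^ 2 ≤ w * ‖Sf‖ ^ 2 := hA.mul_right (by linarith) _
  have hψn : ‖ψ‖ ^ 2 ≤ w * ‖Sg‖ ^ 2 := hA.mul_right (by linarith) _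
  have hxn : x ^ 2 ≤ w * d ^ 2 := hA p _
  have hTe : ‖Sf - Sg‖ ^ 2 ≤ w * ‖g - G‖ ^ 2 := by
    rw [hSf, hSg, ← ofM_sub, ← skewPart_sub, ← Matrix.sub_mul, ← toM_sub, norm_sub_rev g G]
    calc ‖ofM (skewPart (toM (G - g) * (toM X).transpose))‖ ^ 2
        ≤ ‖ofM (toM (G - g) * (toM X).transpose)‖ ^ 2 := by
          gcongr
          exact norm_skewPart_le _
      _ ≤ _ := hA.mul_transpose (toM (G - g))
  have hQ := inner_add_dist_ge (by linarith) (by linarith) Sf Sg hTe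
  have hpen : penalty X = d ^ 2 / 4 := by unfold penalty; ring
  set y := ‖Sg‖ with hy
  have hy0 : 0 ≤ y := norm_nonneg _
  have hsw1 : 1 ≤ √w := Real.one_le_sqrt.mpr (by linarith)
  have hsw : √w * √w = w := Real.mul_self_sqrt (by linarith)
  have hsw2 : √w ≤ w := by nlinarith only [hsw, hsw1]
  have hψ1 := norm_le_of_sq_le hy0 hψn
  have hx1 := norm_le_of_sq_le hd0 hxn
  have hψx : ‖ψ‖ * x ≤ w * y * d := by
    calc ‖ψ‖ * x ≤ (√w * y) * (√w * d) := by gcongr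
      _ = √w * √w * y * d := by ring
      _ = w * y * d := by rw [hsw]
  have hψd : ‖ψ‖ * d ≤ w * y * d := by
    calc ‖ψ‖ * d ≤ (√w * y) * d := by gcongr
      _ ≤ w * y * d := by gcongr
  have hcross : L / 2 * (‖ψ‖ * x) + 1 / 2 * (L' * (‖ψ‖ * d)) ≤ q * (w * y * d) := by
    have h1 : L * (‖ψ‖ * x) ≤ q * (w * y * d) := by
      gcongr
      exact le_max_left _ _
    have h2 : L' * (‖ψ‖ * d) ≤ q * (w * y * d) := by
      gcongr
      exact le_max_right _ _
    linarith only [h1, h2]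
  have hLΛ : L / 2 * ‖landingDir lam X g‖ * x ≤ L / 2 * (‖ψ‖ * x) + lam * L * x ^ 2 / 2 := by
    calc L / 2 * ‖landingDir lam X g‖ * x ≤ L / 2 * (‖ψ‖ + lam * x) * x := by gcongr
      _ = _ := by ring
  have hform : q * (w * y * d)
      ≤ 3 / 4 * (1 - w / 2) * y ^ 2 + q ^ 2 * (1 + ε) * d ^ 2 * (1 + 32 * δ ^ 3) :=
    cross_term_le hδ hδε hε'
  have hwφ : 1 / 4 * ‖rGrad X G‖ ^ 2 + 1 / 4 * ‖ψ‖ ^ 2 ≤ w / 4 * (‖Sf‖ ^ 2 + y ^ 2) := by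
    linarith only [hφn, hψn]
  have hS3' := mul_le_mul_of_nonneg_left hS3 (by positivity : 0 ≤ 3 / 2 * lam)
  rw [hpen]
  linarith only [hgain, hform, hwφ, hS3', hS2, hLΛ, hcross, hQ]

end Slope

/-! ### Descent of the merit function -/

section Descent

variable {n p : ℕ} {ε : ℝ}

/-- The quadratic upper bound for a function that is differentiable along a segment, with gradient
Lipschitz relative to the starting point. -/
lemma le_quadratic_of_gradient_lipschitz {V : Type*} [NormedAddCommGroup V]
    [InnerProductSpace ℝ V] [CompleteSpace V] {h : V → ℝ} {ℓ : ℝ} {X W : V}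
    (hd : ∀ t ∈ Set.Icc (0 : ℝ) 1, DifferentiableAt ℝ h (X + t • W))
    (hl : ∀ t ∈ Set.Icc (0 : ℝ) 1, ‖gradient h (X + t • W) - gradient h X‖ ≤ ℓ * ‖t • W‖) :
    h (X + W) ≤ h X + inner ℝ (gradient h X) W + ℓ / 2 * ‖W‖ ^ 2 := by
  set φ : ℝ → ℝ := fun t => h (X + t • W) - t * inner ℝ (gradient h X) W
    - ℓ / 2 * t ^ 2 * ‖W‖ ^ 2 with hφ
  have hderiv : ∀ t ∈ Set.Icc (0 : ℝ) 1, HasDerivAt φ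
      (inner ℝ (gradient h (X + t • W)) W - inner ℝ (gradient h X) W - ℓ * t * ‖W‖ ^ 2) t := by
    intro t ht
    have h1 : HasDerivAt (fun s : ℝ => X + s • W) W t := by
      simpa using ((hasDerivAt_id t).smul_const W).const_add X
    have h2 := ((hd t ht).hasGradientAt.hasFDerivAt).comp_hasDerivAt t h1
    rw [InnerProductSpace.toDual_apply_apply] at h2
    have h3 : HasDerivAt (fun s : ℝ => s * inner ℝ (gradient h X) W)
        (inner ℝ (gradient h X) W) t := by
      simpa using (hasDerivAt_id t).mul_const (inner ℝ (gradient h X) W)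
    have h4 : HasDerivAt (fun s : ℝ => ℓ / 2 * s ^ 2 * ‖W‖ ^ 2) (ℓ * t * ‖W‖ ^ 2) t := by
      have := (((hasDerivAt_id t).pow 2).const_mul (ℓ / 2)).mul_const (‖W‖ ^ 2)
      refine this.congr_deriv ?_
      simp only [id, Nat.cast_ofNat, Nat.add_one_sub_one, pow_one, mul_one]
      ring
    exact (h2.sub h3).sub h4
  have hanti : AntitoneOn φ (Set.Icc 0 1) := by
    refine antitoneOn_of_deriv_nonpos (convex_Icc 0 1)
      (fun t ht => (hderiv t ht).continuousAt.continuousWithinAt) ?_ ?_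
    · intro t ht
      rw [interior_Icc] at ht
      exact (hderiv t (Set.Ioo_subset_Icc_self ht)).differentiableAt.differentiableWithinAt
    · intro t ht
      rw [interior_Icc] at ht
      have ht' := Set.Ioo_subset_Icc_self ht
      rw [(hderiv t ht').deriv, ← inner_sub_left]
      have h1 := real_inner_le_norm (gradient h (X + t • W) - gradient h X) W
      have h2 := hl t ht'
      rw [norm_smul, Real.norm_eq_abs, abs_of_nonneg ht'.1] at h2
      have h3 := mul_le_mul_of_nonneg_right h2 (norm_nonneg W)
      linarith
  have := hanti (Set.left_mem_Icc.mpr zero_le_one) (Set.right_mem_Icc.mpr zero_le_one) zero_le_one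
  simp only [hφ, one_smul, zero_smul, add_zero, zero_mul, one_mul, one_pow, mul_one, sub_zero,
    zero_pow two_ne_zero, mul_zero] at this
  linarith

lemma merit_eq (f : Mat n p → ℝ) (mu : ℝ) (X : Mat n p) :
    merit f mu X = f X - 1 / 2 * inner ℝ (gradient f X) (ofM (toM X * defect X))
      + mu * penalty X := by
  unfold merit
  rw [inner_symPart_left _ _ (defect_transpose X), inner_ofM_mul_left, ofM_toM,
    Matrix.transpose_transpose]

lemma norm_toM_mul_le {X : Mat n p} (hX : X ∈ safeRegion n p ε) (hε' : ε < 3 / 4) {k : ℕ}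
    (B : Matrix (Fin p) (Fin k) ℝ) : ‖ofM (toM X * B)‖ ≤ 4 / 3 * ‖ofM B‖ := by
  refine le_of_sq_le_sq ((opSqBound_of_mem hX k B).trans ?_) (by positivity)
  nlinarith [sq_nonneg ‖ofM B‖]

lemma norm_transpose_toM_mul_le {X : Mat n p} (hX : X ∈ safeRegion n p ε) (hε : 0 < ε)
    (hε' : ε < 3 / 4) {k : ℕ} (B : Matrix (Fin n) (Fin k) ℝ) :
    ‖ofM ((toM X).transpose * B)‖ ≤ 4 / 3 * ‖ofM B‖ := by
  refine le_of_sq_le_sq (((opSqBound_of_mem hX).transpose_mul (by linarith) B).trans ?_)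
    (by positivity)
  nlinarith [sq_nonneg ‖ofM B‖]

lemma norm_mul_toM_le {X : Mat n p} (hX : X ∈ safeRegion n p ε) (hε : 0 < ε)
    (hε' : ε < 3 / 4) {k : ℕ} (B : Matrix (Fin k) (Fin n) ℝ) :
    ‖ofM (B * toM X)‖ ≤ 4 / 3 * ‖ofM B‖ := by
  refine le_of_sq_le_sq (((opSqBound_of_mem hX).mul_right (by linarith) B).trans ?_)
    (by positivity)
  nlinarith [sq_nonneg ‖ofM B‖]

/-- The derivative of the defect at `X` in the direction `W`. -/
def defectDeriv (X W : Mat n p) : Matrix (Fin p) (Fin p) ℝ :=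
  (toM X).transpose * toM W + (toM W).transpose * toM X

lemma defect_add (X W : Mat n p) :
    defect (X + W) = defect X + defectDeriv X W + (toM W).transpose * toM W := by
  simp only [defect, defectDeriv, toM_add, Matrix.transpose_add, Matrix.mul_add, Matrix.add_mul]
  abel

/-- The derivative of `X ↦ X (Xᵀ X - I)` at `X` in the direction `W`. -/
def cubicDeriv (X W : Mat n p) : Matrix (Fin n) (Fin p) ℝ :=
  toM W * defect X + toM X * defectDeriv X W

lemma cubicDeriv_smul (t : ℝ) (X W : Mat n p) : cubicDeriv X (t • W) = t • cubicDeriv X W := by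
  simp only [cubicDeriv, defectDeriv, toM_smul, Matrix.transpose_smul, Matrix.smul_mul,
    Matrix.mul_smul, smul_add, Matrix.mul_add]

/-- First-order upper model of the increment of the merit function at `X` in the direction `W`. As
only the gradient of `f` is Lipschitz, the derivative of the gradient is replaced by the Lipschitz
bound. -/
noncomputable def meritSlope (f : Mat n p → ℝ) (L mu : ℝ) (X W : Mat n p) : ℝ :=
  inner ℝ (gradient f X) W + L / 2 * ‖W‖ * ‖ofM (toM X * defect X)‖
    - 1 / 2 * inner ℝ (gradient f X) (ofM (cubicDeriv X W))
    + mu * inner ℝ (ofM (toM X * defect X)) W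

lemma meritSlope_smul (f : Mat n p → ℝ) (L mu : ℝ) (X W : Mat n p) {t : ℝ} (ht : 0 ≤ t) :
    meritSlope f L mu X (t • W) = t * meritSlope f L mu X W := by
  unfold meritSlope
  rw [cubicDeriv_smul, ofM_smul, real_inner_smul_right, real_inner_smul_right,
    real_inner_smul_right, norm_smul, Real.norm_eq_abs, abs_of_nonneg ht]
  ring

lemma norm_defect_sub_le (hε : 0 < ε) (hε' : ε < 3 / 4) {X W : Mat n p}
    (hX : X ∈ safeRegion n p ε) (hY : X + W ∈ safeRegion n p ε) :
    ‖ofM (defect (X + W)) - ofM (defect X)‖ ≤ 8 / 3 * ‖W‖ := by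
  have h : defect (X + W) - defect X
      = (toM (X + W)).transpose * toM W + (toM W).transpose * toM X := by
    rw [defect_add, defectDeriv, toM_add, Matrix.transpose_add, Matrix.add_mul]
    abel
  rw [← ofM_sub, h, ofM_add]
  refine (norm_add_le _ _).trans ?_
  have h1 := norm_transpose_toM_mul_le hY hε hε' (toM W)
  have h2 := norm_mul_toM_le hX hε hε' (toM W).transpose
  rw [norm_ofM_transpose] at h2
  rw [ofM_toM] at h1 h2
  linarith

lemma norm_transpose_mul_self_le (W : Mat n p) :
    ‖ofM ((toM W).transpose * toM W)‖ ≤ ‖W‖ ^ 2 := by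
  refine (norm_ofM_mul_le _ _).trans ?_
  rw [norm_ofM_transpose, ofM_toM, pow_two]

/-- Second-order upper expansion of the penalty, whose gradient is `X (Xᵀ X - I)`. -/
lemma penalty_add_le (hε : 0 < ε) (hε' : ε < 3 / 4) {X W : Mat n p}
    (hX : X ∈ safeRegion n p ε) (hY : X + W ∈ safeRegion n p ε) :
    penalty (X + W) ≤ penalty X + inner ℝ (ofM (toM X * defect X)) W + 3 * ‖W‖ ^ 2 := by
  have hd : ‖ofM (defect X)‖ ≤ ε := hX
  have hE := norm_defect_sub_le hε hε' hX hY
  have h1 : ofM (defect (X + W)) = ofM (defect X) + (ofM (defect (X + W)) - ofM (defect X)) := by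
    abel
  have h2 : inner ℝ (ofM (defect X)) (ofM (defect (X + W)) - ofM (defect X))
      = 2 * inner ℝ (ofM (toM X * defect X)) W
        + inner ℝ (ofM (defect X)) (ofM ((toM W).transpose * toM W)) := by
    have h3 : inner ℝ (ofM (defect X)) (ofM ((toM X).transpose * toM W))
        = inner ℝ (ofM (toM X * defect X)) W := by
      rw [← ofM_toM W, inner_ofM_mul_left, toM_ofM]
    have h4 : inner ℝ (ofM (defect X)) (ofM ((toM W).transpose * toM X))
        = inner ℝ (ofM (toM X * defect X)) W := by
      rw [← h3, ← inner_ofM_transpose (defect X) ((toM W).transpose * toM X), defect_transpose,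
        Matrix.transpose_mul, Matrix.transpose_transpose]
    rw [defect_add, defectDeriv, ← h3, ← ofM_sub, add_assoc, add_sub_cancel_left, ofM_add, ofM_add,
      inner_add_right, inner_add_right, h4, h3]
    ring
  unfold penalty
  rw [h1, norm_add_sq_real, h2]
  have h5 := real_inner_le_norm (ofM (defect X)) (ofM ((toM W).transpose * toM W))
  have h6 : ‖ofM (defect X)‖ * ‖ofM ((toM W).transpose * toM W)‖ ≤ 3 / 4 * ‖W‖ ^ 2 := by
    gcongr
    · exact hd.trans hε'.le
    · exact norm_transpose_mul_self_le W
  have h7 : ‖ofM (defect (X + W)) - ofM (defect X)‖ ^ 2 ≤ (8 / 3 * ‖W‖) ^ 2 := by gcongr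
  nlinarith [sq_nonneg ‖W‖]

lemma norm_cubic_sub_le (hε : 0 < ε) (hε' : ε < 3 / 4) {X W : Mat n p}
    (hX : X ∈ safeRegion n p ε) (hY : X + W ∈ safeRegion n p ε) :
    ‖ofM (toM (X + W) * defect (X + W)) - ofM (toM X * defect X)‖ ≤ 5 * ‖W‖ := by
  have h : toM (X + W) * defect (X + W) - toM X * defect X
      = toM W * defect (X + W) + toM X * (defect (X + W) - defect X) := by
    rw [toM_add, Matrix.add_mul, Matrix.mul_sub]
    abel
  have hd : ‖ofM (defect (X + W))‖ ≤ ε := hY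
  rw [← ofM_sub, h, ofM_add]
  refine (norm_add_le _ _).trans ?_
  have h1 : ‖ofM (toM W * defect (X + W))‖ ≤ ‖W‖ * (3 / 4) := by
    refine (norm_ofM_mul_le _ _).trans ?_
    rw [ofM_toM]
    gcongr
    exact hd.trans hε'.le
  have h2 := norm_toM_mul_le hX hε' (defect (X + W) - defect X)
  have h3 := norm_defect_sub_le hε hε' hX hY
  rw [← ofM_sub] at h3
  linarith [norm_nonneg W]

lemma norm_cubic_remainder_le (hε : 0 < ε) (hε' : ε < 3 / 4) {X W : Mat n p}
    (hX : X ∈ safeRegion n p ε) (hY : X + W ∈ safeRegion n p ε) :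
    ‖ofM (toM (X + W) * defect (X + W)) - ofM (toM X * defect X) - ofM (cubicDeriv X W)‖
      ≤ 7 * ‖W‖ ^ 2 := by
  have h : toM (X + W) * defect (X + W) - toM X * defect X - cubicDeriv X W
      = toM (X + W) * ((toM W).transpose * toM W) + toM W * defectDeriv X W := by
    rw [defect_add, cubicDeriv, toM_add]
    simp only [Matrix.add_mul, Matrix.mul_add]
    abel
  rw [← ofM_sub, ← ofM_sub, h, ofM_add]
  refine (norm_add_le _ _).trans ?_
  have h1 := norm_toM_mul_le hY hε' ((toM W).transpose * toM W)
  have h2 := norm_transpose_mul_self_le W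
  have h3 : ‖ofM (toM W * defectDeriv X W)‖ ≤ ‖W‖ * (8 / 3 * ‖W‖) := by
    refine (norm_ofM_mul_le _ _).trans ?_
    rw [ofM_toM]
    gcongr
    unfold defectDeriv
    rw [ofM_add]
    refine (norm_add_le _ _).trans ?_
    have h1 := norm_transpose_toM_mul_le hX hε hε' (toM W)
    have h2 := norm_mul_toM_le hX hε hε' (toM W).transpose
    rw [norm_ofM_transpose] at h2
    rw [ofM_toM] at h1 h2
    linarith
  nlinarith [sq_nonneg ‖W‖]

/-- Constant of the quadratic term in the increment of the merit function that holds without any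
smoothness of the merit function. -/
noncomputable def meritCurvature (L L' mu : ℝ) : ℝ := 6 * L + 7 * L' + 6 * mu

/-- Upper expansion of the merit function along a segment in the safe region. -/
lemma merit_add_le {L L' mu : ℝ} (hε : 0 < ε) (hε' : ε < 3 / 4) (hL : 0 ≤ L) (hmu : 0 ≤ mu)
    {f : Mat n p → ℝ} (hf : Differentiable ℝ f) (hlip : GradLipschitz f ε L) {X W : Mat n p}
    (hG : ‖gradient f X‖ ≤ L')
    (hseg : ∀ t ∈ Set.Icc (0 : ℝ) 1, X + t • W ∈ safeRegion n p ε) :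
    merit f mu (X + W) ≤ merit f mu X + meritSlope f L mu X W
      + meritCurvature L L' mu / 2 * ‖W‖ ^ 2 := by
  have hX : X ∈ safeRegion n p ε := by simpa using hseg 0 (by simp)
  have hY : X + W ∈ safeRegion n p ε := by simpa using hseg 1 (by simp)
  have hquad : f (X + W) ≤ f X + inner ℝ (gradient f X) W + L / 2 * ‖W‖ ^ 2 :=
    le_quadratic_of_gradient_lipschitz (fun t _ => hf _) fun t ht => by
      simpa using hlip _ (hseg t ht) X hX
  have hGG : ‖gradient f (X + W) - gradient f X‖ ≤ L * ‖W‖ := by simpa using hlip _ hY X hX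
  have hpen := mul_le_mul_of_nonneg_left (penalty_add_le hε hε' hX hY) hmu
  have hC1 := norm_cubic_sub_le hε hε' hX hY
  have hC2 := norm_cubic_remainder_le hε hε' hX hY
  rw [merit_eq, merit_eq, meritSlope, meritCurvature]
  set G := gradient f X
  set G' := gradient f (X + W)
  set c := ofM (toM X * defect X)
  set c' := ofM (toM (X + W) * defect (X + W))
  set D := ofM (cubicDeriv X W)
  have hsplit : inner ℝ G' c' - inner ℝ G c
      = inner ℝ (G' - G) c + inner ℝ (G' - G) (c' - c) + inner ℝ G D
        + inner ℝ G (c' - c - D) := by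
    simp only [inner_sub_left, inner_sub_right]
    ring
  have h1 : -(L * ‖W‖ * ‖c‖) ≤ inner ℝ (G' - G) c := by
    have h := neg_le_of_abs_le (abs_real_inner_le_norm (G' - G) c)
    have : ‖G' - G‖ * ‖c‖ ≤ L * ‖W‖ * ‖c‖ := by gcongr
    linarith
  have h2 : -(L * ‖W‖ * (5 * ‖W‖)) ≤ inner ℝ (G' - G) (c' - c) := by
    have h := neg_le_of_abs_le (abs_real_inner_le_norm (G' - G) (c' - c))
    have : ‖G' - G‖ * ‖c' - c‖ ≤ L * ‖W‖ * (5 * ‖W‖) := by gcongr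
    linarith
  have h3 : -(L' * (7 * ‖W‖ ^ 2)) ≤ inner ℝ G (c' - c - D) := by
    have h := neg_le_of_abs_le (abs_real_inner_le_norm G (c' - c - D))
    have hL' : 0 ≤ L' := (norm_nonneg _).trans hG
    have : ‖G‖ * ‖c' - c - D‖ ≤ L' * (7 * ‖W‖ ^ 2) := by gcongr
    linarith
  linarith

lemma muBound_pos {lam L L' : ℝ} (hε : 0 < ε) (hε' : ε < 3 / 4) (hlam : 0 < lam) (hL : 0 ≤ L)
    (hL' : 0 < L') : 0 < muBound ε lam L L' := by
  unfold muBound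
  have h1 : 0 < 3 - 4 * ε := by linarith
  have h2 : 0 ≤ 1 - ε := by linarith
  have h3 : 0 < √(1 + ε) := Real.sqrt_pos.mpr (by linarith)
  positivity

/-- One landing step decreases the merit function, up to the error of the gradient estimate and a
term of second order in the step size. If the merit function is smooth, its directional derivative
along the step is at most the slope `meritSlope`, by comparison of difference quotients. -/
lemma merit_landing_step_le {lam mu L L' Lm γ : ℝ} (hε : 0 < ε) (hε' : ε < 3 / 4)
    (hlam : 0 < lam) (hL : 0 ≤ L) (hL' : 0 < L') (hmu : muBound ε lam L L' ≤ mu)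
    {f : Mat n p → ℝ} (hf : Differentiable ℝ f) (hlip : GradLipschitz f ε L)
    (hfL : ∀ X ∈ safeRegion n p ε, ‖gradient f X‖ ≤ L')
    (hLm : meritCurvature L L' mu ≤ Lm ∨ SmoothOnSafe (merit f mu) ε Lm)
    (hγ : 0 < γ) (hγs : γ ≤ stepSafe ε lam L') {X : Mat n p} (hX : X ∈ safeRegion n p ε)
    {g : Mat n p} (hg : ‖g‖ ≤ L') :
    merit f mu (X - γ • landingDir lam X g) ≤ merit f mu X
      + γ * (-(1 / 4) * ‖rGrad X (gradient f X)‖ ^ 2 - 1 / 4 * ‖rGrad X g‖ ^ 2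
        - lam * mu * penalty X + ‖g - gradient f X‖ ^ 2)
      + Lm / 2 * γ ^ 2 * ‖landingDir lam X g‖ ^ 2 := by
  have hmu0 : 0 < mu := (muBound_pos hε hε' hlam hL hL').trans_le hmu
  set Λ := landingDir lam X g with hΛ
  have hsafe : ∀ t, 0 ≤ t → t ≤ γ → X + t • (-Λ) ∈ safeRegion n p ε := by
    intro t h0 h1
    rw [smul_neg, ← sub_eq_add_neg]
    exact sub_smul_landingDir_mem hε hε' hlam hL' hX hg h0 (h1.trans hγs)
  have hseg : ∀ t, 0 ≤ t → t ≤ γ → ∀ s ∈ Set.Icc (0 : ℝ) 1,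
      X + s • (t • (-Λ)) ∈ safeRegion n p ε := by
    intro t h0 h1 s hs
    rw [smul_smul]
    exact hsafe _ (mul_nonneg hs.1 h0) ((mul_le_of_le_one_left h0 hs.2).trans h1)
  have hslope : meritSlope f L mu X (-Λ) ≤ -(1 / 4) * ‖rGrad X (gradient f X)‖ ^ 2
      - 1 / 4 * ‖rGrad X g‖ ^ 2 - lam * mu * penalty X + ‖g - gradient f X‖ ^ 2 := by
    refine le_trans (le_of_eq ?_) (merit_slope_le hε hε' hlam hL hL' hmu hX (hfL X hX) g)
    have hneg : cubicDeriv X (-Λ) = -cubicDeriv X Λ := by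
      simpa using cubicDeriv_smul (-1) X Λ
    rw [meritSlope, hneg, ofM_neg, inner_neg_right, inner_neg_right, inner_neg_right, norm_neg,
      cubicDeriv, defectDeriv]
    ring
  have hmodel : ∀ t, 0 ≤ t → t ≤ γ → merit f mu (X + t • (-Λ)) ≤ merit f mu X
      + t * meritSlope f L mu X (-Λ) + meritCurvature L L' mu / 2 * t ^ 2 * ‖Λ‖ ^ 2 := by
    intro t h0 h1
    have h := merit_add_le hε hε' hL hmu0.le hf hlip (hfL X hX) (hseg t h0 h1)
    rw [meritSlope_smul _ _ _ _ _ h0, norm_smul, norm_neg, Real.norm_eq_abs, abs_of_nonneg h0] at h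
    linarith
  have hγΛ := mul_le_mul_of_nonneg_left hslope hγ.le
  rw [sub_eq_add_neg, ← smul_neg]
  rcases hLm with hM | ⟨hdiff, hmlip⟩
  · have h := hmodel γ hγ.le le_rfl
    have h2 : meritCurvature L L' mu / 2 * γ ^ 2 * ‖Λ‖ ^ 2 ≤ Lm / 2 * γ ^ 2 * ‖Λ‖ ^ 2 := by gcongr
    linarith
  · have hquad : merit f mu (X + γ • (-Λ)) ≤ merit f mu X
        + inner ℝ (gradient (merit f mu) X) (γ • (-Λ)) + Lm / 2 * ‖γ • (-Λ)‖ ^ 2 :=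
      le_quadratic_of_gradient_lipschitz (fun t ht => hdiff _ (hseg γ hγ.le le_rfl t ht))
        fun t ht => by simpa using hmlip _ (hseg γ hγ.le le_rfl t ht) X hX
    have hdir : inner ℝ (gradient (merit f mu) X) (-Λ) ≤ meritSlope f L mu X (-Λ) := by
      have h1 : HasDerivAt (fun s : ℝ => X + s • (-Λ)) (-Λ) 0 := by
        simpa using ((hasDerivAt_id (0 : ℝ)).smul_const (-Λ)).const_add X
      have h2 : HasDerivAt (fun s : ℝ => merit f mu (X + s • (-Λ)))
          (inner ℝ (gradient (merit f mu) X) (-Λ)) 0 := by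
        have h := (hdiff X hX).hasGradientAt.hasFDerivAt
        have hX0 : X = X + (0 : ℝ) • (-Λ) := by simp
        rw [hX0] at h
        have := h.comp_hasDerivAt (0 : ℝ) h1
        rwa [InnerProductSpace.toDual_apply_apply, ← hX0] at this
      have h3 := (hasDerivAt_iff_tendsto_slope_zero.mp h2).mono_left
        (nhdsWithin_mono (0 : ℝ) (fun t (ht : 0 < t) => ht.ne') :
          nhdsWithin (0 : ℝ) (Set.Ioi 0) ≤ nhdsWithin 0 {0}ᶜ)
      have h4 : Filter.Tendsto (fun t : ℝ => meritSlope f L mu X (-Λ)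
          + meritCurvature L L' mu / 2 * t * ‖Λ‖ ^ 2) (nhdsWithin 0 (Set.Ioi 0))
          (nhds (meritSlope f L mu X (-Λ) + meritCurvature L L' mu / 2 * 0 * ‖Λ‖ ^ 2)) := by
        refine Filter.Tendsto.mono_left (Continuous.tendsto (by fun_prop) _) nhdsWithin_le_nhds
      have h5 := le_of_tendsto_of_tendsto h3 h4 (by
        filter_upwards [Ioc_mem_nhdsGT hγ] with t ht
        have h := hmodel t ht.1.le ht.2
        simp only [zero_add, zero_smul, add_zero, smul_eq_mul]
        rw [inv_mul_le_iff₀ ht.1]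
        linarith)
      simpa using h5
    rw [real_inner_smul_right, norm_smul, norm_neg, Real.norm_eq_abs, abs_of_pos hγ] at hquad
    have := mul_le_mul_of_nonneg_left hdir hγ.le
    linarith

/-- The merit function is bounded below on the safe region, so its infimum is not a junk value. -/
lemma bddBelow_merit {L' mu : ℝ} (hε' : ε < 3 / 4) (hmu : 0 ≤ mu)
    {f : Mat n p → ℝ} (hfL : ∀ X ∈ safeRegion n p ε, ‖gradient f X‖ ≤ L')
    (hb : BddBelow (f '' safeRegion n p ε)) : BddBelow (merit f mu '' safeRegion n p ε) := by
  obtain ⟨b, hb⟩ := hb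
  refine ⟨b - L', ?_⟩
  rintro _ ⟨X, hX, rfl⟩
  have h1 : b ≤ f X := hb ⟨X, hX, rfl⟩
  have h2 : 0 ≤ penalty X := by unfold penalty; positivity
  have h3 := norm_toM_mul_le hX hε' (defect X)
  have hd : ‖ofM (defect X)‖ ≤ ε := hX
  have h4 : inner ℝ (gradient f X) (ofM (toM X * defect X)) ≤ L' * 1 := by
    refine (real_inner_le_norm _ _).trans ?_
    have h0 : 0 ≤ L' := (norm_nonneg _).trans (hfL X hX)
    gcongr
    · exact hfL X hX
    · linarith
  have h0 : 0 ≤ L' := (norm_nonneg _).trans (hfL X hX)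
  rw [merit_eq]
  have := mul_nonneg hmu h2
  linarith

lemma meritInf_le {L' mu : ℝ} (hε' : ε < 3 / 4) (hmu : 0 ≤ mu)
    {f : Mat n p → ℝ} (hfL : ∀ X ∈ safeRegion n p ε, ‖gradient f X‖ ≤ L')
    (hb : BddBelow (f '' safeRegion n p ε)) {X : Mat n p} (hX : X ∈ safeRegion n p ε) :
    meritInf f mu ε ≤ merit f mu X :=
  csInf_le (bddBelow_merit hε' hmu hfL hb) ⟨X, hX, rfl⟩

end Descent

/-! ### Fresh randomness -/

section Probability

variable {Ω 𝓨 𝓩 : Type*} [MeasurableSpace Ω] [MeasurableSpace 𝓨] [MeasurableSpace 𝓩]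
  {P : Measure Ω}

/-- Averaging over a variable `Z` independent of `Y`: a bound that holds with `Y` frozen holds in
expectation. -/
lemma integral_le_of_indepFun [IsProbabilityMeasure P] {Y : Ω → 𝓨} {Z : Ω → 𝓩} {ν : Measure 𝓩}
    [IsProbabilityMeasure ν] (hY : Measurable Y) (hZ : Measurable Z) (hν : P.map Z = ν)
    (hYZ : IndepFun Y Z P) {h : 𝓨 × 𝓩 → ℝ} (hm : Measurable h) (h0 : ∀ z, 0 ≤ h z) {b : Ω → ℝ}
    (hb : Integrable b P) (hint : ∀ ω, Integrable (fun z => h (Y ω, z)) ν)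
    (hle : ∀ ω, ∫ z, h (Y ω, z) ∂ν ≤ b ω) :
    Integrable (fun ω => h (Y ω, Z ω)) P ∧ ∫ ω, h (Y ω, Z ω) ∂P ≤ ∫ ω, b ω ∂P := by
  have hb0 : ∀ ω, 0 ≤ b ω := fun ω => (integral_nonneg fun z => h0 _).trans (hle ω)
  have hmap := (indepFun_iff_map_prod_eq_prod_map_map hY.aemeasurable hZ.aemeasurable).mp hYZ
  rw [hν] at hmap
  have hmo : Measurable fun z => ENNReal.ofReal (h z) := hm.ennreal_ofReal
  have hlin : ∫⁻ ω, ENNReal.ofReal (h (Y ω, Z ω)) ∂P ≤ ∫⁻ ω, ENNReal.ofReal (b ω) ∂P := by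
    calc ∫⁻ ω, ENNReal.ofReal (h (Y ω, Z ω)) ∂P
        = ∫⁻ z, ENNReal.ofReal (h z) ∂(P.map fun ω => (Y ω, Z ω)) :=
          (lintegral_map hmo (hY.prodMk hZ)).symm
      _ = ∫⁻ y, ∫⁻ z, ENNReal.ofReal (h (y, z)) ∂ν ∂(P.map Y) := by
          rw [hmap, lintegral_prod _ hmo.aemeasurable]
      _ = ∫⁻ ω, ∫⁻ z, ENNReal.ofReal (h (Y ω, z)) ∂ν ∂P :=
          lintegral_map hmo.lintegral_prod_right' hY
      _ ≤ ∫⁻ ω, ENNReal.ofReal (b ω) ∂P := by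
          refine lintegral_mono fun ω => ?_
          rw [← ofReal_integral_eq_lintegral_ofReal (hint ω) (Filter.Eventually.of_forall
            fun z => h0 _)]
          exact ENNReal.ofReal_le_ofReal (hle ω)
  have hbfin : ∫⁻ ω, ENNReal.ofReal (b ω) ∂P < ⊤ := by
    rw [← ofReal_integral_eq_lintegral_ofReal hb (Filter.Eventually.of_forall hb0)]
    exact ENNReal.ofReal_lt_top
  have hmeas : Measurable fun ω => h (Y ω, Z ω) := hm.comp (hY.prodMk hZ)
  have hI : Integrable (fun ω => h (Y ω, Z ω)) P := by
    refine ⟨hmeas.aestronglyMeasurable, ?_⟩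
    rw [hasFiniteIntegral_iff_ofReal (Filter.Eventually.of_forall fun ω => h0 _)]
    exact hlin.trans_lt hbfin
  refine ⟨hI, ?_⟩
  rw [← ofReal_integral_eq_lintegral_ofReal hI (Filter.Eventually.of_forall fun ω => h0 _),
    ← ofReal_integral_eq_lintegral_ofReal hb (Filter.Eventually.of_forall hb0)] at hlin
  exact (ENNReal.ofReal_le_ofReal_iff (integral_nonneg hb0)).mp hlin

variable {V : Type*} [NormedAddCommGroup V] [InnerProductSpace ℝ V]

lemma integrable_inner_of_memLp {A B : Ω → V} (hA : MemLp A 2 P) (hB : MemLp B 2 P) :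
    Integrable (fun ω => inner ℝ (A ω) (B ω)) P := by
  have hA2 := (memLp_two_iff_integrable_sq_norm hA.1).mp hA
  have hB2 := (memLp_two_iff_integrable_sq_norm hB.1).mp hB
  refine (hA2.add hB2).mono' (hA.1.inner hB.1) (Filter.Eventually.of_forall fun ω => ?_)
  rw [Real.norm_eq_abs]
  refine (abs_real_inner_le_norm _ _).trans ?_
  simp only [Pi.add_apply]
  nlinarith [sq_nonneg (‖A ω‖ - ‖B ω‖), sq_nonneg ‖A ω‖, sq_nonneg ‖B ω‖]

lemma integrable_norm_sq {E : Type*} [NormedAddCommGroup E] {A : Ω → E} (hA : MemLp A 2 P) :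
    Integrable (fun ω => ‖A ω‖ ^ 2) P :=
  (memLp_two_iff_integrable_sq_norm hA.1).mp hA

/-- A function of `Y` is orthogonal to a function of `(Y, Z)` that is centered in `Z`, if `Z` is
independent of `Y`. -/
lemma integral_inner_eq_zero_of_indepFun [IsProbabilityMeasure P] [CompleteSpace V]
    {Y : Ω → 𝓨} {Z : Ω → 𝓩}
    {ν : Measure 𝓩} [IsProbabilityMeasure ν] (hY : Measurable Y) (hZ : Measurable Z)
    (hν : P.map Z = ν) (hYZ : IndepFun Y Z P) {A : 𝓨 → V} {R : 𝓨 × 𝓩 → V}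
    (hA : StronglyMeasurable A) (hR : StronglyMeasurable R) (hA2 : MemLp (fun ω => A (Y ω)) 2 P)
    (hR2 : MemLp (fun ω => R (Y ω, Z ω)) 2 P)
    (hint : ∀ ω, Integrable (fun z => R (Y ω, z)) ν)
    (hzero : ∀ ω, ∫ z, R (Y ω, z) ∂ν = 0) :
    ∫ ω, inner ℝ (A (Y ω)) (R (Y ω, Z ω)) ∂P = 0 := by
  have hmap := (indepFun_iff_map_prod_eq_prod_map_map hY.aemeasurable hZ.aemeasurable).mp hYZ
  rw [hν] at hmap
  set h : 𝓨 × 𝓩 → ℝ := fun z => inner ℝ (A z.1) (R z) with hh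
  have hm : StronglyMeasurable h := (hA.comp_measurable measurable_fst).inner hR
  have hYm : IsProbabilityMeasure (P.map Y) := Measure.isProbabilityMeasure_map hY.aemeasurable
  have hI : Integrable h ((P.map Y).prod ν) := by
    rw [← hmap, integrable_map_measure hm.aestronglyMeasurable (hY.prodMk hZ).aemeasurable]
    exact integrable_inner_of_memLp hA2 hR2
  calc ∫ ω, inner ℝ (A (Y ω)) (R (Y ω, Z ω)) ∂P
      = ∫ z, h z ∂(P.map fun ω => (Y ω, Z ω)) :=
        (integral_map (hY.prodMk hZ).aemeasurable hm.aestronglyMeasurable).symm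
    _ = ∫ y, ∫ z, h (y, z) ∂ν ∂(P.map Y) := by rw [hmap, integral_prod _ hI]
    _ = ∫ ω, ∫ z, h (Y ω, z) ∂ν ∂P :=
        integral_map hY.aemeasurable hm.integral_prod_right'.aestronglyMeasurable
    _ = ∫ ω, (0 : ℝ) ∂P := by
        refine integral_congr_ae (Filter.Eventually.of_forall fun ω => ?_)
        simp only [hh]
        rw [integral_inner (hint ω), hzero, inner_zero_right]
    _ = 0 := integral_zero _ _

/-- Adding orthogonal noise of second moment at most `s`. -/
lemma integral_norm_add_sq_le {A R : Ω → V} {c s : ℝ} (hA : MemLp A 2 P) (hR : MemLp R 2 P)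
    (horth : ∫ ω, inner ℝ (A ω) (R ω) ∂P = 0) (hs : ∫ ω, ‖R ω‖ ^ 2 ∂P ≤ s) :
    ∫ ω, ‖A ω + c • R ω‖ ^ 2 ∂P ≤ ∫ ω, ‖A ω‖ ^ 2 ∂P + c ^ 2 * s := by
  have h : ∀ ω, ‖A ω + c • R ω‖ ^ 2
      = ‖A ω‖ ^ 2 + 2 * c * inner ℝ (A ω) (R ω) + c ^ 2 * ‖R ω‖ ^ 2 := by
    intro ω
    rw [norm_add_sq_real, real_inner_smul_right, norm_smul, mul_pow, Real.norm_eq_abs, sq_abs]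
    ring
  have hA2 := integrable_norm_sq hA
  have hR2 := integrable_norm_sq hR
  have hAR := integrable_inner_of_memLp hA hR
  rw [integral_congr_ae (Filter.Eventually.of_forall h),
    integral_add (by exact hA2.add (hAR.const_mul _)) (hR2.const_mul _),
    integral_add hA2 (hAR.const_mul _), integral_const_mul, integral_const_mul, horth]
  nlinarith [mul_le_mul_of_nonneg_left hs (sq_nonneg c)]

/-- Variance of an average of uncorrelated vectors. -/
lemma integral_norm_avg_sq_le {N : ℕ} (hN : 0 < N) {R : Fin N → Ω → V} {s : ℝ}
    (hR : ∀ i, MemLp (R i) 2 P) (horth : ∀ i j, i ≠ j → ∫ ω, inner ℝ (R i ω) (R j ω) ∂P = 0)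
    (hs : ∀ i, ∫ ω, ‖R i ω‖ ^ 2 ∂P ≤ s) :
    ∫ ω, ‖(1 / (N : ℝ)) • ∑ i, R i ω‖ ^ 2 ∂P ≤ s / N := by
  have hN' : (0 : ℝ) < N := by exact_mod_cast hN
  have h : ∀ ω, ‖(1 / (N : ℝ)) • ∑ i, R i ω‖ ^ 2
      = (1 / (N : ℝ)) ^ 2 * ∑ i, ∑ j, inner ℝ (R i ω) (R j ω) := by
    intro ω
    rw [norm_smul, mul_pow, Real.norm_eq_abs, sq_abs, ← real_inner_self_eq_norm_sq, sum_inner]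
    simp only [inner_sum]
  have hI : ∀ i j, Integrable (fun ω => inner ℝ (R i ω) (R j ω)) P := fun i j =>
    integrable_inner_of_memLp (hR i) (hR j)
  rw [integral_congr_ae (Filter.Eventually.of_forall h), integral_const_mul,
    integral_finsetSum _ fun i _ => integrable_finsetSum _ fun j _ => hI i j]
  have h2 : ∀ i, ∫ ω, ∑ j, inner ℝ (R i ω) (R j ω) ∂P ≤ s := by
    intro i
    rw [integral_finsetSum _ fun j _ => hI i j, Finset.sum_eq_single i
      (fun j _ hj => horth i j hj.symm) (fun hi => absurd (Finset.mem_univ i) hi)]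
    simpa only [real_inner_self_eq_norm_sq] using hs i
  calc (1 / (N : ℝ)) ^ 2 * ∑ i, ∫ ω, ∑ j, inner ℝ (R i ω) (R j ω) ∂P
      ≤ (1 / (N : ℝ)) ^ 2 * ∑ _i : Fin N, s := by
        gcongr with i
        exact h2 i
    _ = s / N := by
        simp
        field_simp

/-- Young's inequality in the form of a contraction by the factor `1 - η`. -/
lemma contraction_young {E : Type*} [NormedAddCommGroup E] {η : ℝ} (h0 : 0 < η) (h1 : η ≤ 1)
    (A B : E) :
    (1 - η) ^ 2 * ‖A + B‖ ^ 2 ≤ (1 - η) * ‖A‖ ^ 2 + (1 - η) ^ 2 / η * ‖B‖ ^ 2 := by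
  have h2 : ‖A + B‖ ^ 2 ≤ (‖A‖ + ‖B‖) ^ 2 := by
    gcongr
    exact norm_add_le _ _
  have h3 : (1 - η) ^ 2 * (‖A‖ + ‖B‖) ^ 2
      = (1 - η) * ‖A‖ ^ 2 + (1 - η) ^ 2 / η * ‖B‖ ^ 2
        - (1 - η) / η * (η * ‖A‖ - (1 - η) * ‖B‖) ^ 2 := by
    field_simp
    ring
  have h4 : 0 ≤ (1 - η) / η * (η * ‖A‖ - (1 - η) * ‖B‖) ^ 2 :=
    mul_nonneg (div_nonneg (by linarith) h0.le) (sq_nonneg _)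
  have h5 := mul_le_mul_of_nonneg_left h2 (sq_nonneg (1 - η))
  linarith

/-- Convexity of the square of the norm. -/
lemma norm_avg_sq_le {N : ℕ} (hN : 0 < N) (A : Fin N → V) :
    ‖(1 / (N : ℝ)) • ∑ i, A i‖ ^ 2 ≤ 1 / (N : ℝ) * ∑ i, ‖A i‖ ^ 2 := by
  have hN' : (0 : ℝ) < N := by exact_mod_cast hN
  rw [norm_smul, mul_pow, Real.norm_eq_abs, sq_abs]
  have h1 : ‖∑ i, A i‖ ^ 2 ≤ (∑ i, ‖A i‖) ^ 2 := by
    gcongr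
    exact norm_sum_le _ _
  have h2 := sq_sum_le_card_mul_sum_sq (s := Finset.univ) (f := fun i => ‖A i‖)
  rw [Finset.card_univ, Fintype.card_fin] at h2
  calc (1 / (N : ℝ)) ^ 2 * ‖∑ i, A i‖ ^ 2
      ≤ (1 / (N : ℝ)) ^ 2 * (N * ∑ i, ‖A i‖ ^ 2) := by
        gcongr
        exact h1.trans h2
    _ = _ := by field_simp

end Probability

/-! ### Measurability and independence along a run -/

section Measurability

variable {n p N : ℕ} {Ξ S Ω : Type*}

lemma continuous_toM : Continuous (toM : Mat n p → Matrix (Fin n) (Fin p) ℝ) := by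
  unfold toM
  refine continuous_matrix fun i j => ?_
  simp only [Matrix.of_apply]
  fun_prop

lemma continuous_ofM : Continuous (ofM : Matrix (Fin n) (Fin p) ℝ → Mat n p) := by
  unfold ofM
  refine (PiLp.continuous_toLp 2 _).comp (continuous_pi fun q => ?_)
  fun_prop

lemma continuous_defect : Continuous (defect : Mat n p → Matrix (Fin p) (Fin p) ℝ) := by
  unfold defect
  have := continuous_toM (n := n) (p := p)
  fun_prop

lemma continuous_penalty : Continuous (penalty : Mat n p → ℝ) := by
  unfold penalty
  have h1 := continuous_ofM.comp (continuous_defect (n := n) (p := p))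
  exact continuous_const.mul (h1.norm.pow 2)

lemma continuous_rGrad : Continuous fun z : Mat n p × Mat n p => rGrad z.1 z.2 := by
  unfold rGrad skewPart
  have h := continuous_toM (n := n) (p := p)
  refine continuous_ofM.comp ?_
  have h1 : Continuous fun z : Mat n p × Mat n p => toM z.1 := h.comp continuous_fst
  have h2 : Continuous fun z : Mat n p × Mat n p => toM z.2 := h.comp continuous_snd
  fun_prop

lemma continuous_landingDir (lam : ℝ) :
    Continuous fun z : Mat n p × Mat n p => landingDir lam z.1 z.2 := by
  unfold landingDir
  have h1 := continuous_rGrad (n := n) (p := p)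
  have h2 : Continuous fun z : Mat n p × Mat n p => ofM (toM z.1 * defect z.1) := by
    refine continuous_ofM.comp ?_
    have h := continuous_toM.comp (continuous_fst (X := Mat n p) (Y := Mat n p))
    have h' := continuous_defect.comp (continuous_fst (X := Mat n p) (Y := Mat n p))
    exact Continuous.matrix_mul h h'
  exact h1.add (h2.const_smul lam)

lemma measurable_clip (L' : ℝ) : Measurable (clip L' : Mat n p → Mat n p) := by
  unfold clip
  exact (measurable_const.min (measurable_const.div measurable_norm)).smul measurable_id

lemma measurable_gradient (h : Mat n p → ℝ) : Measurable (gradient h) :=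
  (InnerProductSpace.toDual ℝ (Mat n p)).symm.continuous.measurable.comp (measurable_fderiv ℝ h)

/-- The state of the algorithm at time `k` as a random variable. -/
noncomputable def path (F : Mat n p → Ξ → ℝ) (C : Mat n p → S → Mat n p) (lam η γ L' : ℝ)
    (X₀ : Mat n p) (ξ : Fin N → ℕ → Ω → Ξ) (ζ : ℕ → Ω → Fin N → S) (k : ℕ) (ω : Ω) : State n p N :=
  run F C lam η γ L' X₀ (fun i j => ξ i j ω) (fun j => ζ j ω) k

variable {F : Mat n p → Ξ → ℝ} {C : Mat n p → S → Mat n p} {lam η γ L' : ℝ} {X₀ : Mat n p}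
  {ξ : Fin N → ℕ → Ω → Ξ} {ζ : ℕ → Ω → Fin N → S}

local notation "𝒮" => path F C lam η γ L' X₀ ξ ζ

lemma path_zero_X (ω : Ω) : (𝒮 0 ω).X = X₀ := rfl

lemma path_zero_v (i : Fin N) (ω : Ω) : (𝒮 0 ω).v i = stochGrad F X₀ (ξ i 0 ω) := rfl

lemma path_zero_g (i : Fin N) (ω : Ω) : (𝒮 0 ω).g i = C ((𝒮 0 ω).v i) (ζ 0 ω i) := rfl

lemma path_succ_X (k : ℕ) (ω : Ω) : (𝒮 (k + 1) ω).X
    = (𝒮 k ω).X - γ • landingDir lam (𝒮 k ω).X (clip L' (𝒮 k ω).gm) := rfl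

lemma path_succ_v (k : ℕ) (i : Fin N) (ω : Ω) : (𝒮 (k + 1) ω).v i
    = (1 - η) • (𝒮 k ω).v i + η • stochGrad F (𝒮 (k + 1) ω).X (ξ i (k + 1) ω) := rfl

lemma path_succ_g (k : ℕ) (i : Fin N) (ω : Ω) : (𝒮 (k + 1) ω).g i
    = (𝒮 k ω).g i + C ((𝒮 (k + 1) ω).v i - (𝒮 k ω).g i) (ζ (k + 1) ω i) := rfl

lemma path_succ_gm (k : ℕ) (ω : Ω) : (𝒮 (k + 1) ω).gm = (𝒮 k ω).gm
    + (1 / (N : ℝ)) • ∑ i, C ((𝒮 (k + 1) ω).v i - (𝒮 k ω).g i) (ζ (k + 1) ω i) := rfl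

/-- The master's estimate is the average of the local ones. -/
lemma path_gm_eq (k : ℕ) (ω : Ω) : (𝒮 k ω).gm = (1 / (N : ℝ)) • ∑ i, (𝒮 k ω).g i := by
  induction k with
  | zero => rfl
  | succ k ih =>
    rw [path_succ_gm, ih, ← smul_add, ← Finset.sum_add_distrib]
    rfl

variable [MeasurableSpace Ξ]

/-- The noise of the stochastic gradient of node `i`. -/
noncomputable def gradNoise (F : Mat n p → Ξ → ℝ) (D : Fin N → Measure Ξ) (i : Fin N)
    (z : Mat n p × Ξ) : Mat n p := stochGrad F z.1 z.2 - gradient (localObj F D i) z.1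

/-- The momentum update as a convex combination with the exact gradient, plus noise. -/
lemma path_succ_v_eq (D : Fin N → Measure Ξ) (k : ℕ) (i : Fin N) (ω : Ω) : (𝒮 (k + 1) ω).v i
    = ((1 - η) • (𝒮 k ω).v i + η • gradient (localObj F D i) (𝒮 (k + 1) ω).X)
      + η • gradNoise F D i ((𝒮 (k + 1) ω).X, ξ i (k + 1) ω) := by
  rw [path_succ_v, gradNoise]
  module

lemma path_gm_sub_eq (D : Fin N → Measure Ξ) (k : ℕ) (ω : Ω) :
    (𝒮 k ω).gm - gradient (globalObj F D) (𝒮 k ω).X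
    = (1 / (N : ℝ)) • ∑ i, ((𝒮 k ω).g i - (𝒮 k ω).v i)
      + ((1 / (N : ℝ)) • (∑ i, (𝒮 k ω).v i) - gradient (globalObj F D) (𝒮 k ω).X) := by
  rw [path_gm_eq, Finset.sum_sub_distrib, smul_sub]
  abel

variable [MeasurableSpace S]

lemma measurable_path {mΩ : MeasurableSpace Ω}
    (hF : Measurable fun z : Mat n p × Ξ => stochGrad F z.1 z.2)
    (hC : Measurable fun z : Mat n p × S => C z.1 z.2) (k : ℕ)
    (hξ : ∀ i, ∀ j ≤ k, Measurable (ξ i j)) (hζ : ∀ j ≤ k, Measurable (ζ j)) :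
    Measurable (fun ω => (𝒮 k ω).X) ∧ (∀ i, Measurable fun ω => (𝒮 k ω).v i) ∧
      (∀ i, Measurable fun ω => (𝒮 k ω).g i) ∧ Measurable fun ω => (𝒮 k ω).gm := by
  have avg : ∀ {u : Fin N → Ω → Mat n p}, (∀ i, Measurable (u i)) →
      Measurable fun ω => (1 / (N : ℝ)) • ∑ i, u i ω := by
    intro u hu
    have h : Measurable fun ω => ∑ i, u i ω := Finset.measurable_fun_sum _ fun i _ => hu i
    exact h.const_smul (1 / (N : ℝ))
  induction k with
  | zero =>
    have hv : ∀ i, Measurable fun ω => (𝒮 0 ω).v i := fun i =>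
      hF.comp (measurable_const.prodMk (hξ i 0 le_rfl))
    have hg : ∀ i, Measurable fun ω => (𝒮 0 ω).g i := fun i =>
      hC.comp ((hv i).prodMk ((measurable_pi_apply i).comp (hζ 0 le_rfl)))
    exact ⟨measurable_const, hv, hg, avg hg⟩
  | succ k ih =>
    obtain ⟨hX, hv, hg, hgm⟩ := ih (fun i j hj => hξ i j (hj.trans k.le_succ))
      fun j hj => hζ j (hj.trans k.le_succ)
    have hX' : Measurable fun ω => (𝒮 (k + 1) ω).X :=
      hX.sub (((continuous_landingDir lam).measurable.comp
        (hX.prodMk ((measurable_clip L').comp hgm))).const_smul γ)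
    have hv' : ∀ i, Measurable fun ω => (𝒮 (k + 1) ω).v i := fun i =>
      ((hv i).const_smul (1 - η)).add
        ((hF.comp (hX'.prodMk (hξ i (k + 1) le_rfl))).const_smul η)
    have hc : ∀ i, Measurable fun ω =>
        C ((𝒮 (k + 1) ω).v i - (𝒮 k ω).g i) (ζ (k + 1) ω i) := fun i =>
      hC.comp (((hv' i).sub (hg i)).prodMk
        ((measurable_pi_apply i).comp (hζ (k + 1) le_rfl)))
    exact ⟨hX', hv', fun i => (hg i).add (hc i), hgm.add (avg hc)⟩

/-- The iterate of round `k` is a function of the randomness of the rounds before `k`, whereas the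
momenta also depend on the samples of round `k`, see `measurable_path_v`. -/
lemma measurable_path_X {mΩ : MeasurableSpace Ω}
    (hF : Measurable fun z : Mat n p × Ξ => stochGrad F z.1 z.2)
    (hC : Measurable fun z : Mat n p × S => C z.1 z.2) (k : ℕ)
    (hξ : ∀ i, ∀ j < k, Measurable (ξ i j)) (hζ : ∀ j < k, Measurable (ζ j)) :
    Measurable fun ω => (𝒮 k ω).X := by
  cases k with
  | zero => exact measurable_const
  | succ k =>
    obtain ⟨hX, -, -, hgm⟩ := measurable_path (lam := lam) (η := η) (γ := γ) (L' := L')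
      (X₀ := X₀) hF hC k (fun i j hj => hξ i j (Nat.lt_succ_of_le hj))
      fun j hj => hζ j (Nat.lt_succ_of_le hj)
    exact hX.sub (((continuous_landingDir lam).measurable.comp
        (hX.prodMk ((measurable_clip L').comp hgm))).const_smul γ)

lemma measurable_path_v {mΩ : MeasurableSpace Ω}
    (hF : Measurable fun z : Mat n p × Ξ => stochGrad F z.1 z.2)
    (hC : Measurable fun z : Mat n p × S => C z.1 z.2) (k : ℕ)
    (hξ : ∀ i, ∀ j ≤ k, Measurable (ξ i j)) (hζ : ∀ j < k, Measurable (ζ j)) (i : Fin N) :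
    Measurable fun ω => (𝒮 k ω).v i := by
  have hX : Measurable fun ω => (𝒮 k ω).X :=
    measurable_path_X hF hC k (fun i j hj => hξ i j hj.le) hζ
  cases k with
  | zero => exact hF.comp (measurable_const.prodMk (hξ i 0 le_rfl))
  | succ k =>
    obtain ⟨-, hv, -, -⟩ := measurable_path (lam := lam) (η := η) (γ := γ) (L' := L')
      (X₀ := X₀) hF hC k (fun i j hj => hξ i j (hj.trans k.le_succ))
      fun j hj => hζ j (Nat.lt_succ_of_le hj)
    exact ((hv i).const_smul (1 - η)).add
        ((hF.comp (hX.prodMk (hξ i (k + 1) le_rfl))).const_smul η)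

/-- The σ-algebras generated by the single samples and by the seed vectors. -/
abbrev sourceSigma (ξ : Fin N → ℕ → Ω → Ξ) (ζ : ℕ → Ω → Fin N → S) :
    (Fin N × ℕ) ⊕ ℕ → MeasurableSpace Ω :=
  Sum.elim (fun q => MeasurableSpace.comap (ξ q.1 q.2) inferInstance)
    (fun k => MeasurableSpace.comap (ζ k) inferInstance)

/-- The σ-algebra generated by the sources of randomness in `T`. -/
abbrev sourceSup (ξ : Fin N → ℕ → Ω → Ξ) (ζ : ℕ → Ω → Fin N → S) (T : Set ((Fin N × ℕ) ⊕ ℕ)) :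
    MeasurableSpace Ω := ⨆ t ∈ T, sourceSigma ξ ζ t

lemma measurable_sample_sourceSup {T : Set ((Fin N × ℕ) ⊕ ℕ)} {i : Fin N} {k : ℕ}
    (h : Sum.inl (i, k) ∈ T) : Measurable[sourceSup ξ ζ T] (ξ i k) :=
  measurable_iff_comap_le.mpr (le_iSup₂_of_le (f := fun t _ => sourceSigma ξ ζ t) _ h le_rfl)

lemma measurable_seed_sourceSup {T : Set ((Fin N × ℕ) ⊕ ℕ)} {k : ℕ}
    (h : Sum.inr k ∈ T) : Measurable[sourceSup ξ ζ T] (ζ k) :=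
  measurable_iff_comap_le.mpr (le_iSup₂_of_le (f := fun t _ => sourceSigma ξ ζ t) _ h le_rfl)

/-- The sources of randomness of the rounds before `k`. -/
def past (N k : ℕ) : Set ((Fin N × ℕ) ⊕ ℕ) := {t | Sum.elim (fun q => q.2 < k) (fun j => j < k) t}

/-- The sources of randomness of the rounds before `k` and the samples of round `k`. -/
def pastAndSamples (N k : ℕ) : Set ((Fin N × ℕ) ⊕ ℕ) :=
  {t | Sum.elim (fun q => q.2 ≤ k) (fun j => j < k) t}

lemma measurable_X_of_past (hF : Measurable fun z : Mat n p × Ξ => stochGrad F z.1 z.2)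
    (hC : Measurable fun z : Mat n p × S => C z.1 z.2) {k : ℕ} {T : Set ((Fin N × ℕ) ⊕ ℕ)}
    (hT : past N k ⊆ T) : Measurable[sourceSup ξ ζ T] fun ω => (𝒮 k ω).X :=
  measurable_path_X (mΩ := sourceSup ξ ζ T) hF hC k
    (fun i _ hj => measurable_sample_sourceSup (hT (show Sum.inl (i, _) ∈ past N k from hj)))
    fun _ hj => measurable_seed_sourceSup (hT (show Sum.inr _ ∈ past N k from hj))

lemma measurable_v_of_past (hF : Measurable fun z : Mat n p × Ξ => stochGrad F z.1 z.2)
    (hC : Measurable fun z : Mat n p × S => C z.1 z.2) {k : ℕ} {T : Set ((Fin N × ℕ) ⊕ ℕ)}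
    (hT : pastAndSamples N k ⊆ T) (i : Fin N) :
    Measurable[sourceSup ξ ζ T] fun ω => (𝒮 k ω).v i :=
  measurable_path_v (mΩ := sourceSup ξ ζ T) hF hC k
    (fun i _ hj => measurable_sample_sourceSup
      (hT (show Sum.inl (i, _) ∈ pastAndSamples N k from hj)))
    (fun _ hj => measurable_seed_sourceSup (hT (show Sum.inr _ ∈ pastAndSamples N k from hj))) i

lemma measurable_g_of_past (hF : Measurable fun z : Mat n p × Ξ => stochGrad F z.1 z.2)
    (hC : Measurable fun z : Mat n p × S => C z.1 z.2) {k : ℕ} {T : Set ((Fin N × ℕ) ⊕ ℕ)}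
    (hT : past N (k + 1) ⊆ T) (i : Fin N) :
    Measurable[sourceSup ξ ζ T] fun ω => (𝒮 k ω).g i :=
  (measurable_path (mΩ := sourceSup ξ ζ T) hF hC k
    (fun i _ hj => measurable_sample_sourceSup
      (hT (show Sum.inl (i, _) ∈ past N (k + 1) from Nat.lt_succ_of_le hj)))
    (fun _ hj => measurable_seed_sourceSup
      (hT (show Sum.inr _ ∈ past N (k + 1) from Nat.lt_succ_of_le hj)))).2.2.1 i

lemma pastAndSamples_subset (N k : ℕ) : pastAndSamples N k ⊆ past N (k + 1) := by
  rintro (⟨i, j⟩ | j) h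
  · exact Nat.lt_succ_of_le h
  · exact Nat.lt_succ_of_lt h

lemma past_subset (N k : ℕ) : past N k ⊆ pastAndSamples N k := by
  rintro (⟨i, j⟩ | j) h
  · exact (show j < k from h).le
  · exact h

variable [MeasurableSpace Ω] {P : Measure Ω} {D : Fin N → Measure Ξ} {ρ : Measure S}

lemma Sampling.sourceSigma_le (h : Sampling P D ρ ξ ζ) (t : (Fin N × ℕ) ⊕ ℕ) :
    sourceSigma ξ ζ t ≤ ‹MeasurableSpace Ω› := by
  rcases t with ⟨i, k⟩ | k
  · exact (h.measurable_sample i k).comap_le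
  · exact (h.measurable_seed k).comap_le

lemma Sampling.sourceSup_le (h : Sampling P D ρ ξ ζ) (T : Set ((Fin N × ℕ) ⊕ ℕ)) :
    sourceSup ξ ζ T ≤ ‹MeasurableSpace Ω› :=
  iSup₂_le fun t _ => h.sourceSigma_le t

lemma Sampling.indep_source (h : Sampling P D ρ ξ ζ) {T : Set ((Fin N × ℕ) ⊕ ℕ)}
    {t : (Fin N × ℕ) ⊕ ℕ} (ht : t ∉ T) : Indep (sourceSup ξ ζ T) (sourceSigma ξ ζ t) P := by
  have h1 := indep_iSup_of_disjoint h.sourceSigma_le h.indep (S := T) (T := {t})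
    (Set.disjoint_singleton_right.mpr ht)
  exact indep_of_indep_of_le_right h1
    (le_iSup₂_of_le (f := fun t _ => sourceSigma ξ ζ t) t rfl le_rfl)

lemma Sampling.indepFun_sample (h : Sampling P D ρ ξ ζ) {T : Set ((Fin N × ℕ) ⊕ ℕ)} {i : Fin N}
    {k : ℕ} (ht : Sum.inl (i, k) ∉ T) {𝓨 : Type*} [MeasurableSpace 𝓨] {Y : Ω → 𝓨}
    (hY : Measurable[sourceSup ξ ζ T] Y) : IndepFun Y (ξ i k) P := by
  rw [IndepFun_iff_Indep]
  exact indep_of_indep_of_le_left (h.indep_source ht) hY.comap_le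

lemma Sampling.indepFun_seed (h : Sampling P D ρ ξ ζ) {T : Set ((Fin N × ℕ) ⊕ ℕ)} {k : ℕ}
    (ht : Sum.inr k ∉ T) (i : Fin N) {𝓨 : Type*} [MeasurableSpace 𝓨] {Y : Ω → 𝓨}
    (hY : Measurable[sourceSup ξ ζ T] Y) : IndepFun Y (fun ω => ζ k ω i) P := by
  rw [IndepFun_iff_Indep]
  refine indep_of_indep_of_le_left (indep_of_indep_of_le_right (h.indep_source ht) ?_) hY.comap_le
  rw [← measurable_iff_comap_le]
  exact (measurable_pi_apply i).comp (comap_measurable (ζ k))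

end Measurability

/-! ### One round of the algorithm in expectation -/

section Recursion

variable {n p N : ℕ} {Ξ S Ω : Type*} [MeasurableSpace Ξ] [MeasurableSpace S] [MeasurableSpace Ω]

/-- The standing assumptions on the problem, the compressor, the randomness and the step size. -/
structure RunAssumptions (F : Mat n p → Ξ → ℝ) (D : Fin N → Measure Ξ) (Li : Fin N → ℝ)
    (ε L L' σ : ℝ) (C : Mat n p → S → Mat n p) (ρ : Measure S) (α : ℝ) (P : Measure Ω)
    (ξ : Fin N → ℕ → Ω → Ξ) (ζ : ℕ → Ω → Fin N → S) (X₀ : Mat n p) (lam η γ : ℝ) : Prop where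
  prob_space : IsProbabilityMeasure P
  prob_data : ∀ i, IsProbabilityMeasure (D i)
  prob_seed : IsProbabilityMeasure ρ
  eps_pos : 0 < ε
  eps_lt : ε < 3 / 4
  lam_pos : 0 < lam
  L_nonneg : 0 ≤ L
  bound_pos : 0 < L'
  nodes_pos : 0 < N
  wellPosed : WellPosed F D ε
  gradBound : GradientBound F D ε L'
  smooth : LocalSmoothness F D ε Li
  lipschitz : GradLipschitz (globalObj F D) ε L
  unbiased : UnbiasedBoundedVariance F D ε σ
  compressor : ContractiveCompressor C ρ α
  sampling : Sampling P D ρ ξ ζ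
  init_mem : X₀ ∈ safeRegion n p ε
  eta_pos : 0 < η
  eta_le : η ≤ 1
  gamma_pos : 0 < γ
  gamma_le : γ ≤ stepSafe ε lam L'

/-- The mean square error of the local estimate `g i`, relative to the momentum `v i`. -/
noncomputable def compressionError (P : Measure Ω) (s : Ω → State n p N) (i : Fin N) : ℝ :=
  ∫ ω, ‖(s ω).g i - (s ω).v i‖ ^ 2 ∂P

/-- The mean square error of the momentum `v i`, relative to the gradient of the local
objective. -/
noncomputable def momentumError (F : Mat n p → Ξ → ℝ) (D : Fin N → Measure Ξ) (P : Measure Ω)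
    (s : Ω → State n p N) (i : Fin N) : ℝ :=
  ∫ ω, ‖(s ω).v i - gradient (localObj F D i) (s ω).X‖ ^ 2 ∂P

/-- The mean square error of the averaged momentum, relative to the gradient of the objective. -/
noncomputable def meanMomentumError (F : Mat n p → Ξ → ℝ) (D : Fin N → Measure Ξ) (P : Measure Ω)
    (s : Ω → State n p N) : ℝ :=
  ∫ ω, ‖(1 / (N : ℝ)) • (∑ i, (s ω).v i) - gradient (globalObj F D) (s ω).X‖ ^ 2 ∂P

variable {F : Mat n p → Ξ → ℝ} {D : Fin N → Measure Ξ}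
  {Li : Fin N → ℝ} {ε L L' σ : ℝ} {C : Mat n p → S → Mat n p} {ρ : Measure S}
  {α : ℝ} {P : Measure Ω}
  {ξ : Fin N → ℕ → Ω → Ξ} {ζ : ℕ → Ω → Fin N → S} {X₀ : Mat n p} {lam η γ : ℝ}

local notation "𝒮" => path F C lam η γ L' X₀ ξ ζ

local notation "𝓗" => RunAssumptions F D Li ε L L' σ C ρ α P ξ ζ X₀ lam η γ

namespace RunAssumptions

lemma X_mem (h : 𝓗) (k : ℕ) (ω : Ω) : (𝒮 k ω).X ∈ safeRegion n p ε := by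
  induction k with
  | zero => exact h.init_mem
  | succ k ih =>
    rw [path_succ_X]
    exact sub_smul_landingDir_mem h.eps_pos h.eps_lt h.lam_pos h.bound_pos ih
      (norm_clip_le h.bound_pos.le _) h.gamma_pos.le h.gamma_le

lemma norm_gradient_localObj_le (h : 𝓗) (i : Fin N) {X : Mat n p} (hX : X ∈ safeRegion n p ε) :
    ‖gradient (localObj F D i) X‖ ≤ L' := by
  have := h.prob_data
  obtain ⟨hint, hzero, -, -⟩ := h.unbiased i X hX
  rw [integral_sub hint (integrable_const _), integral_const, probReal_univ, one_smul,
    sub_eq_zero] at hzero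
  rw [← hzero]
  simpa using norm_integral_le_of_norm_le_const (h.gradBound i X hX)

lemma gradient_globalObj (h : 𝓗) (X : Mat n p) : gradient (globalObj F D) X
    = (1 / (N : ℝ)) • ∑ i, gradient (localObj F D i) X := by
  refine HasGradientAt.gradient ?_
  have h1 : ∀ i, HasFDerivAt (localObj F D i) (fderiv ℝ (localObj F D i) X) X := fun i =>
    ((h.smooth i).2.1 X).hasFDerivAt
  have h2 := (HasFDerivAt.fun_sum fun i (_ : i ∈ Finset.univ) => h1 i).const_mul (1 / (N : ℝ))
  rw [hasGradientAt_iff_hasFDerivAt]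
  refine h2.congr_fderiv ?_
  simp [gradient]

lemma differentiable_globalObj (h : 𝓗) : Differentiable ℝ (globalObj F D) := by
  unfold globalObj
  exact (Differentiable.fun_sum fun i _ => (h.smooth i).2.1).const_mul _

lemma norm_gradient_globalObj_le (h : 𝓗) {X : Mat n p} (hX : X ∈ safeRegion n p ε) :
    ‖gradient (globalObj F D) X‖ ≤ L' := by
  have hN : (0 : ℝ) < N := by exact_mod_cast h.nodes_pos
  rw [h.gradient_globalObj, norm_smul, Real.norm_eq_abs, abs_of_pos (by positivity)]
  calc 1 / (N : ℝ) * ‖∑ i, gradient (localObj F D i) X‖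
      ≤ 1 / (N : ℝ) * ∑ _i : Fin N, L' := by
        gcongr
        exact (norm_sum_le _ _).trans
          (Finset.sum_le_sum fun i _ => h.norm_gradient_localObj_le i hX)
    _ = L' := by
        simp
        field_simp

lemma measurable_X (h : 𝓗) (k : ℕ) : Measurable fun ω => (𝒮 k ω).X :=
  (measurable_X_of_past h.wellPosed.measurable h.compressor.measurable le_rfl).mono
    (h.sampling.sourceSup_le _) le_rfl

lemma measurable_gradNoise (h : 𝓗) (i : Fin N) : Measurable (gradNoise F D i) :=
  h.wellPosed.measurable.sub ((measurable_gradient _).comp measurable_fst)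

/-- The noise at the iterate of round `k` has second moment at most `σ ^ 2`, since the sample of
round `k` is independent of that iterate. -/
lemma gradNoise_sq (h : 𝓗) (k : ℕ) (i : Fin N) :
    MemLp (fun ω => gradNoise F D i ((𝒮 k ω).X, ξ i k ω)) 2 P ∧
      ∫ ω, ‖gradNoise F D i ((𝒮 k ω).X, ξ i k ω)‖ ^ 2 ∂P ≤ σ ^ 2 := by
  have := h.prob_space
  have := h.prob_data
  have hm := h.measurable_gradNoise i
  have hX := h.measurable_X k
  have hξ := h.sampling.measurable_sample i k
  have hind : IndepFun (fun ω => (𝒮 k ω).X) (ξ i k) P :=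
    h.sampling.indepFun_sample (T := past N k) (fun hk => lt_irrefl k hk)
      (measurable_X_of_past h.wellPosed.measurable h.compressor.measurable le_rfl)
  obtain ⟨h1, h2⟩ := integral_le_of_indepFun (b := fun _ => σ ^ 2) hX hξ
    (h.sampling.law_sample i k) hind (h := fun z => ‖gradNoise F D i z‖ ^ 2) (hm.norm.pow_const 2)
    (fun z => sq_nonneg _) (integrable_const _)
    (fun ω => (h.unbiased i _ (h.X_mem k ω)).2.2.1)
    (fun ω => (h.unbiased i _ (h.X_mem k ω)).2.2.2)
  refine ⟨(memLp_two_iff_integrable_sq_norm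
    (hm.comp (hX.prodMk hξ)).aestronglyMeasurable).mpr h1, ?_⟩
  simpa using h2

/-- The noise of node `i` in round `k` is orthogonal to every square integrable vector that does
not depend on the sample of node `i` in round `k`. -/
lemma integral_inner_gradNoise (h : 𝓗) {k : ℕ} {i : Fin N} {T : Set ((Fin N × ℕ) ⊕ ℕ)}
    (hT : past N k ⊆ T) (hi : Sum.inl (i, k) ∉ T) {A : Ω → Mat n p}
    (hA : Measurable[sourceSup ξ ζ T] A) (hA2 : MemLp A 2 P) :
    ∫ ω, inner ℝ (A ω) (gradNoise F D i ((𝒮 k ω).X, ξ i k ω)) ∂P = 0 := by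
  have := h.prob_space
  have := h.prob_data
  have hX := measurable_X_of_past (lam := lam) (η := η) (γ := γ) (L' := L') (X₀ := X₀) (ξ := ξ)
    (ζ := ζ) h.wellPosed.measurable h.compressor.measurable hT
  have hY := hA.prodMk hX
  refine integral_inner_eq_zero_of_indepFun (Y := fun ω => (A ω, (𝒮 k ω).X))
    (A := Prod.fst) (R := fun z => gradNoise F D i (z.1.2, z.2))
    (hY.mono (h.sampling.sourceSup_le T) le_rfl) (h.sampling.measurable_sample i k)
    (h.sampling.law_sample i k) (h.sampling.indepFun_sample hi hY)
    measurable_fst.stronglyMeasurable ?_ hA2 (h.gradNoise_sq k i).1 ?_ ?_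
  · exact ((h.measurable_gradNoise i).comp
      ((measurable_snd.comp measurable_fst).prodMk measurable_snd)).stronglyMeasurable
  · intro ω
    exact (h.unbiased i _ (h.X_mem k ω)).1.sub
      (integrable_const (gradient (localObj F D i) (𝒮 k ω).X))
  · intro ω
    exact (h.unbiased i _ (h.X_mem k ω)).2.1

lemma measurable_gradient_localObj (h : 𝓗) {k : ℕ} {T : Set ((Fin N × ℕ) ⊕ ℕ)} (hT : past N k ⊆ T)
    (i : Fin N) :
    Measurable[sourceSup ξ ζ T] fun ω => gradient (localObj F D i) (𝒮 k ω).X :=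
  (measurable_gradient _).comp
    (measurable_X_of_past h.wellPosed.measurable h.compressor.measurable hT)

lemma memLp_gradient_localObj (h : 𝓗) (k : ℕ) (i : Fin N) :
    MemLp (fun ω => gradient (localObj F D i) (𝒮 k ω).X) 2 P := by
  have := h.prob_space
  exact MemLp.of_bound ((measurable_gradient _).comp (h.measurable_X k)).aestronglyMeasurable L'
    (Filter.Eventually.of_forall fun ω => h.norm_gradient_localObj_le i (h.X_mem k ω))

lemma memLp_gradient_globalObj (h : 𝓗) (k : ℕ) :
    MemLp (fun ω => gradient (globalObj F D) (𝒮 k ω).X) 2 P := by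
  have := h.prob_space
  exact MemLp.of_bound ((measurable_gradient _).comp (h.measurable_X k)).aestronglyMeasurable L'
    (Filter.Eventually.of_forall fun ω => h.norm_gradient_globalObj_le (h.X_mem k ω))

lemma memLp_v (h : 𝓗) (k : ℕ) (i : Fin N) : MemLp (fun ω => (𝒮 k ω).v i) 2 P := by
  induction k with
  | zero =>
    refine ((h.gradNoise_sq 0 i).1.add (h.memLp_gradient_localObj 0 i)).congr_norm ?_ ?_
    · exact (measurable_v_of_past h.wellPosed.measurable h.compressor.measurable le_rfl i).mono
        (h.sampling.sourceSup_le _) le_rfl |>.aestronglyMeasurable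
    · refine Filter.Eventually.of_forall fun ω => ?_
      simp [gradNoise, path_zero_v, path_zero_X]
  | succ k ih =>
    simp only [path_succ_v_eq D]
    exact ((ih.const_smul (1 - η)).add ((h.memLp_gradient_localObj (k + 1) i).const_smul η)).add
      ((h.gradNoise_sq (k + 1) i).1.const_smul η)

/-- The mean square error of the compressor on a random input that does not depend on the seeds of
round `k`. -/
lemma compressor_sq (h : 𝓗) {k : ℕ} (i : Fin N) {T : Set ((Fin N × ℕ) ⊕ ℕ)}
    (hk : Sum.inr k ∉ T) {U : Ω → Mat n p} (hU : Measurable[sourceSup ξ ζ T] U)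
    (hU2 : MemLp U 2 P) :
    MemLp (fun ω => C (U ω) (ζ k ω i) - U ω) 2 P ∧
      ∫ ω, ‖C (U ω) (ζ k ω i) - U ω‖ ^ 2 ∂P ≤ (1 - α) * ∫ ω, ‖U ω‖ ^ 2 ∂P := by
  have := h.prob_space
  have := h.prob_seed
  have hUm : Measurable U := hU.mono (h.sampling.sourceSup_le T) le_rfl
  have hζ : Measurable fun ω => ζ k ω i :=
    (measurable_pi_apply i).comp (h.sampling.measurable_seed k)
  have hm : Measurable fun z : Mat n p × S => C z.1 z.2 - z.1 :=
    h.compressor.measurable.sub measurable_fst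
  obtain ⟨h1, h2⟩ := integral_le_of_indepFun (b := fun ω => (1 - α) * ‖U ω‖ ^ 2) hUm hζ
    (h.sampling.law_seed k i) (h.sampling.indepFun_seed hk i hU)
    (h := fun z => ‖C z.1 z.2 - z.1‖ ^ 2) (hm.norm.pow_const 2)
    (fun z => sq_nonneg _) ((integrable_norm_sq hU2).const_mul _)
    (fun ω => h.compressor.integrable _) (fun ω => h.compressor.contract _)
  refine ⟨(memLp_two_iff_integrable_sq_norm
    (hm.comp (hUm.prodMk hζ)).aestronglyMeasurable).mpr h1, ?_⟩
  rwa [integral_const_mul] at h2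

lemma inr_notMem_pastAndSamples (k : ℕ) : (Sum.inr k : (Fin N × ℕ) ⊕ ℕ) ∉ pastAndSamples N k :=
  fun hk => lt_irrefl k hk

lemma inl_notMem_past (k : ℕ) (i : Fin N) : (Sum.inl (i, k) : (Fin N × ℕ) ⊕ ℕ) ∉ past N k :=
  fun hk => lt_irrefl k hk

lemma measurable_v_sub_g (h : 𝓗) (k : ℕ) (i : Fin N) :
    Measurable[sourceSup ξ ζ (pastAndSamples N (k + 1))]
      fun ω => (𝒮 (k + 1) ω).v i - (𝒮 k ω).g i :=
  (measurable_v_of_past h.wellPosed.measurable h.compressor.measurable le_rfl i).sub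
    (measurable_g_of_past h.wellPosed.measurable h.compressor.measurable (past_subset N (k + 1)) i)

lemma memLp_g (h : 𝓗) (k : ℕ) (i : Fin N) : MemLp (fun ω => (𝒮 k ω).g i) 2 P := by
  induction k with
  | zero =>
    have h1 := (h.compressor_sq i (inr_notMem_pastAndSamples 0)
      (measurable_v_of_past h.wellPosed.measurable h.compressor.measurable le_rfl i)
      (h.memLp_v 0 i)).1.add (h.memLp_v 0 i)
    refine h1.ae_eq (Filter.Eventually.of_forall fun ω => ?_)
    simp [path_zero_g]
  | succ k ih =>
    have hU := (h.memLp_v (k + 1) i).sub ih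
    have h1 := ((h.compressor_sq i (inr_notMem_pastAndSamples (k + 1))
      (h.measurable_v_sub_g k i) hU).1.add hU).add ih
    refine h1.ae_eq (Filter.Eventually.of_forall fun ω => ?_)
    simp [path_succ_g, add_comm]

lemma compressionError_zero_le (h : 𝓗) (i : Fin N) :
    compressionError P (𝒮 0) i ≤ (1 - α) * ∫ ω, ‖(𝒮 0 ω).v i‖ ^ 2 ∂P :=
  (h.compressor_sq i (inr_notMem_pastAndSamples 0)
    (measurable_v_of_past h.wellPosed.measurable h.compressor.measurable le_rfl i)
    (h.memLp_v 0 i)).2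

lemma compressionError_succ_le (h : 𝓗) (k : ℕ) (i : Fin N) : compressionError P (𝒮 (k + 1)) i
    ≤ (1 - α) * ∫ ω, ‖(𝒮 (k + 1) ω).v i - (𝒮 k ω).g i‖ ^ 2 ∂P := by
  have h1 := (h.compressor_sq i (inr_notMem_pastAndSamples (k + 1))
      (h.measurable_v_sub_g k i) ((h.memLp_v (k + 1) i).sub (h.memLp_g k i))).2
  refine le_trans (le_of_eq ?_) h1
  refine integral_congr_ae (Filter.Eventually.of_forall fun ω => ?_)
  simp only [path_succ_g]
  congr 2
  abel

lemma integrable_step (h : 𝓗) (k : ℕ) :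
    Integrable (fun ω => ‖(𝒮 (k + 1) ω).X - (𝒮 k ω).X‖ ^ 2) P := by
  have := h.prob_space
  have hb : ∀ X ∈ safeRegion n p ε, ‖X‖ ≤ 4 / 3 * ‖ofM (1 : Matrix (Fin p) (Fin p) ℝ)‖ := by
    intro X hX
    simpa using norm_toM_mul_le hX h.eps_lt (1 : Matrix (Fin p) (Fin p) ℝ)
  refine integrable_norm_sq (MemLp.of_bound
    ((h.measurable_X (k + 1)).sub (h.measurable_X k)).aestronglyMeasurable
    (4 / 3 * ‖ofM (1 : Matrix (Fin p) (Fin p) ℝ)‖ + 4 / 3 * ‖ofM (1 : Matrix (Fin p) (Fin p) ℝ)‖)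
    (Filter.Eventually.of_forall fun ω => ?_))
  exact (norm_sub_le _ _).trans (add_le_add (hb _ (h.X_mem _ ω)) (hb _ (h.X_mem _ ω)))

lemma theta_pos (h : 𝓗) : 0 < thetaC α := by
  have := Real.sqrt_lt_sqrt (x := 1 - α) (y := 1)
    (by linarith [h.compressor.factor_le_one]) (by linarith [h.compressor.factor_pos])
  rw [Real.sqrt_one] at this
  unfold thetaC
  linarith

lemma theta_le_one : thetaC α ≤ 1 := by
  unfold thetaC
  linarith [Real.sqrt_nonneg (1 - α)]

lemma one_sub_theta_sq (h : 𝓗) : (1 - thetaC α) ^ 2 = 1 - α := by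
  unfold thetaC
  rw [sub_sub_cancel, Real.sq_sqrt (by linarith [h.compressor.factor_le_one])]

lemma beta_eq (h : 𝓗) : (1 - thetaC α) ^ 2 / thetaC α = betaC α := by
  rw [h.one_sub_theta_sq]
  rfl

/-- Decay of the compression error of one node. -/
lemma compressionError_recursion (h : 𝓗) (k : ℕ) (i : Fin N) :
    compressionError P (𝒮 (k + 1)) i ≤ (1 - thetaC α) * compressionError P (𝒮 k) i
      + betaC α * η ^ 2 * (2 * momentumError F D P (𝒮 k) i
        + 2 * Li i ^ 2 * ∫ ω, ‖(𝒮 (k + 1) ω).X - (𝒮 k ω).X‖ ^ 2 ∂P)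
      + (1 - α) * η ^ 2 * σ ^ 2 := by
  set G : Ω → Mat n p := fun ω => gradient (localObj F D i) (𝒮 k ω).X with hG
  set G' : Ω → Mat n p := fun ω => gradient (localObj F D i) (𝒮 (k + 1) ω).X with hG'
  have hGm : MemLp G 2 P := h.memLp_gradient_localObj k i
  have hGm' : MemLp G' 2 P := h.memLp_gradient_localObj (k + 1) i
  have hv := h.memLp_v k i
  have hg := h.memLp_g k i
  set B : Ω → Mat n p := fun ω => ((𝒮 k ω).v i - (𝒮 k ω).g i) + η • (G' ω - (𝒮 k ω).v i) with hB
  have hBm : MemLp B 2 P := (hv.sub hg).add ((hGm'.sub hv).const_smul η)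
  have hvB : ∀ ω, (𝒮 (k + 1) ω).v i - (𝒮 k ω).g i
      = B ω + η • gradNoise F D i ((𝒮 (k + 1) ω).X, ξ i (k + 1) ω) := by
    intro ω
    rw [path_succ_v_eq D]
    simp only [hB, hG']
    module
  have hBmeas : Measurable[sourceSup ξ ζ (past N (k + 1))] B := by
    have h1 := measurable_v_of_past (lam := lam) (η := η) (γ := γ) (L' := L') (X₀ := X₀) (ξ := ξ)
      (ζ := ζ) h.wellPosed.measurable h.compressor.measurable (pastAndSamples_subset N k) i
    have h2 := measurable_g_of_past (lam := lam) (η := η) (γ := γ) (L' := L') (X₀ := X₀) (ξ := ξ)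
      (ζ := ζ) h.wellPosed.measurable h.compressor.measurable (le_refl (past N (k + 1))) i
    have h3 := h.measurable_gradient_localObj (le_refl (past N (k + 1))) i
    exact (h1.sub h2).add ((h3.sub h1).const_smul η)
  have h1 := integral_norm_add_sq_le (c := η) hBm (h.gradNoise_sq (k + 1) i).1
    (h.integral_inner_gradNoise le_rfl (inl_notMem_past (k + 1) i) hBmeas hBm)
    (h.gradNoise_sq (k + 1) i).2
  simp only [← hvB] at h1
  have h2 : (1 - α) * ∫ ω, ‖B ω‖ ^ 2 ∂P ≤ (1 - thetaC α) * compressionError P (𝒮 k) i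
      + betaC α * η ^ 2 * (2 * momentumError F D P (𝒮 k) i
        + 2 * Li i ^ 2 * ∫ ω, ‖(𝒮 (k + 1) ω).X - (𝒮 k ω).X‖ ^ 2 ∂P) := by
    have hI1 := integrable_norm_sq (hg.sub hv)
    have hI2 := integrable_norm_sq (hv.sub hGm)
    have hI3 := h.integrable_step k
    unfold compressionError momentumError
    rw [← integral_const_mul, ← integral_const_mul, ← integral_const_mul, ← integral_const_mul,
      ← integral_add (by exact hI2.const_mul _) (hI3.const_mul _), ← integral_const_mul,
      ← integral_add (by exact hI1.const_mul _)
        (by exact ((hI2.const_mul _).add (hI3.const_mul _)).const_mul _)]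
    refine integral_mono ((integrable_norm_sq hBm).const_mul _) (by
      exact (hI1.const_mul _).add (((hI2.const_mul _).add (hI3.const_mul _)).const_mul _))
      fun ω => ?_
    have hy := contraction_young h.theta_pos theta_le_one ((𝒮 k ω).v i - (𝒮 k ω).g i)
      (η • (G' ω - (𝒮 k ω).v i))
    rw [h.beta_eq, h.one_sub_theta_sq, norm_smul, mul_pow, Real.norm_eq_abs, sq_abs,
      norm_sub_rev ((𝒮 k ω).v i) ((𝒮 k ω).g i)] at hy
    have hβ : 0 ≤ betaC α := by
      rw [← h.beta_eq]
      exact div_nonneg (sq_nonneg _) h.theta_pos.le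
    have hlip : ‖G' ω - G ω‖ ≤ Li i * ‖(𝒮 (k + 1) ω).X - (𝒮 k ω).X‖ :=
      (h.smooth i).2.2 _ (h.X_mem _ ω) _ (h.X_mem _ ω)
    have hsq : ‖G' ω - (𝒮 k ω).v i‖ ^ 2 ≤ 2 * ‖(𝒮 k ω).v i - G ω‖ ^ 2
        + 2 * Li i ^ 2 * ‖(𝒮 (k + 1) ω).X - (𝒮 k ω).X‖ ^ 2 := by
      have h3 : ‖G' ω - (𝒮 k ω).v i‖ ≤ ‖G' ω - G ω‖ + ‖(𝒮 k ω).v i - G ω‖ := by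
        rw [norm_sub_rev ((𝒮 k ω).v i)]
        exact norm_sub_le_norm_sub_add_norm_sub _ _ _
      have h4 : ‖G' ω - (𝒮 k ω).v i‖ ^ 2
          ≤ (Li i * ‖(𝒮 (k + 1) ω).X - (𝒮 k ω).X‖ + ‖(𝒮 k ω).v i - G ω‖) ^ 2 := by
        gcongr
        linarith
      linarith [sq_nonneg (Li i * ‖(𝒮 (k + 1) ω).X - (𝒮 k ω).X‖ - ‖(𝒮 k ω).v i - G ω‖)]
    have h5 := mul_le_mul_of_nonneg_left hsq (mul_nonneg hβ (sq_nonneg η))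
    simp only [hB]
    linarith
  have h3 := h.compressionError_succ_le k i
  have h4 := mul_le_mul_of_nonneg_left h1 (by linarith [h.compressor.factor_le_one] : 0 ≤ 1 - α)
  linarith

/-- Decay of the momentum error of one node. -/
lemma momentumError_recursion (h : 𝓗) (k : ℕ) (i : Fin N) :
    momentumError F D P (𝒮 (k + 1)) i ≤ (1 - η) * momentumError F D P (𝒮 k) i
      + (1 - η) ^ 2 / η * (Li i ^ 2 * ∫ ω, ‖(𝒮 (k + 1) ω).X - (𝒮 k ω).X‖ ^ 2 ∂P)
      + η ^ 2 * σ ^ 2 := by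
  set G : Ω → Mat n p := fun ω => gradient (localObj F D i) (𝒮 k ω).X with hG
  set G' : Ω → Mat n p := fun ω => gradient (localObj F D i) (𝒮 (k + 1) ω).X with hG'
  have hGm : MemLp G 2 P := h.memLp_gradient_localObj k i
  have hGm' : MemLp G' 2 P := h.memLp_gradient_localObj (k + 1) i
  have hv := h.memLp_v k i
  set B : Ω → Mat n p := fun ω => (1 - η) • ((𝒮 k ω).v i - G' ω) with hB
  have hBm : MemLp B 2 P := (hv.sub hGm').const_smul (1 - η)
  have hvB : ∀ ω, (𝒮 (k + 1) ω).v i - G' ω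
      = B ω + η • gradNoise F D i ((𝒮 (k + 1) ω).X, ξ i (k + 1) ω) := by
    intro ω
    rw [path_succ_v_eq D]
    simp only [hB, hG']
    module
  have hBmeas : Measurable[sourceSup ξ ζ (past N (k + 1))] B := by
    have h1 := measurable_v_of_past (lam := lam) (η := η) (γ := γ) (L' := L') (X₀ := X₀) (ξ := ξ)
      (ζ := ζ) h.wellPosed.measurable h.compressor.measurable (pastAndSamples_subset N k) i
    have h3 := h.measurable_gradient_localObj (le_refl (past N (k + 1))) i
    exact (h1.sub h3).const_smul (1 - η)
  have h1 := integral_norm_add_sq_le (c := η) hBm (h.gradNoise_sq (k + 1) i).1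
    (h.integral_inner_gradNoise le_rfl (inl_notMem_past (k + 1) i) hBmeas hBm)
    (h.gradNoise_sq (k + 1) i).2
  simp only [← hvB] at h1
  refine h1.trans (add_le_add ?_ le_rfl)
  have hI2 := integrable_norm_sq (hv.sub hGm)
  have hI3 := h.integrable_step k
  unfold momentumError
  rw [← integral_const_mul, ← integral_const_mul, ← integral_const_mul,
    ← integral_add (by exact hI2.const_mul _) (by exact (hI3.const_mul _).const_mul _)]
  refine integral_mono (integrable_norm_sq hBm) (by
    exact (hI2.const_mul _).add ((hI3.const_mul _).const_mul _)) fun ω => ?_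
  have hy := contraction_young h.eta_pos h.eta_le ((𝒮 k ω).v i - G ω) (G ω - G' ω)
  rw [sub_add_sub_cancel] at hy
  have hlip : ‖G ω - G' ω‖ ≤ Li i * ‖(𝒮 (k + 1) ω).X - (𝒮 k ω).X‖ := by
    rw [norm_sub_rev]
    exact (h.smooth i).2.2 _ (h.X_mem _ ω) _ (h.X_mem _ ω)
  have hlip2 : ‖G ω - G' ω‖ ^ 2 ≤ Li i ^ 2 * ‖(𝒮 (k + 1) ω).X - (𝒮 k ω).X‖ ^ 2 := by
    rw [← mul_pow]
    gcongr
  have hc : 0 ≤ (1 - η) ^ 2 / η := div_nonneg (sq_nonneg _) h.eta_pos.le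
  have h5 := mul_le_mul_of_nonneg_left hlip2 hc
  simp only [hB, norm_smul, mul_pow, Real.norm_eq_abs, sq_abs]
  linarith

lemma memLp_avg {u : Fin N → Ω → Mat n p} (hu : ∀ i, MemLp (u i) 2 P) :
    MemLp (fun ω => (1 / (N : ℝ)) • ∑ i, u i ω) 2 P :=
  (memLp_finsetSum _ fun i _ => hu i).const_smul (1 / (N : ℝ))

/-- Decay of the error of the averaged momentum. As the samples of different nodes are
independent, the noise is reduced by the factor `N`. -/
lemma meanMomentumError_recursion (h : 𝓗) (k : ℕ) :
    meanMomentumError F D P (𝒮 (k + 1)) ≤ (1 - η) * meanMomentumError F D P (𝒮 k)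
      + (1 - η) ^ 2 / η * (L ^ 2 * ∫ ω, ‖(𝒮 (k + 1) ω).X - (𝒮 k ω).X‖ ^ 2 ∂P)
      + η ^ 2 * (σ ^ 2 / N) := by
  set G : Ω → Mat n p := fun ω => gradient (globalObj F D) (𝒮 k ω).X with hG
  set G' : Ω → Mat n p := fun ω => gradient (globalObj F D) (𝒮 (k + 1) ω).X with hG'
  set R : Fin N → Ω → Mat n p := fun i ω => gradNoise F D i ((𝒮 (k + 1) ω).X, ξ i (k + 1) ω)
    with hR
  set V : Ω → Mat n p := fun ω => (1 / (N : ℝ)) • ∑ i, (𝒮 k ω).v i with hV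
  have hGm : MemLp G 2 P := h.memLp_gradient_globalObj k
  have hGm' : MemLp G' 2 P := h.memLp_gradient_globalObj (k + 1)
  have hRm : ∀ i, MemLp (R i) 2 P := fun i => (h.gradNoise_sq (k + 1) i).1
  have hVm : MemLp V 2 P := memLp_avg fun i => h.memLp_v k i
  set B : Ω → Mat n p := fun ω => (1 - η) • (V ω - G' ω) with hB
  have hBm : MemLp B 2 P := (hVm.sub hGm').const_smul (1 - η)
  have hvB : ∀ ω, (1 / (N : ℝ)) • (∑ i, (𝒮 (k + 1) ω).v i) - G' ω
      = B ω + η • ((1 / (N : ℝ)) • ∑ i, R i ω) := by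
    intro ω
    simp only [path_succ_v_eq D, hB, hG', hV, hR, h.gradient_globalObj, Finset.sum_add_distrib,
      ← Finset.smul_sum]
    module
  have hBmeas : Measurable[sourceSup ξ ζ (past N (k + 1))] B := by
    have h1 := fun i => measurable_v_of_past (lam := lam) (η := η) (γ := γ) (L' := L') (X₀ := X₀)
      (ξ := ξ) (ζ := ζ) h.wellPosed.measurable h.compressor.measurable
      (pastAndSamples_subset N k) i
    have h2 : Measurable[sourceSup ξ ζ (past N (k + 1))] fun ω => ∑ i, (𝒮 k ω).v i :=
      Finset.measurable_fun_sum _ fun i _ => h1 i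
    have h3 : Measurable[sourceSup ξ ζ (past N (k + 1))] G' := (measurable_gradient _).comp
      (measurable_X_of_past h.wellPosed.measurable h.compressor.measurable le_rfl)
    exact ((h2.const_smul (1 / (N : ℝ))).sub h3).const_smul (1 - η)
  have horthR : ∀ i j, i ≠ j → ∫ ω, inner ℝ (R i ω) (R j ω) ∂P = 0 := by
    intro i j hij
    have hsub : past N (k + 1) ⊆ insert (Sum.inl (i, k + 1)) (past N (k + 1)) :=
      Set.subset_insert _ _
    refine h.integral_inner_gradNoise (T := insert (Sum.inl (i, k + 1)) (past N (k + 1)))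
      hsub ?_ ?_ (hRm i)
    · rintro (hj | hj)
      · simp only [Sum.inl.injEq, Prod.mk.injEq, and_true] at hj
        exact hij hj.symm
      · exact inl_notMem_past (k + 1) j hj
    · exact (h.measurable_gradNoise i).comp
        ((measurable_X_of_past h.wellPosed.measurable h.compressor.measurable hsub).prodMk
          (measurable_sample_sourceSup (Set.mem_insert _ _)))
  have horthB : ∫ ω, inner ℝ (B ω) ((1 / (N : ℝ)) • ∑ i, R i ω) ∂P = 0 := by
    simp only [real_inner_smul_right, inner_sum]
    rw [integral_const_mul, integral_finsetSum _ fun i _ => integrable_inner_of_memLp hBm (hRm i),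
      Finset.sum_eq_zero fun i _ => h.integral_inner_gradNoise le_rfl
        (inl_notMem_past (k + 1) i) hBmeas hBm, mul_zero]
  have h1 := integral_norm_add_sq_le (c := η) hBm (memLp_avg hRm) horthB
    (integral_norm_avg_sq_le h.nodes_pos hRm horthR fun i => (h.gradNoise_sq (k + 1) i).2)
  simp only [← hvB] at h1
  refine h1.trans (add_le_add ?_ le_rfl)
  have hI2 := integrable_norm_sq (hVm.sub hGm)
  have hI3 := h.integrable_step k
  unfold meanMomentumError
  rw [← integral_const_mul, ← integral_const_mul, ← integral_const_mul,
    ← integral_add (by exact hI2.const_mul _) (by exact (hI3.const_mul _).const_mul _)]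
  refine integral_mono (integrable_norm_sq hBm) (by
    exact (hI2.const_mul _).add ((hI3.const_mul _).const_mul _)) fun ω => ?_
  have hy := contraction_young h.eta_pos h.eta_le (V ω - G ω) (G ω - G' ω)
  rw [sub_add_sub_cancel] at hy
  have hlip : ‖G ω - G' ω‖ ≤ L * ‖(𝒮 (k + 1) ω).X - (𝒮 k ω).X‖ := by
    rw [norm_sub_rev]
    exact h.lipschitz _ (h.X_mem _ ω) _ (h.X_mem _ ω)
  have hlip2 : ‖G ω - G' ω‖ ^ 2 ≤ L ^ 2 * ‖(𝒮 (k + 1) ω).X - (𝒮 k ω).X‖ ^ 2 := by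
    rw [← mul_pow]
    gcongr
  have hc : 0 ≤ (1 - η) ^ 2 / η := div_nonneg (sq_nonneg _) h.eta_pos.le
  have h5 := mul_le_mul_of_nonneg_left hlip2 hc
  simp only [hB, norm_smul, mul_pow, Real.norm_eq_abs, sq_abs]
  linarith

end RunAssumptions

end Recursion

/-! ### The Lyapunov inequality -/

section StepSize

/-- The smallness condition on the step size: the bound is a convex function of
`(γ √a, γ Lm)` on the triangle with vertices `(0, 0)`, `(1/2, 0)`, `(0, 1/2)`. -/
lemma step_coefficient_le {a Lm γ : ℝ} (hLm : 0 < Lm) (ha : 0 ≤ a) (hγ : 0 < γ)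
    (h : γ ≤ (2 * √a + 2 * Lm)⁻¹) : Lm / 2 * γ + a * γ ^ 2 ≤ 1 / 4 := by
  have hs := Real.sqrt_nonneg a
  rw [← one_div, le_div_iff₀ (by positivity)] at h
  have hu : 0 ≤ γ * √a := by positivity
  have hv : 0 ≤ γ * Lm := by positivity
  have hsq : a * γ ^ 2 = (γ * √a) * (γ * √a) := by
    rw [mul_mul_mul_comm, Real.mul_self_sqrt ha]
    ring
  have h1 : γ * √a ≤ 1 / 2 := by linarith
  have h2 : (γ * √a) * (γ * √a) ≤ 1 / 2 * (γ * √a) := by gcongr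
  linarith

lemma stepA_nonneg {α η L Lt c₁ c₂ : ℝ} (hα : α ≤ 1) (hη : 0 < η) (hη' : η ≤ 1) (hc₁ : 0 ≤ c₁)
    (hc₂ : 0 ≤ c₂) (hθ : 0 < thetaC α) : 0 ≤ stepA α η L Lt c₁ c₂ := by
  have hβ : 0 ≤ betaC α := div_nonneg (by linarith) hθ.le
  have h1 : 0 ≤ 1 - η + η ^ 3 := by
    have : 0 ≤ η ^ 3 := by positivity
    linarith
  unfold stepA
  positivity

/-- The weighted sum of the three errors decreases in one round by the bound for the gradient
error, up to the displacement and the noise. The weight of the momentum errors is chosen such that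
their contribution to the compression errors cancels. -/
lemma weighted_errors_le {α η γ L Lt σ c₁ c₂ N d Gt Gt' Pt Pt' Pm Pm' : ℝ} (hα : α ≤ 1)
    (hη : 0 < η) (hγ : 0 < γ) (hc₁ : 0 ≤ c₁) (hc₂ : 0 ≤ c₂) (hθ : 0 < thetaC α)
    (hd : 0 ≤ d)
    (hG : Gt' ≤ (1 - thetaC α) * Gt + betaC α * η ^ 2 * (2 * Pt + 2 * Lt ^ 2 * d)
      + (1 - α) * η ^ 2 * σ ^ 2)
    (hP : Pt' ≤ (1 - η) * Pt + (1 - η) ^ 2 / η * (Lt ^ 2 * d) + η ^ 2 * σ ^ 2)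
    (hPm : Pm' ≤ (1 - η) * Pm + (1 - η) ^ 2 / η * (L ^ 2 * d) + η ^ 2 * (σ ^ 2 / N)) :
    c₁ * γ / thetaC α * Gt' + 2 * c₁ * γ * η * betaC α / thetaC α * Pt' + c₂ * γ / η * Pm'
        + γ * (c₁ * Gt + c₂ * Pm)
      ≤ c₁ * γ / thetaC α * Gt + 2 * c₁ * γ * η * betaC α / thetaC α * Pt + c₂ * γ / η * Pm
        + γ * stepA α η L Lt c₁ c₂ * d
        + γ * (c₁ * η ^ 2 * (1 - α) * σ ^ 2 / thetaC α
          + 2 * c₁ * η ^ 3 * betaC α * σ ^ 2 / thetaC α + c₂ * η * σ ^ 2 / N) := by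
  have hβ : 0 ≤ betaC α := div_nonneg (by linarith) hθ.le
  set θ := thetaC α
  set β := betaC α
  have e1 := mul_le_mul_of_nonneg_left hG (by positivity : 0 ≤ c₁ * γ / θ)
  have e2 := mul_le_mul_of_nonneg_left hP (by positivity : 0 ≤ 2 * c₁ * γ * η * β / θ)
  have e3 := mul_le_mul_of_nonneg_left hPm (by positivity : 0 ≤ c₂ * γ / η)
  have i1 : c₁ * γ / θ * ((1 - θ) * Gt + β * η ^ 2 * (2 * Pt + 2 * Lt ^ 2 * d)
      + (1 - α) * η ^ 2 * σ ^ 2) = c₁ * γ / θ * Gt - γ * c₁ * Gt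
      + 2 * c₁ * γ * η ^ 2 * β / θ * Pt + γ * (2 * c₁ * β * Lt ^ 2 / θ) * η ^ 2 * d
      + γ * (c₁ * η ^ 2 * (1 - α) * σ ^ 2 / θ) := by
    field_simp
    ring
  have i2 : 2 * c₁ * γ * η * β / θ * ((1 - η) * Pt + (1 - η) ^ 2 / η * (Lt ^ 2 * d)
      + η ^ 2 * σ ^ 2) = 2 * c₁ * γ * η * β / θ * Pt - 2 * c₁ * γ * η ^ 2 * β / θ * Pt
      + γ * (2 * c₁ * β * Lt ^ 2 / θ) * (1 - η) ^ 2 * d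
      + γ * (2 * c₁ * η ^ 3 * β * σ ^ 2 / θ) := by
    field_simp
  have i3 : c₂ * γ / η * ((1 - η) * Pm + (1 - η) ^ 2 / η * (L ^ 2 * d) + η ^ 2 * (σ ^ 2 / N))
      = c₂ * γ / η * Pm - γ * c₂ * Pm + γ * (c₂ * L ^ 2 / η ^ 2 * (1 - η) ^ 2) * d
      + γ * (c₂ * η * σ ^ 2 / N) := by
    have : c₂ * γ / η * (η ^ 2 * (σ ^ 2 / N)) = γ * (c₂ * η * σ ^ 2 / N) := by
      field_simp
    rw [mul_add, this]
    congr 1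
    field_simp
  rw [i1] at e1
  rw [i2] at e2
  rw [i3] at e3
  have ha : (2 * c₁ * β * Lt ^ 2 / θ) * η ^ 2 + (2 * c₁ * β * Lt ^ 2 / θ) * (1 - η) ^ 2
      + c₂ * L ^ 2 / η ^ 2 * (1 - η) ^ 2 ≤ stepA α η L Lt c₁ c₂ := by
    have h1 : 0 ≤ (2 * c₁ * β * Lt ^ 2 / θ) * (η * (1 - η) ^ 2) := by positivity
    have h2 : 0 ≤ c₂ * L ^ 2 / η ^ 2 * (1 - η) ^ 2 * η := by positivity
    unfold stepA
    linarith
  have ha' := mul_le_mul_of_nonneg_left (mul_le_mul_of_nonneg_right ha hd) hγ.le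
  linarith

end StepSize

section Lyapunov

variable {n p N : ℕ} {Ξ S Ω : Type*} [MeasurableSpace Ξ] [MeasurableSpace S] [MeasurableSpace Ω]
  {F : Mat n p → Ξ → ℝ} {D : Fin N → Measure Ξ}
  {Li : Fin N → ℝ} {ε L L' σ : ℝ} {C : Mat n p → S → Mat n p} {ρ : Measure S}
  {α : ℝ} {P : Measure Ω}
  {ξ : Fin N → ℕ → Ω → Ξ} {ζ : ℕ → Ω → Fin N → S} {X₀ : Mat n p} {lam η γ : ℝ}

local notation "𝒮" => path F C lam η γ L' X₀ ξ ζ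

local notation "𝓗" => RunAssumptions F D Li ε L L' σ C ρ α P ξ ζ X₀ lam η γ

lemma penalty_nonneg (X : Mat n p) : 0 ≤ penalty X := by
  unfold penalty
  positivity

/-- An almost surely vanishing term does not matter for the mean square. -/
lemma integral_norm_add_sq_le_of_nonpos {V : Type*} [NormedAddCommGroup V] {A B : Ω → V}
    (hB : MemLp B 2 P) (hB0 : ∫ ω, ‖B ω‖ ^ 2 ∂P ≤ 0) :
    ∫ ω, ‖A ω + B ω‖ ^ 2 ∂P ≤ ∫ ω, ‖A ω‖ ^ 2 ∂P := by
  have h0 : ∫ ω, ‖B ω‖ ^ 2 ∂P = 0 := le_antisymm hB0 (integral_nonneg fun ω => sq_nonneg _)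
  rw [integral_eq_zero_iff_of_nonneg (fun ω => sq_nonneg _) (integrable_norm_sq hB)] at h0
  refine le_of_eq (integral_congr_ae ?_)
  filter_upwards [h0] with ω hω
  simp only [Pi.zero_apply, ne_eq, OfNat.ofNat_ne_zero, not_false_eq_true, pow_eq_zero_iff,
    norm_eq_zero] at hω
  rw [hω, add_zero]

namespace RunAssumptions

lemma caseConstants_nonneg {c₁ c₂ : ℝ} (hc : CaseConstants η σ α c₁ c₂) : 0 ≤ c₁ ∧ 0 ≤ c₂ := by
  rcases hc with ⟨-, -, rfl, rfl⟩ | ⟨-, rfl, rfl⟩ | ⟨-, -, rfl, rfl⟩ <;> norm_num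

lemma momentumError_zero_le (h : 𝓗) (i : Fin N) : momentumError F D P (𝒮 0) i ≤ σ ^ 2 :=
  (h.gradNoise_sq 0 i).2

/-- Without momentum and without noise, the momenta are the exact gradients. -/
lemma momentumError_nonpos (h : 𝓗) (hη : η = 1) (hσ : σ ^ 2 = 0) (k : ℕ) (i : Fin N) :
    momentumError F D P (𝒮 k) i ≤ 0 := by
  cases k with
  | zero => exact (h.momentumError_zero_le i).trans hσ.le
  | succ k => simpa [hη, hσ] using h.momentumError_recursion k i

/-- Without compression, the local estimates are the momenta. -/
lemma compressionError_nonpos (h : 𝓗) (hα : α = 1) (k : ℕ) (i : Fin N) :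
    compressionError P (𝒮 k) i ≤ 0 := by
  cases k with
  | zero => simpa [hα] using h.compressionError_zero_le i
  | succ k => simpa [hα] using h.compressionError_succ_le k i

lemma memLp_g_sub_v (h : 𝓗) (k : ℕ) :
    MemLp (fun ω => (1 / (N : ℝ)) • ∑ i, ((𝒮 k ω).g i - (𝒮 k ω).v i)) 2 P :=
  memLp_avg fun i => (h.memLp_g k i).sub (h.memLp_v k i)

lemma memLp_meanMomentum_sub (h : 𝓗) (k : ℕ) : MemLp (fun ω => (1 / (N : ℝ)) •
    (∑ i, (𝒮 k ω).v i) - gradient (globalObj F D) (𝒮 k ω).X) 2 P :=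
  (memLp_avg fun i => h.memLp_v k i).sub (h.memLp_gradient_globalObj k)

lemma integral_norm_avg_le_avg {A : Fin N → Ω → Mat n p} (hN : 0 < N)
    (hA : ∀ i, MemLp (A i) 2 P) : ∫ ω, ‖(1 / (N : ℝ)) • ∑ i, A i ω‖ ^ 2 ∂P
      ≤ 1 / (N : ℝ) * ∑ i, ∫ ω, ‖A i ω‖ ^ 2 ∂P := by
  rw [← integral_finsetSum _ fun i _ => integrable_norm_sq (hA i), ← integral_const_mul]
  exact integral_mono (integrable_norm_sq (memLp_avg hA))
    ((integrable_finsetSum _ fun i _ => integrable_norm_sq (hA i)).const_mul _)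
    fun ω => norm_avg_sq_le hN _

lemma meanMomentumError_le_avg (h : 𝓗) (k : ℕ) : meanMomentumError F D P (𝒮 k)
    ≤ 1 / (N : ℝ) * ∑ i, momentumError F D P (𝒮 k) i := by
  refine le_trans (le_of_eq ?_) (integral_norm_avg_le_avg h.nodes_pos
    fun i => (h.memLp_v k i).sub (h.memLp_gradient_localObj k i))
  refine integral_congr_ae (Filter.Eventually.of_forall fun ω => ?_)
  simp only [h.gradient_globalObj, Finset.sum_sub_distrib, smul_sub]

lemma memLp_gm_sub (h : 𝓗) (k : ℕ) :
    MemLp (fun ω => (𝒮 k ω).gm - gradient (globalObj F D) (𝒮 k ω).X) 2 P := by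
  simp only [path_gm_sub_eq D]
  exact (h.memLp_g_sub_v k).add (h.memLp_meanMomentum_sub k)

/-- The mean square error of the master's estimate. In the two special cases one of the two sources
of error vanishes, which saves the factor `2`. -/
lemma gm_error_le (h : 𝓗) {c₁ c₂ : ℝ} (hc : CaseConstants η σ α c₁ c₂) (k : ℕ) :
    ∫ ω, ‖(𝒮 k ω).gm - gradient (globalObj F D) (𝒮 k ω).X‖ ^ 2 ∂P
      ≤ c₁ * (1 / (N : ℝ) * ∑ i, compressionError P (𝒮 k) i)
        + c₂ * meanMomentumError F D P (𝒮 k) := by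
  have hA := h.memLp_g_sub_v k
  have hB := h.memLp_meanMomentum_sub k
  have hAG : ∫ ω, ‖(1 / (N : ℝ)) • ∑ i, ((𝒮 k ω).g i - (𝒮 k ω).v i)‖ ^ 2 ∂P
      ≤ 1 / (N : ℝ) * ∑ i, compressionError P (𝒮 k) i :=
    integral_norm_avg_le_avg h.nodes_pos fun i => (h.memLp_g k i).sub (h.memLp_v k i)
  have hN : (0 : ℝ) ≤ 1 / (N : ℝ) := by positivity
  simp only [path_gm_sub_eq D]
  rcases hc with ⟨hη, hσ, rfl, rfl⟩ | ⟨hα, rfl, rfl⟩ | ⟨-, -, rfl, rfl⟩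
  · have hP0 : meanMomentumError F D P (𝒮 k) ≤ 0 :=
      (h.meanMomentumError_le_avg k).trans (mul_nonpos_of_nonneg_of_nonpos hN
        (Finset.sum_nonpos fun i _ => h.momentumError_nonpos hη hσ k i))
    have := (integral_norm_add_sq_le_of_nonpos (A := fun ω =>
      (1 / (N : ℝ)) • ∑ i, ((𝒮 k ω).g i - (𝒮 k ω).v i)) hB hP0).trans hAG
    linarith
  · have hG0 := hAG.trans (mul_nonpos_of_nonneg_of_nonpos hN
      (Finset.sum_nonpos fun i _ => h.compressionError_nonpos hα k i))
    have := integral_norm_add_sq_le_of_nonpos (A := fun ω =>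
      (1 / (N : ℝ)) • (∑ i, (𝒮 k ω).v i) - gradient (globalObj F D) (𝒮 k ω).X) hA hG0
    simp only [add_comm] at this ⊢
    unfold meanMomentumError
    linarith
  · have hA2 := integrable_norm_sq hA
    have hB2 := integrable_norm_sq hB
    have hsum : ∫ ω, ‖(1 / (N : ℝ)) • ∑ i, ((𝒮 k ω).g i - (𝒮 k ω).v i)
        + ((1 / (N : ℝ)) • (∑ i, (𝒮 k ω).v i) - gradient (globalObj F D) (𝒮 k ω).X)‖ ^ 2 ∂P
        ≤ 2 * ∫ ω, ‖(1 / (N : ℝ)) • ∑ i, ((𝒮 k ω).g i - (𝒮 k ω).v i)‖ ^ 2 ∂P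
          + 2 * meanMomentumError F D P (𝒮 k) := by
      unfold meanMomentumError
      rw [← integral_const_mul, ← integral_const_mul,
        ← integral_add (hA2.const_mul 2) (hB2.const_mul 2)]
      refine integral_mono (integrable_norm_sq (hA.add hB))
        ((hA2.const_mul 2).add (hB2.const_mul 2)) fun ω => ?_
      have := parallelogram_law_with_norm ℝ
        ((1 / (N : ℝ)) • ∑ i, ((𝒮 k ω).g i - (𝒮 k ω).v i))
        ((1 / (N : ℝ)) • (∑ i, (𝒮 k ω).v i) - gradient (globalObj F D) (𝒮 k ω).X)
      beta_reduce
      nlinarith [mul_self_nonneg ‖(1 / (N : ℝ)) • ∑ i, ((𝒮 k ω).g i - (𝒮 k ω).v i)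
        - ((1 / (N : ℝ)) • (∑ i, (𝒮 k ω).v i) - gradient (globalObj F D) (𝒮 k ω).X)‖]
    linarith

lemma isCompact_safeRegion (hε' : ε < 3 / 4) : IsCompact (safeRegion n p ε) := by
  refine Metric.isCompact_of_isClosed_isBounded ?_ ?_
  · exact isClosed_le (continuous_ofM.comp continuous_defect).norm continuous_const
  · refine isBounded_iff_forall_norm_le.mpr ⟨4 / 3 * ‖ofM (1 : Matrix (Fin p) (Fin p) ℝ)‖, ?_⟩
    intro X hX
    simpa using norm_toM_mul_le hX hε' (1 : Matrix (Fin p) (Fin p) ℝ)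

lemma penalty_le {X : Mat n p} (hX : X ∈ safeRegion n p ε) : penalty X ≤ 1 / 4 * ε ^ 2 := by
  have hd : ‖ofM (defect X)‖ ≤ ε := hX
  unfold penalty
  gcongr

lemma integrable_penalty (h : 𝓗) (k : ℕ) : Integrable (fun ω => penalty (𝒮 k ω).X) P := by
  have := h.prob_space
  refine Integrable.of_bound (continuous_penalty.measurable.comp
    (h.measurable_X k)).aestronglyMeasurable (1 / 4 * ε ^ 2) (Filter.Eventually.of_forall ?_)
  intro ω
  rw [Real.norm_eq_abs, abs_of_nonneg (penalty_nonneg _)]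
  exact penalty_le (h.X_mem k ω)

lemma integrable_rGrad_sq (h : 𝓗) (k : ℕ) :
    Integrable (fun ω => ‖rGrad (𝒮 k ω).X (gradient (globalObj F D) (𝒮 k ω).X)‖ ^ 2) P := by
  have := h.prob_space
  refine integrable_norm_sq (MemLp.of_bound (continuous_rGrad.measurable.comp
    ((h.measurable_X k).prodMk ((measurable_gradient _).comp
      (h.measurable_X k)))).aestronglyMeasurable ((1 + ε) * L') (Filter.Eventually.of_forall ?_))
  intro ω
  have hε := h.eps_pos
  refine (norm_rGrad_le hε.le (h.X_mem k ω) _).trans ?_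
  gcongr
  exact h.norm_gradient_globalObj_le (h.X_mem k ω)

lemma integrable_merit (h : 𝓗) (mu : ℝ) (k : ℕ) :
    Integrable (fun ω => merit (globalObj F D) mu (𝒮 k ω).X) P := by
  have := h.prob_space
  have hf : Integrable (fun ω => globalObj F D (𝒮 k ω).X) P := by
    obtain ⟨B, hB⟩ := (isCompact_safeRegion (n := n) (p := p) h.eps_lt).exists_bound_of_continuousOn
      h.differentiable_globalObj.continuous.continuousOn
    exact Integrable.of_bound (h.differentiable_globalObj.continuous.measurable.comp
      (h.measurable_X k)).aestronglyMeasurable B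
      (Filter.Eventually.of_forall fun ω => hB _ (h.X_mem k ω))
  have hc : Integrable (fun ω => inner ℝ (gradient (globalObj F D) (𝒮 k ω).X)
      (ofM (toM (𝒮 k ω).X * defect (𝒮 k ω).X))) P := by
    refine integrable_inner_of_memLp (h.memLp_gradient_globalObj k) (MemLp.of_bound
      ((continuous_ofM.comp (Continuous.matrix_mul continuous_toM
        continuous_defect)).measurable.comp (h.measurable_X k)).aestronglyMeasurable 1
      (Filter.Eventually.of_forall fun ω => ?_))
    have hd : ‖ofM (defect (𝒮 k ω).X)‖ ≤ ε := h.X_mem k ω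
    refine (norm_toM_mul_le (h.X_mem k ω) h.eps_lt _).trans ?_
    linarith [h.eps_lt]
  simp only [merit_eq]
  exact (hf.sub (hc.const_mul _)).add ((h.integrable_penalty k).const_mul _)

/-- The mean Lyapunov function in terms of the mean errors. -/
lemma integral_lyapunov (h : 𝓗) (mu c₁ c₂ : ℝ) (k : ℕ) :
    ∫ ω, lyapunov F D ε mu α η γ c₁ c₂ (𝒮 k ω) ∂P
      = ∫ ω, merit (globalObj F D) mu (𝒮 k ω).X ∂P - meritInf (globalObj F D) mu ε
        + (c₁ * γ / thetaC α * (1 / (N : ℝ) * ∑ i, compressionError P (𝒮 k) i)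
          + 2 * c₁ * γ * η * betaC α / thetaC α
            * (1 / (N : ℝ) * ∑ i, momentumError F D P (𝒮 k) i)
          + c₂ * γ / η * meanMomentumError F D P (𝒮 k)) := by
  have := h.prob_space
  have hm := h.integrable_merit mu k
  have hG := fun i => integrable_norm_sq ((h.memLp_g k i).sub (h.memLp_v k i))
  have hP := fun i => integrable_norm_sq ((h.memLp_v k i).sub (h.memLp_gradient_localObj k i))
  have hPm := integrable_norm_sq (h.memLp_meanMomentum_sub k)
  have hGs := ((integrable_finsetSum Finset.univ fun i _ => hG i).const_mul (1 / (N : ℝ))).const_mul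
    (c₁ * γ / thetaC α)
  have hPs := ((integrable_finsetSum Finset.univ fun i _ => hP i).const_mul (1 / (N : ℝ))).const_mul
    (2 * c₁ * γ * η * betaC α / thetaC α)
  have hm' := hm.sub (integrable_const (meritInf (globalObj F D) mu ε))
  simp only [Pi.sub_apply] at hG hP hGs hPs
  unfold lyapunov compressionError momentumError meanMomentumError
  simp only
  rw [integral_add (by exact (hm'.add hGs).add hPs) (by exact hPm.const_mul _),
    integral_add (by exact hm'.add hGs) hPs, integral_add (by exact hm') hGs,
    integral_sub hm (integrable_const _), integral_const, probReal_univ, one_smul,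
    integral_const_mul, integral_const_mul, integral_const_mul, integral_const_mul,
    integral_const_mul, integral_finsetSum _ fun i _ => hG i,
    integral_finsetSum _ fun i _ => hP i]
  ring

/-- Pointwise decrease of the merit function in one round, with the displacement term that the
error recursions consume. -/
lemma merit_step_le (h : 𝓗) {mu Lm a : ℝ} (hmu : muBound ε lam L L' ≤ mu)
    (hLm : meritCurvature L L' mu ≤ Lm ∨ SmoothOnSafe (merit (globalObj F D) mu) ε Lm)
    (hc0 : 0 ≤ Lm / 2 * γ + a * γ ^ 2) (hc1 : Lm / 2 * γ + a * γ ^ 2 ≤ 1 / 4)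
    (hc2 : (Lm / 2 * γ + a * γ ^ 2) * (8 * lam * (1 + ε)) ≤ mu) (k : ℕ) (ω : Ω) :
    merit (globalObj F D) mu (𝒮 (k + 1) ω).X
        + γ * a * ‖(𝒮 (k + 1) ω).X - (𝒮 k ω).X‖ ^ 2
      ≤ merit (globalObj F D) mu (𝒮 k ω).X
        - γ * (1 / 4 * ‖rGrad (𝒮 k ω).X (gradient (globalObj F D) (𝒮 k ω).X)‖ ^ 2
          + lam * mu / 2 * penalty (𝒮 k ω).X)
        + γ * ‖(𝒮 k ω).gm - gradient (globalObj F D) (𝒮 k ω).X‖ ^ 2 := by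
  have hX := h.X_mem k ω
  have hlam := h.lam_pos
  have hγ := h.gamma_pos
  have hstep := merit_landing_step_le h.eps_pos h.eps_lt h.lam_pos h.L_nonneg h.bound_pos hmu
    h.differentiable_globalObj h.lipschitz (fun X hX => h.norm_gradient_globalObj_le hX) hLm
    h.gamma_pos h.gamma_le hX (norm_clip_le h.bound_pos.le (𝒮 k ω).gm)
  have hclip := norm_clip_sub_le (h.norm_gradient_globalObj_le hX) (𝒮 k ω).gm
  have hΛ := norm_landingDir_sq lam (𝒮 k ω).X (clip L' (𝒮 k ω).gm)
  have hx := opSqBound_of_mem hX p (defect (𝒮 k ω).X)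
  have hpen : ‖ofM (defect (𝒮 k ω).X)‖ ^ 2 = 4 * penalty (𝒮 k ω).X := by
    unfold penalty
    ring
  have hpen0 := penalty_nonneg (𝒮 k ω).X
  have hd : ‖(𝒮 (k + 1) ω).X - (𝒮 k ω).X‖ ^ 2
      = γ ^ 2 * ‖landingDir lam (𝒮 k ω).X (clip L' (𝒮 k ω).gm)‖ ^ 2 := by
    rw [path_succ_X, sub_sub_cancel_left, norm_neg, norm_smul, mul_pow, Real.norm_eq_abs, sq_abs]
  rw [hpen] at hx
  rw [hd, path_succ_X]
  have hclip2 : ‖clip L' (𝒮 k ω).gm - gradient (globalObj F D) (𝒮 k ω).X‖ ^ 2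
      ≤ ‖(𝒮 k ω).gm - gradient (globalObj F D) (𝒮 k ω).X‖ ^ 2 := by gcongr
  set ψ := ‖rGrad (𝒮 k ω).X (clip L' (𝒮 k ω).gm)‖ ^ 2
  have hψ0 : 0 ≤ ψ := sq_nonneg _
  set c := Lm / 2 * γ + a * γ ^ 2 with hc
  set pen := penalty (𝒮 k ω).X
  set Λ := ‖landingDir lam (𝒮 k ω).X (clip L' (𝒮 k ω).gm)‖ ^ 2
  set x := ‖ofM (toM (𝒮 k ω).X * defect (𝒮 k ω).X)‖ ^ 2
  have h1 : c * Λ ≤ 1 / 4 * ψ + lam * mu / 2 * pen := by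
    calc c * Λ = c * ψ + c * lam ^ 2 * x := by rw [hΛ]; ring
      _ ≤ 1 / 4 * ψ + c * lam ^ 2 * ((1 + ε) * (4 * pen)) := by gcongr
      _ = 1 / 4 * ψ + lam / 2 * (c * (8 * lam * (1 + ε))) * pen := by ring
      _ ≤ 1 / 4 * ψ + lam / 2 * mu * pen := by gcongr
      _ = _ := by ring
  have h2 := mul_le_mul_of_nonneg_left h1 hγ.le
  have h3 := mul_le_mul_of_nonneg_left hclip2 hγ.le
  rw [hc] at h2
  linarith

/-- One round decreases the mean Lyapunov function. -/
lemma lyapunov_step_le (h : 𝓗) {mu Lm c₁ c₂ : ℝ} (hmu : muBound ε lam L L' ≤ mu)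
    (hLm0 : 0 < Lm)
    (hLm : meritCurvature L L' mu ≤ Lm ∨ SmoothOnSafe (merit (globalObj F D) mu) ε Lm)
    (hc : CaseConstants η σ α c₁ c₂)
    (hγ₁ : γ ≤ stepOne (stepA α η L (avgSmooth Li) c₁ c₂) Lm)
    (hγ₂ : γ ≤ stepTwo ε lam mu (stepA α η L (avgSmooth Li) c₁ c₂) Lm) (k : ℕ) :
    ∫ ω, lyapunov F D ε mu α η γ c₁ c₂ (𝒮 (k + 1) ω) ∂P
      + γ * (1 / 4 * ∫ ω, ‖rGrad (𝒮 k ω).X (gradient (globalObj F D) (𝒮 k ω).X)‖ ^ 2 ∂P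
        + lam * mu / 2 * ∫ ω, penalty (𝒮 k ω).X ∂P)
      ≤ ∫ ω, lyapunov F D ε mu α η γ c₁ c₂ (𝒮 k ω) ∂P
        + γ * (c₁ * η ^ 2 * (1 - α) * σ ^ 2 / thetaC α
          + 2 * c₁ * η ^ 3 * betaC α * σ ^ 2 / thetaC α + c₂ * η * σ ^ 2 / N) := by
  have hγ := h.gamma_pos
  have hlam := h.lam_pos
  have hε := h.eps_pos
  have hα := h.compressor.factor_le_one
  obtain ⟨hc₁, hc₂⟩ := caseConstants_nonneg hc
  have hmu0 : 0 < mu :=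
    (muBound_pos hε h.eps_lt hlam h.L_nonneg h.bound_pos).trans_le hmu
  have ha0 : 0 ≤ stepA α η L (avgSmooth Li) c₁ c₂ :=
    stepA_nonneg hα h.eta_pos h.eta_le hc₁ hc₂ h.theta_pos
  set a := stepA α η L (avgSmooth Li) c₁ c₂ with ha
  have hs1 : Lm / 2 * γ + a * γ ^ 2 ≤ 1 / 4 := step_coefficient_le hLm0 ha0 hγ hγ₁
  have hs2 : (Lm / 2 * γ + a * γ ^ 2) * (8 * lam * (1 + ε)) ≤ mu := by
    -- `stepTwo` is `stepOne` for the parameters scaled by `2 * lam * (1 + ε) / mu`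
    have h1 := step_coefficient_le (a := 2 * lam * (1 + ε) * a / mu)
      (Lm := 2 * lam * (1 + ε) * Lm / mu) (by positivity) (by positivity) hγ (by
        refine hγ₂.trans (le_of_eq ?_)
        unfold stepTwo
        congr 2
        ring)
    have h2 : (Lm / 2 * γ + a * γ ^ 2) * (8 * lam * (1 + ε)) = 4 * mu *
        (2 * lam * (1 + ε) * Lm / mu / 2 * γ + 2 * lam * (1 + ε) * a / mu * γ ^ 2) := by
      field_simp
      ring
    rw [h2]
    nlinarith
  have hpoint := h.merit_step_le hmu hLm (by positivity) hs1 hs2 k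
  -- the decrease of the merit function in expectation
  have hI := h.integrable_step k
  have hm := h.integrable_merit mu k
  have hm' := h.integrable_merit mu (k + 1)
  have hφ := h.integrable_rGrad_sq k
  have hpen := h.integrable_penalty k
  have he := integrable_norm_sq (h.memLp_gm_sub k)
  have hint := integral_mono (by exact hm'.add (hI.const_mul (γ * a)))
    (by exact (hm.sub (((hφ.const_mul (1 / 4)).add (hpen.const_mul (lam * mu / 2))).const_mul
      γ)).add (he.const_mul γ)) hpoint
  rw [integral_add hm' (hI.const_mul _), integral_const_mul,
    integral_add (by exact hm.sub (((hφ.const_mul (1 / 4)).add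
      (hpen.const_mul (lam * mu / 2))).const_mul γ)) (he.const_mul γ),
    integral_sub hm (by exact ((hφ.const_mul (1 / 4)).add
      (hpen.const_mul (lam * mu / 2))).const_mul γ), integral_const_mul, integral_const_mul,
    integral_add (hφ.const_mul (1 / 4)) (hpen.const_mul (lam * mu / 2)), integral_const_mul,
    integral_const_mul] at hint
  -- the recursions of the errors, averaged over the nodes
  set d := ∫ ω, ‖(𝒮 (k + 1) ω).X - (𝒮 k ω).X‖ ^ 2 ∂P with hd
  have hd0 : 0 ≤ d := integral_nonneg fun ω => sq_nonneg _
  have hN : (0 : ℝ) < N := by exact_mod_cast h.nodes_pos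
  have hNinv : 1 / (N : ℝ) * N = 1 := by field_simp
  have hLt : avgSmooth Li ^ 2 = 1 / (N : ℝ) * ∑ i, Li i ^ 2 := by
    unfold avgSmooth
    exact Real.sq_sqrt (by positivity)
  have hG : 1 / (N : ℝ) * ∑ i, compressionError P (𝒮 (k + 1)) i
      ≤ (1 - thetaC α) * (1 / (N : ℝ) * ∑ i, compressionError P (𝒮 k) i)
        + betaC α * η ^ 2 * (2 * (1 / (N : ℝ) * ∑ i, momentumError F D P (𝒮 k) i)
          + 2 * avgSmooth Li ^ 2 * d) + (1 - α) * η ^ 2 * σ ^ 2 := by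
    have h1 := mul_le_mul_of_nonneg_left (Finset.sum_le_sum fun i (_ : i ∈ Finset.univ) =>
      h.compressionError_recursion k i) (by positivity : 0 ≤ 1 / (N : ℝ))
    refine h1.trans (le_of_eq ?_)
    simp only [Finset.sum_add_distrib, ← Finset.mul_sum, ← Finset.sum_mul, Finset.sum_const,
      Finset.card_univ, Fintype.card_fin, nsmul_eq_mul]
    rw [hLt, ← hd]
    linear_combination ((1 - α) * η ^ 2 * σ ^ 2) * hNinv
  have hP : 1 / (N : ℝ) * ∑ i, momentumError F D P (𝒮 (k + 1)) i
      ≤ (1 - η) * (1 / (N : ℝ) * ∑ i, momentumError F D P (𝒮 k) i)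
        + (1 - η) ^ 2 / η * (avgSmooth Li ^ 2 * d) + η ^ 2 * σ ^ 2 := by
    have h1 := mul_le_mul_of_nonneg_left (Finset.sum_le_sum fun i (_ : i ∈ Finset.univ) =>
      h.momentumError_recursion k i) (by positivity : 0 ≤ 1 / (N : ℝ))
    refine h1.trans (le_of_eq ?_)
    simp only [Finset.sum_add_distrib, ← Finset.mul_sum, ← Finset.sum_mul, Finset.sum_const,
      Finset.card_univ, Fintype.card_fin, nsmul_eq_mul]
    rw [hLt, ← hd]
    linear_combination (η ^ 2 * σ ^ 2) * hNinv
  have herr := weighted_errors_le hα h.eta_pos hγ hc₁ hc₂ h.theta_pos hd0 hG hP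
    (h.meanMomentumError_recursion k)
  have hgm := mul_le_mul_of_nonneg_left (h.gm_error_le hc k) hγ.le
  rw [h.integral_lyapunov, h.integral_lyapunov]
  linarith

lemma compressionError_nonneg (s : Ω → State n p N) (i : Fin N) : 0 ≤ compressionError P s i :=
  integral_nonneg fun _ => sq_nonneg _

lemma momentumError_nonneg (s : Ω → State n p N) (i : Fin N) : 0 ≤ momentumError F D P s i :=
  integral_nonneg fun _ => sq_nonneg _

/-- The mean Lyapunov function is nonnegative because the merit function is bounded below. -/
lemma integral_lyapunov_nonneg (h : 𝓗) {mu c₁ c₂ : ℝ} (hmu : 0 ≤ mu)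
    (hb : LowerBounded F D ε) (hc : CaseConstants η σ α c₁ c₂) (k : ℕ) :
    0 ≤ ∫ ω, lyapunov F D ε mu α η γ c₁ c₂ (𝒮 k ω) ∂P := by
  have := h.prob_space
  obtain ⟨hc₁, hc₂⟩ := caseConstants_nonneg hc
  have hγ := h.gamma_pos
  have hη := h.eta_pos
  have hθ := h.theta_pos
  have hβ : 0 ≤ betaC α := div_nonneg (by linarith [h.compressor.factor_le_one]) hθ.le
  have h1 : meritInf (globalObj F D) mu ε ≤ ∫ ω, merit (globalObj F D) mu (𝒮 k ω).X ∂P := by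
    have := integral_mono (integrable_const (meritInf (globalObj F D) mu ε))
      (h.integrable_merit mu k) fun ω => meritInf_le h.eps_lt hmu
        (fun X hX => h.norm_gradient_globalObj_le hX) hb (h.X_mem k ω)
    simpa using this
  have h2 : 0 ≤ ∑ i, compressionError P (𝒮 k) i :=
    Finset.sum_nonneg fun i _ => compressionError_nonneg _ i
  have h3 : 0 ≤ ∑ i, momentumError F D P (𝒮 k) i :=
    Finset.sum_nonneg fun i _ => momentumError_nonneg _ i
  have h4 : 0 ≤ meanMomentumError F D P (𝒮 k) := integral_nonneg fun _ => sq_nonneg _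
  rw [h.integral_lyapunov]
  have h5 : 0 ≤ c₁ * γ / thetaC α * (1 / (N : ℝ) * ∑ i, compressionError P (𝒮 k) i)
      + 2 * c₁ * γ * η * betaC α / thetaC α * (1 / (N : ℝ) * ∑ i, momentumError F D P (𝒮 k) i)
      + c₂ * γ / η * meanMomentumError F D P (𝒮 k) :=
    add_nonneg (add_nonneg
      (mul_nonneg (by positivity) (mul_nonneg (by positivity) h2))
      (mul_nonneg (by positivity) (mul_nonneg (by positivity) h3)))
      (mul_nonneg (by positivity) h4)
  linarith

/-- Telescoping the Lyapunov inequality. -/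
lemma convergence (h : 𝓗) {mu Lm c₁ c₂ : ℝ} (hmu : muBound ε lam L L' ≤ mu)
    (hb : LowerBounded F D ε) (hLm0 : 0 < Lm)
    (hLm : meritCurvature L L' mu ≤ Lm ∨ SmoothOnSafe (merit (globalObj F D) mu) ε Lm)
    (hc : CaseConstants η σ α c₁ c₂)
    (hγ₁ : γ ≤ stepOne (stepA α η L (avgSmooth Li) c₁ c₂) Lm)
    (hγ₂ : γ ≤ stepTwo ε lam mu (stepA α η L (avgSmooth Li) c₁ c₂) Lm) {K : ℕ} (hK : 0 < K) :
    1 / (4 * (K : ℝ)) * ∑ k ∈ Finset.range K,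
          ∫ ω, ‖rGrad (𝒮 k ω).X (gradient (globalObj F D) (𝒮 k ω).X)‖ ^ 2 ∂P
        + lam * mu / (2 * (K : ℝ)) * ∑ k ∈ Finset.range K, ∫ ω, penalty (𝒮 k ω).X ∂P
      ≤ (∫ ω, lyapunov F D ε mu α η γ c₁ c₂ (𝒮 0 ω) ∂P) / (γ * K)
        + c₁ * η ^ 2 * (1 - α) * σ ^ 2 / thetaC α
        + 2 * c₁ * η ^ 3 * betaC α * σ ^ 2 / thetaC α
        + c₂ * η * σ ^ 2 / N := by
  have hγ := h.gamma_pos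
  have hK' : (0 : ℝ) < K := by exact_mod_cast hK
  have hmu0 : 0 < mu :=
    (muBound_pos h.eps_pos h.eps_lt h.lam_pos h.L_nonneg h.bound_pos).trans_le hmu
  set ℓ : ℕ → ℝ := fun k => ∫ ω, lyapunov F D ε mu α η γ c₁ c₂ (𝒮 k ω) ∂P with hℓ
  set φ : ℕ → ℝ := fun k =>
    ∫ ω, ‖rGrad (𝒮 k ω).X (gradient (globalObj F D) (𝒮 k ω).X)‖ ^ 2 ∂P with hφ
  set ν : ℕ → ℝ := fun k => ∫ ω, penalty (𝒮 k ω).X ∂P with hν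
  set s := c₁ * η ^ 2 * (1 - α) * σ ^ 2 / thetaC α
    + 2 * c₁ * η ^ 3 * betaC α * σ ^ 2 / thetaC α + c₂ * η * σ ^ 2 / N with hs
  have hstep : ∀ k, γ * (1 / 4 * φ k + lam * mu / 2 * ν k) ≤ ℓ k - ℓ (k + 1) + γ * s := by
    intro k
    have := h.lyapunov_step_le hmu hLm0 hLm hc hγ₁ hγ₂ k
    linarith
  have hsum : γ * (1 / 4 * ∑ k ∈ Finset.range K, φ k + lam * mu / 2 * ∑ k ∈ Finset.range K, ν k)
      ≤ ℓ 0 - ℓ K + K * (γ * s) := by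
    have h1 := Finset.sum_le_sum fun k (_ : k ∈ Finset.range K) => hstep k
    rw [Finset.sum_add_distrib, Finset.sum_range_sub', Finset.sum_const, Finset.card_range,
      nsmul_eq_mul, ← Finset.mul_sum, Finset.sum_add_distrib, ← Finset.mul_sum,
      ← Finset.mul_sum] at h1
    exact h1
  have hK0 : 0 ≤ ℓ K := h.integral_lyapunov_nonneg hmu0.le hb hc K
  calc 1 / (4 * (K : ℝ)) * ∑ k ∈ Finset.range K, φ k
        + lam * mu / (2 * (K : ℝ)) * ∑ k ∈ Finset.range K, ν k
      = γ * (1 / 4 * ∑ k ∈ Finset.range K, φ k + lam * mu / 2 * ∑ k ∈ Finset.range K, ν k)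
        / (γ * K) := by field_simp
    _ ≤ (ℓ 0 + K * (γ * s)) / (γ * K) := by
        gcongr
        linarith
    _ = ℓ 0 / (γ * K) + s := by field_simp
    _ = _ := by rw [hs]; ring

end RunAssumptions

end Lyapunov

end EFLanding

theorem theorem1
    (ε lam mu L L' : ℝ) (hε : 0 < ε) (hε' : ε < 3 / 4) (hlam : 0 < lam)
    (hL : 0 ≤ L) (hL' : 0 < L') (hmu : muBound ε lam L L' ≤ mu) :
    ∃ M : ℝ, 0 < M ∧
      ∀ (n p N : ℕ) (_ : 0 < N)
        (Ξ : Type*) [MeasurableSpace Ξ] (S : Type*) [MeasurableSpace S]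
        (Ω : Type*) [MeasurableSpace Ω] (P : Measure Ω) [IsProbabilityMeasure P]
        -- the problem
        (F : Mat n p → Ξ → ℝ) (D : Fin N → Measure Ξ) [∀ i, IsProbabilityMeasure (D i)]
        (Li : Fin N → ℝ) (σ : ℝ) (_ : 0 ≤ σ)
        (_ : WellPosed F D ε)
        (_ : GradientBound F D ε L')
        (_ : LocalSmoothness F D ε Li)
        (_ : GradLipschitz (globalObj F D) ε L)
        (_ : LowerBounded F D ε)
        (_ : UnbiasedBoundedVariance F D ε σ)
        -- the compressor
        (C : Mat n p → S → Mat n p) (ρ : Measure S) [IsProbabilityMeasure ρ] (α : ℝ)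
        (_ : ContractiveCompressor C ρ α)
        -- the randomness and the parameters of the run
        (ξ : Fin N → ℕ → Ω → Ξ) (ζ : ℕ → Ω → Fin N → S) (_ : Sampling P D ρ ξ ζ)
        (X₀ : Mat n p) (_ : X₀ ∈ safeRegion n p ε)
        (η : ℝ) (_ : 0 < η) (_ : η ≤ 1)
        (c₁ c₂ : ℝ) (_ : CaseConstants η σ α c₁ c₂)
        -- the step size
        (Lm : ℝ) (_ : 0 < Lm) (_ : M ≤ Lm ∨ SmoothOnSafe (merit (globalObj F D) mu) ε Lm)
        (γ : ℝ) (_ : 0 < γ)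
        (_ : γ ≤ min (stepSafe ε lam L')
          (min (stepOne (stepA α η L (avgSmooth Li) c₁ c₂) Lm)
            (stepTwo ε lam mu (stepA α η L (avgSmooth Li) c₁ c₂) Lm)))
        (K : ℕ) (_ : 0 < K),
        let st : ℕ → Ω → State n p N := fun k ω =>
          run F C lam η γ L' X₀ (fun i j => ξ i j ω) (fun j => ζ j ω) k
        1 / (4 * (K : ℝ)) * ∑ k ∈ Finset.range K,
              ∫ ω, ‖rGrad (st k ω).X (gradient (globalObj F D) (st k ω).X)‖ ^ 2 ∂P
            + lam * mu / (2 * (K : ℝ)) * ∑ k ∈ Finset.range K, ∫ ω, penalty (st k ω).X ∂P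
          ≤ (∫ ω, lyapunov F D ε mu α η γ c₁ c₂ (st 0 ω) ∂P) / (γ * K)
            + c₁ * η ^ 2 * (1 - α) * σ ^ 2 / thetaC α
            + 2 * c₁ * η ^ 3 * betaC α * σ ^ 2 / thetaC α
            + c₂ * η * σ ^ 2 / N := by
  refine ⟨meritCurvature L L' mu, ?_, ?_⟩
  · have := (muBound_pos hε hε' hlam hL hL').trans_le hmu
    unfold meritCurvature
    positivity
  · intro n p N hN Ξ _ S _ Ω _ P hP F D hD Li σ _ hwell hbound hsmooth hlip hlow hunb C ρ hρ α
      hcomp ξ ζ hsamp X₀ hX₀ η hη hη' c₁ c₂ hc Lm hLm0 hLm γ hγ hγs K hK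
    have h : RunAssumptions F D Li ε L L' σ C ρ α P ξ ζ X₀ lam η γ :=
      ⟨hP, hD, hρ, hε, hε', hlam, hL, hL', hN, hwell, hbound, hsmooth, hlip, hunb, hcomp, hsamp,
        hX₀, hη, hη', hγ, hγs.trans (min_le_left _ _)⟩
    exact h.convergence hmu hlow hLm0 hLm hc
      (hγs.trans ((min_le_right _ _).trans (min_le_left _ _)))
      (hγs.trans ((min_le_right _ _).trans (min_le_right _ _))) hK
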